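/- An instance of the PD-matching problem consists of $n$ jobs, $m$ machines, and an integer tolerance $b(j,i)\ge 0$ for every job $j$ and machine $i$. A PD-matching is a set $M$ of pairs $(j,i)$ such that every job occurs in at most one pair of $M$ and, for every $(j,i)\in M$, the number of jobs matched to machine $i$ in $M$ is at most $b(j,i)$. Let $\mathcal T=\{b(j,i) : 1\le j\le n,\ 1\le i\le m\}$ be the set of tolerances of the instance. On instances with $\mathcal T=\{0,k\}$ for some integer $k\ge 0$ or with $\mathcal T=\{1,2\}$, a PD-matching of maximum cardinality can be found in polynomial time. More precisely, there is one algorithm (a program of a unit-cost random access machine whose arithmetic is addition and truncated subtraction) that, for every such instance, $k$ being part of the input, outputs a PD-matching of maximum cardinality in time polynomial in the length of the binary encoding of the instance. -/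

import Mathlib

/-! ### PD-matching -/

/-- An instance: `n` jobs, `m` machines and the matrix of tolerances `b j i` of job `j` on
machine `i`. -/
structure PDInstance where
  n : ℕ
  m : ℕ
  b : Fin n → Fin m → ℕ

namespace PDInstance

/-- The set of all tolerances that occur in the instance. -/
def toleranceSet (I : PDInstance) : Set ℕ := {t | ∃ j i, I.b j i = t}

/-- The set of jobs matched to machine `i`. -/
def jobsOn (I : PDInstance) (M : Finset (Fin I.n × Fin I.m)) (i : Fin I.m) : Finset (Fin I.n) :=
  Finset.univ.filter (fun j => (j, i) ∈ M)

/-- The degree of machine `i` in `M`. -/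
def deg (I : PDInstance) (M : Finset (Fin I.n × Fin I.m)) (i : Fin I.m) : ℕ :=
  (I.jobsOn M i).card

/-- `M` is a PD-matching: every job lies on at most one edge of `M`, and the degree of a machine
does not exceed the tolerance of any job matched to it. -/
def IsPDMatching (I : PDInstance) (M : Finset (Fin I.n × Fin I.m)) : Prop :=
  (∀ j i i', (j, i) ∈ M → (j, i') ∈ M → i = i') ∧ ∀ j i, (j, i) ∈ M → I.deg M i ≤ I.b j i

/-- `M` is a PD-matching of maximum cardinality. -/
def IsMaximumPDMatching (I : PDInstance) (M : Finset (Fin I.n × Fin I.m)) : Prop :=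
  I.IsPDMatching M ∧ ∀ M', I.IsPDMatching M' → M'.card ≤ M.card

/-- The length of the instance written in binary, with one separator after every number. -/
def bitSize (I : PDInstance) : ℕ :=
  (Nat.size I.n + 1) + (Nat.size I.m + 1) + ∑ j, ∑ i, (Nat.size (I.b j i) + 1)

end PDInstance

/-! ### Random access machine

Structured programs of a unit-cost random access machine. The only arithmetic is addition and
truncated subtraction, so the bit length of the numbers grows by at most one per step, and
polynomial time in the bit length of the input is polynomial time on Turing machines. -/

namespace RAM

/-- The memory consists of arrays `s 0, s 1, …` of natural numbers. Array names are constants in a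
program, so a program touches finitely many arrays; indices are computed. -/
abbrev Memory := ℕ → ℕ → ℕ

/-- Expressions: constants, array cells, sums and truncated differences. -/
inductive Expr where
  | const (c : ℕ)
  | get (a : ℕ) (idx : Expr)
  | add (x y : Expr)
  | sub (x y : Expr)

namespace Expr

/-- The value of an expression. -/
def eval (s : Memory) : Expr → ℕ
  | const c => c
  | get a idx => s a (idx.eval s)
  | add x y => x.eval s + y.eval s
  | sub x y => x.eval s - y.eval s

/-- The number of steps needed to evaluate an expression: one per operation. -/
def cost : Expr → ℕ
  | const _ => 1
  | get _ idx => idx.cost + 1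
  | add x y => x.cost + y.cost + 1
  | sub x y => x.cost + y.cost + 1

end Expr

/-- Programs. A condition is an expression; it holds if its value is nonzero. -/
inductive Prog where
  | nop
  | put (a : ℕ) (idx val : Expr)
  | seq (P Q : Prog)
  | ite (cond : Expr) (P Q : Prog)
  | loop (cond : Expr) (P : Prog)

/-- The memory `s` after storing `v` in cell `i` of array `a`. -/
def Memory.store (s : Memory) (a i v : ℕ) : Memory :=
  fun a' i' => if a' = a ∧ i' = i then v else s a' i'

/-- `Runs P s t s'`: started on memory `s`, the program `P` halts after exactly `t` steps with
memory `s'`. -/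
inductive Runs : Prog → Memory → ℕ → Memory → Prop where
  | nop (s : Memory) : Runs .nop s 1 s
  | put (s : Memory) (a : ℕ) (idx val : Expr) :
      Runs (.put a idx val) s (idx.cost + val.cost + 1) (s.store a (idx.eval s) (val.eval s))
  | seq {P Q : Prog} {s s' s'' : Memory} {t t' : ℕ} :
      Runs P s t s' → Runs Q s' t' s'' → Runs (.seq P Q) s (t + t') s''
  | ite_true {c : Expr} {P Q : Prog} {s s' : Memory} {t : ℕ} :
      c.eval s ≠ 0 → Runs P s t s' → Runs (.ite c P Q) s (c.cost + 1 + t) s'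
  | ite_false {c : Expr} {P Q : Prog} {s s' : Memory} {t : ℕ} :
      c.eval s = 0 → Runs Q s t s' → Runs (.ite c P Q) s (c.cost + 1 + t) s'
  | loop_done {c : Expr} {P : Prog} {s : Memory} :
      c.eval s = 0 → Runs (.loop c P) s (c.cost + 1) s
  | loop_step {c : Expr} {P : Prog} {s s' s'' : Memory} {t t' : ℕ} :
      c.eval s ≠ 0 → Runs P s t s' → Runs (.loop c P) s' t' s'' →
        Runs (.loop c P) s (c.cost + 1 + t + t') s''

end RAM

namespace PDInstance

/-- The input: array 0 holds `n` in cell 0, array 1 holds `m` in cell 0, array 2 holds the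
tolerance matrix row by row, i.e. `b j i` in cell `j * m + i`. All other cells are 0. -/
def input (I : PDInstance) : RAM.Memory := fun a c =>
  if a = 0 then (if c = 0 then I.n else 0)
  else if a = 1 then (if c = 0 then I.m else 0)
  else if a = 2 then ∑ j, ∑ i, (if c = j.val * I.m + i.val then I.b j i else 0)
  else 0

/-- The output: array 3 holds the indicator matrix of the edge set `M` row by row. -/
def IsOutput (I : PDInstance) (M : Finset (Fin I.n × Fin I.m)) (s : RAM.Memory) : Prop :=
  ∀ (j : Fin I.n) (i : Fin I.m), s 3 (j.val * I.m + i.val) = if (j, i) ∈ M then 1 else 0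

end PDInstance

/-- On the instances of the class `C`, a maximum PD-matching can be found in polynomial time: one
program and one polynomial work for all instances of the class. -/
def MaxPDMatchingInPolyTime (C : Set PDInstance) : Prop :=
  ∃ (P : RAM.Prog) (p : Polynomial ℕ), ∀ I ∈ C, ∃ (t : ℕ) (s : RAM.Memory),
    RAM.Runs P I.input t s ∧ t ≤ p.eval I.bitSize ∧
      ∃ M : Finset (Fin I.n × Fin I.m), I.IsMaximumPDMatching M ∧ I.IsOutput M s

/-! Both classes reduce to one maximum matching problem in a general graph, `copyGraph`. A machine
is replaced by copies, as many as the largest tolerance `K` but at most `n + 1`, so that the graph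
stays polynomial even when `k` is exponential in the input length. A job is joined to the copies of
the machines on which its tolerance is `K`.

If a zero tolerance occurs, the tolerances are `0` and `K`, the copies are independent, and a
matching of the graph is the same as a PD-matching: a job cannot use a machine on which its
tolerance is `0`, and elsewhere the only restriction is degree at most `K`
(`isMaximumPDMatching_of_zero`).

For tolerances `1` and `2` every machine has two copies, and these are joined. A machine with two
jobs uses two job edges; any other machine uses the edge between its copies, which stands for the
one job that it can always accept. So a PD-matching yields a graph matching with at least as many
edges (`exists_mate_of_isPDMatching_two`). Conversely, let `d` machines have both copies matched to
jobs. Keep these jobs, and give the others greedily to unused machines, one each. Either every job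
is placed, or at least `m + d` are. Charging missed vertices shows that the graph matching has at
most `m + d` edges (`le_miss_add_double`), hence optimality (`isMaximumPDMatching_of_one_two`).

The maximum matching is found without shrinking blossoms. The algorithm keeps a number `c` and a set
`D` of vertices, each with a stored matching that misses it and misses at most `c` vertices in all.
Let `A` be the set of neighbours of `D` outside `D`. The basic move is `exchange`: a matching `W` is
made to miss a given `t` in `D` by swapping it, along an alternating path, with the stored matching
of `t`. Either the stored matching improves, or it now misses the vertex `z` that `W` has gained; if
`z` is new, `D` grows, and otherwise `W` has traded one missed vertex of `D` for another.

One attempt deletes the edges at `A` from the current matching, moves the missed vertices around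
inside the components of `D`, joins two of them when they become adjacent, and finally rematches `A`
into `D`. If none of this makes progress, the thinned matching misses at least `c + 2|A|` vertices,
all in `A` or `D`, and at most one in each component of `D`. Components with a missed vertex are
odd, so `A` is a Tutte–Berge barrier and `c` is optimal (`optimal_of_barrier`, `attempt_spec`).
Progress lowers `c` or enlarges `D`, so quadratically many attempts suffice (`maxMatching_spec`).

The program is written in a language whose loops have fixed bounds. Its semantics is a total
function, and a polynomial time bound can be read off the syntax (`exists_runs`). -/

/-! ### Matchings as involutions

A matching of a graph `G` on the vertices `0, …, N - 1` is given by the function that maps a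
matched vertex to its partner and fixes the vertices that the matching misses. -/

/-- `f` is the partner function of a matching of `G` on the vertices below `N`. -/
def Mate (N : ℕ) (G : ℕ → ℕ → Prop) (f : ℕ → ℕ) : Prop :=
  ∀ x < N, f x < N ∧ f (f x) = x ∧ (f x ≠ x → G x (f x))

/-- The number of vertices missed by `f`. -/
def miss (N : ℕ) (f : ℕ → ℕ) : ℕ := ((Finset.range N).filter fun x => f x = x).card

section Matching

variable {N : ℕ} {G : ℕ → ℕ → Prop} {f g : ℕ → ℕ}

theorem Mate.congr (hf : Mate N G f) (h : ∀ x < N, g x = f x) : Mate N G g := by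
  intro x hx
  obtain ⟨h1, h2, h3⟩ := hf x hx
  rw [h x hx, h _ h1]
  exact ⟨h1, h2, h3⟩

theorem miss_congr (h : ∀ x < N, g x = f x) : miss N g = miss N f := by
  unfold miss
  congr 1
  apply Finset.filter_congr
  intro x hx
  rw [h x (Finset.mem_range.1 hx)]

/-- The missed set changes by replacing `z` with `t`. Only an inequality holds, because `t` may be
missed already or lie outside the range. -/
theorem miss_le_of_exchange {t z : ℕ} (hz : z < N) (hfz : f z = z)
    (h : ∀ y < N, g y = y ↔ y = t ∨ (f y = y ∧ y ≠ z)) : miss N g ≤ miss N f := by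
  unfold miss
  have hsub : (Finset.range N).filter (fun x => g x = x) ⊆
      insert t (((Finset.range N).filter fun x => f x = x).erase z) := by
    intro y hy
    simp only [Finset.mem_filter, Finset.mem_range, Finset.mem_insert, Finset.mem_erase] at *
    rcases (h y hy.1).1 hy.2 with h1 | h1
    · exact Or.inl h1
    · exact Or.inr ⟨h1.2, hy.1, h1.1⟩
  refine (Finset.card_le_card hsub).trans ((Finset.card_insert_le _ _).trans ?_)
  have hmem : z ∈ (Finset.range N).filter fun x => f x = x := by simp [hz, hfz]
  have := Finset.card_pos.2 ⟨z, hmem⟩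
  rw [Finset.card_erase_of_mem hmem]
  omega

/-! ### Alternating paths and exchanges -/

/-- The walk from `t` that alternates between the two matchings. -/
def alternatingWalk (f g : ℕ → ℕ) (t : ℕ) : ℕ → ℕ
  | 0 => t
  | i + 1 => g (f (alternatingWalk f g t i))

theorem alternatingWalk_lt (hf : Mate N G f) (hg : Mate N G g) {t : ℕ} (ht : t < N) (i : ℕ) :
    alternatingWalk f g t i < N := by
  induction i with
  | zero => exact ht
  | succ i ih => exact (hg _ (hf _ ih).1).1

/-- A step of the walk is injective below `N`, so a coincidence of two positions can be traced back
to the start. -/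
theorem alternatingWalk_cancel (hf : Mate N G f) (hg : Mate N G g) {t : ℕ} (ht : t < N)
    (i j : ℕ) (h : alternatingWalk f g t i = alternatingWalk f g t (i + j)) :
    alternatingWalk f g t j = t := by
  induction i with
  | zero => rw [Nat.zero_add] at h; exact h.symm
  | succ i ih =>
    apply ih
    rw [Nat.add_right_comm] at h
    have h1 := alternatingWalk_lt hf hg ht i
    have h2 := alternatingWalk_lt hf hg ht (i + j)
    have h3 : f (alternatingWalk f g t i) = f (alternatingWalk f g t (i + j)) := by
      have := congrArg g h
      simpa [alternatingWalk, (hg _ (hf _ h1).1).2.1, (hg _ (hf _ h2).1).2.1] using this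
    have := congrArg f h3
    rwa [(hf _ h1).2.1, (hf _ h2).2.1] at this

/-- The walk from an end of an alternating path is periodic, and both matchings act on its period
as reflections. -/
theorem exists_period (hf : Mate N G f) (hg : Mate N G g) {t : ℕ} (ht : t < N) (hgt : g t = t) :
    ∃ p, 0 < p ∧ p ≤ N ∧ (∀ i, alternatingWalk f g t (i + p) = alternatingWalk f g t i) ∧
      (∀ i < p, ∀ j < p, alternatingWalk f g t i = alternatingWalk f g t j → i = j) ∧
      (∀ i < p, f (alternatingWalk f g t i) = alternatingWalk f g t (p - 1 - i)) ∧
      (∀ i < p, 0 < i → g (alternatingWalk f g t i) = alternatingWalk f g t (p - i)) := by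
  classical
  set w := alternatingWalk f g t with hw
  have hlt := alternatingWalk_lt hf hg ht
  -- Pigeonhole: two of the first `N + 1` positions coincide, and cancelling their common steps
  -- leads back to `t`.
  have hex : ∃ p, 0 < p ∧ w p = t := by
    obtain ⟨i, -, j, -, hij, he⟩ := Finset.exists_ne_map_eq_of_card_lt_of_maps_to
      (s := Finset.range (N + 1)) (t := Finset.range N) (by simp) (f := w)
      (fun i _ => by simpa using hlt i)
    rcases lt_or_gt_of_ne hij with h | h
    · obtain ⟨d, rfl⟩ := Nat.exists_eq_add_of_lt h
      exact ⟨d + 1, by omega, alternatingWalk_cancel hf hg ht i (d + 1) he⟩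
    · obtain ⟨d, rfl⟩ := Nat.exists_eq_add_of_lt h
      exact ⟨d + 1, by omega, alternatingWalk_cancel hf hg ht j (d + 1) he.symm⟩
  obtain ⟨hp0, hpt⟩ := Nat.find_spec hex
  have hmin : ∀ q, 0 < q → w q = t → Nat.find hex ≤ q := fun q h1 h2 => Nat.find_min' hex ⟨h1, h2⟩
  set p := Nat.find hex
  have hinj : ∀ i < p, ∀ j < p, w i = w j → i = j := by
    intro i hi j hj h
    by_contra hne
    rcases lt_or_gt_of_ne hne with h' | h'
    · obtain ⟨d, rfl⟩ := Nat.exists_eq_add_of_lt h'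
      have := hmin (d + 1) (by omega) (alternatingWalk_cancel hf hg ht i (d + 1) h)
      omega
    · obtain ⟨d, rfl⟩ := Nat.exists_eq_add_of_lt h'
      have := hmin (d + 1) (by omega) (alternatingWalk_cancel hf hg ht j (d + 1) h.symm)
      omega
  have hpN : p ≤ N := by
    have := Finset.card_le_card_of_injOn (s := Finset.range p) (t := Finset.range N) w
      (fun i _ => by simpa using hlt i)
      (fun i hi j hj h => hinj i (by simpa using hi) j (by simpa using hj) h)
    simpa using this
  have hgf : ∀ i, g (w (i + 1)) = f (w i) := fun i => (hg _ (hf _ (hlt i)).1).2.1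
  -- The return to `t`, which `g` fixes, gives `f t = w (p - 1)`; the relation `g (w (i + 1)) = f (w
  -- i)` then carries the reflection along the orbit.
  have hrefl : ∀ i < p, f (w i) = w (p - 1 - i) := by
    intro i
    induction i with
    | zero =>
      intro _
      obtain ⟨q, hq⟩ := Nat.exists_eq_succ_of_ne_zero hp0.ne'
      have h1 := hgf q
      rw [← Nat.succ_eq_add_one, ← hq, hpt, hgt] at h1
      have h2 := (hf _ (hlt q)).2.1
      rw [← hw, ← h1] at h2
      rw [show p - 1 - 0 = q by omega]
      exact h2
    | succ i ih =>
      intro hi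
      have h1 := ih (by omega)
      obtain ⟨q, hq⟩ : ∃ q, p - 1 - i = q + 1 := ⟨p - 2 - i, by omega⟩
      rw [show p - 1 - (i + 1) = q by omega]
      have h2 : w (i + 1) = g (f (w i)) := rfl
      rw [h2, h1, hq, hgf q]
      exact (hf _ (hlt q)).2.1
  refine ⟨p, hp0, hpN, ?_, hinj, hrefl, ?_⟩
  · intro i
    induction i with
    | zero => rw [Nat.zero_add]; exact hpt
    | succ i ih =>
      rw [Nat.add_right_comm]
      change g (f (w (i + p))) = g (f (w i))
      rw [ih]
  · intro i hi h0
    obtain ⟨j, rfl⟩ := Nat.exists_eq_succ_of_ne_zero h0.ne'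
    rw [Nat.succ_eq_add_one, hgf j, hrefl j (by omega)]
    congr 1
    omega

/-- Both involutions preserve `S`, hence also its complement, so neither matching has an edge across
the border. -/
theorem mate_piecewise (hf : Mate N G f) (hg : Mate N G g) (S : ℕ → Prop) [DecidablePred S]
    (hSf : ∀ x < N, S x → S (f x)) (hSg : ∀ x < N, S x → S (g x)) :
    Mate N G fun x => if S x then g x else f x := by
  intro x hx
  by_cases h : S x
  · obtain ⟨h1, h2, h3⟩ := hg x hx
    simp only [h, if_true, hSg x hx h]
    exact ⟨h1, h2, h3⟩
  · obtain ⟨h1, h2, h3⟩ := hf x hx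
    have h' : ¬ S (f x) := fun h' => h (h2 ▸ hSf _ h1 h')
    simp only [h, if_false, h']
    exact ⟨h1, h2, h3⟩

/-- Exchanging two matchings along the alternating path that starts at a vertex `t` missed by `g`:
either `g` improves, or the path ends in a vertex `z` missed by `f`. -/
theorem exchange (hf : Mate N G f) (hg : Mate N G g) {t : ℕ} (ht : t < N) (hgt : g t = t)
    (S : ℕ → Prop) [DecidablePred S]
    (hS : ∀ x, S x ↔ ∃ i < N, x = alternatingWalk f g t i ∨ x = f (alternatingWalk f g t i)) :
    Mate N G (fun x => if S x then g x else f x) ∧ Mate N G (fun x => if S x then f x else g x) ∧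
      (miss N (fun x => if S x then f x else g x) < miss N g ∨
        ∃ z < N, f z = z ∧ (if S z then f z else g z) = z ∧ (f t = t → z = t) ∧
          (∀ y < N, (if S y then g y else f y) = y ↔ y = t ∨ (f y = y ∧ y ≠ z)) ∧
          miss N (fun x => if S x then f x else g x) ≤ miss N g) := by
  obtain ⟨p, hp0, hpN, hper, hinj, hrf, hrg⟩ := exists_period hf hg ht hgt
  set w := alternatingWalk f g t with hw
  have hlt : ∀ i, w i < N := alternatingWalk_lt hf hg ht
  have hmod : ∀ i, ∃ j < p, w i = w j := by
    intro i
    refine ⟨i % p, Nat.mod_lt _ hp0, ?_⟩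
    conv_lhs => rw [← Nat.mod_add_div i p]
    generalize i / p = q
    induction q with
    | zero => simp
    | succ q ih => rw [Nat.mul_succ, ← Nat.add_assoc, hper, ih]
  -- One period of the walk already runs through the whole path: `N` is at least the period, and `f`
  -- only reflects it.
  have hS' : ∀ x, S x ↔ ∃ i < p, x = w i := by
    intro x
    rw [hS]
    constructor
    · rintro ⟨i, -, rfl | rfl⟩
      · exact hmod i
      · obtain ⟨j, hj, he⟩ := hmod i
        exact ⟨p - 1 - j, by omega, by rw [he, hrf j hj]⟩
    · rintro ⟨i, hi, rfl⟩
      exact ⟨i, by omega, Or.inl rfl⟩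
  have hSf : ∀ x < N, S x → S (f x) := by
    intro x _ h
    obtain ⟨i, hi, rfl⟩ := (hS' x).1 h
    exact (hS' _).2 ⟨p - 1 - i, by omega, hrf i hi⟩
  have hw0 : w 0 = t := rfl
  have hSg : ∀ x < N, S x → S (g x) := by
    intro x _ h
    obtain ⟨i, hi, rfl⟩ := (hS' x).1 h
    rcases Nat.eq_zero_or_pos i with rfl | h0
    · rw [hw0, hgt]; rwa [hw0] at h
    · exact (hS' _).2 ⟨p - i, by omega, hrg i hi h0⟩
  have hSt : S t := (hS' t).2 ⟨0, hp0, hw0.symm⟩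
  refine ⟨mate_piecewise hf hg S hSf hSg, mate_piecewise hg hf S hSg hSf, ?_⟩
  -- The path has `p` vertices. A vertex of it missed by `f` has `p - 1 = 2 * i`, so it is unique,
  -- and `p` is odd, so `t` is the only vertex of the path that `g` misses. If `f` misses none,
  -- giving its edges to `g` covers the whole path, in particular `t`.
  by_cases hz : ∃ z, S z ∧ f z = z
  · right
    obtain ⟨z, hzS, hfz⟩ := hz
    obtain ⟨i, hi, rfl⟩ := (hS' z).1 hzS
    have hii : p - 1 - i = i := by
      apply hinj _ (by omega) _ hi
      rw [← hrf i hi, hfz]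
    have huniq : ∀ y, S y → f y = y → y = w i := by
      intro y hy hfy
      obtain ⟨j, hj, rfl⟩ := (hS' y).1 hy
      have : p - 1 - j = j := by
        apply hinj _ (by omega) _ hj
        rw [← hrf j hj, hfy]
      congr 1
      omega
    have huniq' : ∀ y, S y → g y = y → y = t := by
      intro y hy hgy
      obtain ⟨j, hj, rfl⟩ := (hS' y).1 hy
      rcases Nat.eq_zero_or_pos j with rfl | h0
      · rfl
      · have : p - j = j := by
          apply hinj _ (by omega) _ hj
          rw [← hrg j hj h0, hgy]
        omega
    refine ⟨w i, hlt i, hfz, by rw [if_pos hzS, hfz], fun h => (huniq t hSt h).symm, ?_, ?_⟩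
    · intro y hy
      by_cases hSy : S y
      · rw [if_pos hSy]
        constructor
        · exact fun h => Or.inl (huniq' y hSy h)
        · rintro (rfl | ⟨h1, h2⟩)
          · exact hgt
          · exact absurd (huniq y hSy h1) h2
      · rw [if_neg hSy]
        constructor
        · exact fun h => Or.inr ⟨h, fun h' => hSy (h' ▸ hzS)⟩
        · rintro (rfl | ⟨h1, h2⟩)
          · exact absurd hSt hSy
          · exact h1
    · apply miss_le_of_exchange ht hgt (t := w i)
      intro y hy
      by_cases hSy : S y
      · rw [if_pos hSy]
        constructor
        · exact fun h => Or.inl (huniq y hSy h)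
        · rintro (rfl | ⟨h1, h2⟩)
          · exact hfz
          · exact absurd (huniq' y hSy h1) h2
      · rw [if_neg hSy]
        constructor
        · exact fun h => Or.inr ⟨h, fun h' => hSy (h' ▸ hSt)⟩
        · rintro (rfl | ⟨h1, h2⟩)
          · exact absurd hzS hSy
          · exact h1
  · left
    apply Finset.card_lt_card
    rw [Finset.ssubset_iff_of_subset]
    · refine ⟨t, by simp [ht, hgt], ?_⟩
      simp only [Finset.mem_filter, hSt, if_true, not_and]
      exact fun _ h => hz ⟨t, hSt, h⟩
    · intro y
      simp only [Finset.mem_filter]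
      rintro ⟨h1, h2⟩
      refine ⟨h1, ?_⟩
      by_cases hSy : S y
      · rw [if_pos hSy] at h2
        exact absurd ⟨y, hSy, h2⟩ hz
      · rwa [if_neg hSy] at h2

/-! ### Adding and deleting edges -/

/-- Adding an edge between two missed vertices. -/
def addEdge (f : ℕ → ℕ) (a b : ℕ) : ℕ → ℕ :=
  fun x => if x = b then a else if x = a then b else f x

theorem Mate.addEdge (hf : Mate N G f) {a b : ℕ} (ha : a < N) (hb : b < N) (hfa : f a = a)
    (hfb : f b = b) (hab : G a b) (hba : G b a) : Mate N G (addEdge f a b) := by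
  intro x hx
  unfold _root_.addEdge
  by_cases h1 : x = b
  · subst h1
    by_cases h2 : a = x
    · subst h2; simp [ha]
    · simp [ha, h2, hba]
  · by_cases h2 : x = a
    · subst h2; simp [h1, hb, hab]
    · obtain ⟨h3, h4, h5⟩ := hf x hx
      have h6 : f x ≠ b := fun h => h1 (by rw [← h4, h, hfb])
      have h7 : f x ≠ a := fun h => h2 (by rw [← h4, h, hfa])
      simp only [h1, h2, h6, h7, if_false]
      exact ⟨h3, h4, h5⟩

theorem addEdge_eq_self_iff {a b : ℕ} (hab : a ≠ b) (y : ℕ) :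
    addEdge f a b y = y ↔ f y = y ∧ y ≠ a ∧ y ≠ b := by
  unfold addEdge
  by_cases h1 : y = b
  · subst h1; simp [hab]
  · by_cases h2 : y = a
    · subst h2; simp [h1, Ne.symm hab]
    · simp [h1, h2]

theorem miss_addEdge {a b : ℕ} (ha : a < N) (hb : b < N) (hfa : f a = a)
    (hfb : f b = b) (hab : a ≠ b) : miss N (addEdge f a b) + 2 = miss N f := by
  unfold miss
  have : (Finset.range N).filter (fun x => addEdge f a b x = x) =
      (((Finset.range N).filter fun x => f x = x).erase a).erase b := by
    ext y
    simp only [Finset.mem_filter, Finset.mem_erase, addEdge_eq_self_iff hab]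
    tauto
  have hma : a ∈ (Finset.range N).filter fun x => f x = x := by simp [ha, hfa]
  have hmb : b ∈ ((Finset.range N).filter fun x => f x = x).erase a := by
    simp [hb, hfb, Ne.symm hab]
  have h1 := Finset.card_erase_add_one hma
  have h2 := Finset.card_erase_add_one hmb
  rw [this]
  omega

/-- The matching without the edges that meet `A`. -/
def isolate (A : ℕ → Prop) [DecidablePred A] (f : ℕ → ℕ) : ℕ → ℕ :=
  fun x => if A x ∨ A (f x) then x else f x

theorem Mate.isolate (hf : Mate N G f) (A : ℕ → Prop) [DecidablePred A] :
    Mate N G (isolate A f) := by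
  intro x hx
  obtain ⟨h1, h2, h3⟩ := hf x hx
  unfold _root_.isolate
  by_cases h : A x ∨ A (f x)
  · simp [h, hx]
  · have h' : ¬ (A (f x) ∨ A x) := by tauto
    simp only [h, if_false, h2, h']
    exact ⟨h1, trivial, h3⟩

/-- Isolating a vertex of `A` frees at most that vertex and its partner. -/
theorem miss_isolate_le (A : ℕ → Prop) [DecidablePred A] (hf : Mate N G f) :
    miss N (isolate A f) ≤ miss N f + 2 * ((Finset.range N).filter A).card := by
  have hsub : (Finset.range N).filter (fun x => isolate A f x = x) ⊆
      ((Finset.range N).filter fun x => f x = x) ∪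
        (((Finset.range N).filter A) ∪ ((Finset.range N).filter A).image f) := by
    intro x hx
    simp only [Finset.mem_filter, Finset.mem_range, Finset.mem_union, Finset.mem_image] at *
    obtain ⟨h1, h2⟩ := hx
    unfold isolate at h2
    split_ifs at h2 with h
    · rcases h with h | h
      · exact Or.inr (Or.inl ⟨h1, h⟩)
      · exact Or.inr (Or.inr ⟨f x, ⟨(hf x h1).1, h⟩, (hf x h1).2.1⟩)
    · exact Or.inl ⟨h1, h2⟩
  have h1 := Finset.card_le_card hsub
  have h2 := Finset.card_union_le ((Finset.range N).filter fun x => f x = x)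
    (((Finset.range N).filter A) ∪ ((Finset.range N).filter A).image f)
  have h3 := Finset.card_union_le ((Finset.range N).filter A) (((Finset.range N).filter A).image f)
  have h4 : (((Finset.range N).filter A).image f).card ≤ _ := Finset.card_image_le
  unfold miss
  omega

/-! ### Parity, components of `D` and the Tutte–Berge certificate -/

/-- The points moved by an involution cancel in pairs modulo two. -/
theorem card_cast_eq_fixed {K : Finset ℕ} (h : ∀ x ∈ K, f x ∈ K ∧ f (f x) = x) :
    (K.card : ZMod 2) = ((K.filter fun x => f x = x).card : ZMod 2) := by
  have h1 : ∑ x ∈ K.filter (fun x => ¬ f x = x), (1 : ZMod 2) = 0 := by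
    refine Finset.sum_involution (fun x _ => f x) ?_ ?_ ?_ ?_
    · intros; decide
    · intro x hx _
      exact (Finset.mem_filter.1 hx).2
    · intro x hx
      obtain ⟨h1, h2⟩ := Finset.mem_filter.1 hx
      refine Finset.mem_filter.2 ⟨(h x h1).1, ?_⟩
      rw [(h x h1).2]
      exact fun h => h2 h.symm
    · intro x hx
      exact (h x (Finset.mem_filter.1 hx).1).2
  have h2 := Finset.card_filter_add_card_filter_not (s := K) (fun x => f x = x)
  rw [← h2, Nat.cast_add]
  simp only [Finset.sum_const, nsmul_eq_mul, mul_one] at h1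
  rw [h1, add_zero]

/-- Reachability inside the set `D`. -/
def ReachIn (N : ℕ) (G : ℕ → ℕ → Prop) (D : ℕ → Prop) : ℕ → ℕ → Prop :=
  Relation.ReflTransGen fun x y => G x y ∧ D y ∧ y < N

theorem ReachIn.mem {D : ℕ → Prop} {u x : ℕ} (hu : u < N) (hD : D u) (h : ReachIn N G D u x) :
    x < N ∧ D x := by
  induction h with
  | refl => exact ⟨hu, hD⟩
  | tail _ h _ => exact ⟨h.2.2, h.2.1⟩

theorem ReachIn.symm {D : ℕ → Prop} (hG : ∀ x < N, ∀ y < N, G x y → G y x) {u x : ℕ} (hu : u < N)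
    (hD : D u) (h : ReachIn N G D u x) : ReachIn N G D x u := by
  induction h with
  | refl => exact Relation.ReflTransGen.refl
  | tail h1 h2 ih =>
    obtain ⟨h3, h4⟩ := ReachIn.mem hu hD h1
    exact Relation.ReflTransGen.head ⟨hG _ h3 _ h2.2.2 h2.1, h4, h3⟩ ih

/-- A matching is maximum if, after the removal of the neighbours `A` of `D`, it is perfect outside
`D` and misses at most one vertex of every component of `D`. -/
theorem optimal_of_barrier {D A : ℕ → Prop} [DecidablePred A] {c : ℕ} {H : ℕ → ℕ}
    (hG : ∀ x < N, ∀ y < N, G x y → G y x) (hH : Mate N G H)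
    (hA : ∀ a < N, A a ↔ ¬ D a ∧ ∃ d < N, D d ∧ G a d)
    (hHA : ∀ a < N, A a → H a = a)
    (hmiss : c + 2 * ((Finset.range N).filter A).card ≤ miss N H)
    (hD : ∀ x < N, H x = x → A x ∨ D x)
    (halone : ∀ u < N, D u → H u = u → ∀ x, ReachIn N G D u x → H x = x → x = u)
    (hf : Mate N G f) : c ≤ miss N f := by
  classical
  have hf0 := hf.isolate A
  have hle := miss_isolate_le A hf
  set f0 := isolate A f with hf0def
  have hf0A : ∀ a, A a → f0 a = a := fun a ha => by simp [hf0def, isolate, ha]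
  -- An edge leaving a component of `D` ends in a neighbour of `D` outside `D`, that is, in `A`; so
  -- a matching that misses `A` preserves the components.
  have hclosed : ∀ F : ℕ → ℕ, Mate N G F → (∀ a < N, A a → F a = a) → ∀ u < N, D u →
      ∀ x, ReachIn N G D u x → ReachIn N G D u (F x) := by
    intro F hF hFA u hu hDu x hx
    obtain ⟨h1, h2⟩ := hx.mem hu hDu
    by_cases hfx : F x = x
    · rwa [hfx]
    · obtain ⟨h3, h4, h5⟩ := hF x h1
      have hna : ¬ A (F x) := fun h => hfx (by rw [← hFA _ h3 h, h4])
      have hDF : D (F x) := by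
        by_contra hnD
        exact hna ((hA _ h3).2 ⟨hnD, x, h1, h2, hG _ h1 _ h3 (h5 hfx)⟩)
      exact hx.tail ⟨h5 hfx, hDF, h3⟩
  -- Deleting the edges at `A` costs `f` at most `2 * |A|` vertices, which is exactly the surplus
  -- granted in `hmiss`.
  suffices h : miss N H ≤ miss N f0 by omega
  -- A vertex missed by `H` is related to itself if it lies in `A`, and otherwise to all vertices of
  -- its component. No vertex is related to two of them.
  refine Finset.card_le_card_of_forall_subsingleton
    (fun x y => (A x ∧ y = x) ∨ (D x ∧ ReachIn N G D x y)) ?_ ?_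
  · intro u hu
    simp only [Finset.mem_filter, Finset.mem_range] at hu
    obtain ⟨hu, hHu⟩ := hu
    rcases hD u hu hHu with h | h
    · exact ⟨u, by simp [hu, hf0A u h], Or.inl ⟨h, rfl⟩⟩
    · by_contra hno
      -- In the component `K` of `u` the matching `H` misses only `u`, so `K` is odd; if `f0` missed
      -- nothing there, `K` would be even.
      set K := (Finset.range N).filter (fun x => ReachIn N G D u x)
      have hK : ∀ x, x ∈ K ↔ ReachIn N G D u x := by
        intro x
        simp only [K, Finset.mem_filter, Finset.mem_range, and_iff_right_iff_imp]
        exact fun hx => (hx.mem hu h).1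
      have e1 := card_cast_eq_fixed (K := K) (f := H) (fun x hx => by
        rw [hK] at *
        exact ⟨hclosed H hH hHA u hu h x hx, (hH x (hx.mem hu h).1).2.1⟩)
      have e2 := card_cast_eq_fixed (K := K) (f := f0) (fun x hx => by
        rw [hK] at *
        exact ⟨hclosed f0 hf0 (fun a _ => hf0A a) u hu h x hx, (hf0 x (hx.mem hu h).1).2.1⟩)
      have e3 : K.filter (fun x => H x = x) = {u} := by
        ext x
        simp only [Finset.mem_filter, hK, Finset.mem_singleton]
        constructor
        · rintro ⟨h1, h2⟩
          exact halone u hu h hHu x h1 h2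
        · rintro rfl
          exact ⟨Relation.ReflTransGen.refl, hHu⟩
      have e4 : K.filter (fun x => f0 x = x) = ∅ := by
        ext x
        simp only [Finset.mem_filter, hK, Finset.notMem_empty, iff_false, not_and]
        intro h1 h2
        exact hno ⟨x, by simp [(h1.mem hu h).1, h2], Or.inr ⟨h, h1⟩⟩
      rw [e3, Finset.card_singleton] at e1
      rw [e4, Finset.card_empty, e1] at e2
      exact absurd e2 (by decide)
  · rintro y - x ⟨hx, h1⟩ x' ⟨hx', h2⟩
    simp only [Finset.mem_filter, Finset.mem_range] at hx hx'
    have hAD : ∀ a < N, A a → ¬ D a := fun a h h' => ((hA a h).1 h').1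
    rcases h1 with ⟨h1, rfl⟩ | ⟨h1, h1'⟩ <;> rcases h2 with ⟨h2, h2'⟩ | ⟨h2, h2'⟩
    · exact h2'
    · exact absurd (h2'.mem hx'.1 h2).2 (hAD _ hx.1 h1)
    · subst h2'
      exact absurd (h1'.mem hx.1 h1).2 (hAD _ hx'.1 h2)
    · have := h1'.trans (h2'.symm hG hx'.1 h2)
      exact (halone x hx.1 h1 hx.2 x' this hx'.2).symm

/-- The vertices of `D` at distance at most `i` from `u`. -/
def ballIn (N : ℕ) (G : ℕ → ℕ → Prop) (D : ℕ → Prop) (u : ℕ) : ℕ → ℕ → Prop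
  | 0 => fun x => x = u
  | i + 1 => fun x => ballIn N G D u i x ∨ ∃ r, ballIn N G D u i r ∧ G r x ∧ D x ∧ x < N

theorem ballIn_lt {D : ℕ → Prop} {u : ℕ} (hu : u < N) {i x : ℕ} (h : ballIn N G D u i x) :
    x < N := by
  induction i generalizing x with
  | zero => rw [show x = u from h]; exact hu
  | succ i ih =>
    rcases h with h | ⟨r, _, _, _, h⟩
    · exact ih h
    · exact h

/-- The balls gain a vertex in every step until they become stable. This is why `N` rounds of the
search exhaust a component. -/
theorem ReachIn.ballIn {D : ℕ → Prop} {u x : ℕ} (hu : u < N) (h : ReachIn N G D u x) :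
    ballIn N G D u N x := by
  classical
  set B : ℕ → Finset ℕ := fun i => (Finset.range N).filter fun x => _root_.ballIn N G D u i x
  have hB : ∀ i x, x ∈ B i ↔ _root_.ballIn N G D u i x := by
    intro i x
    simp only [B, Finset.mem_filter, Finset.mem_range, and_iff_right_iff_imp]
    exact fun h => ballIn_lt hu h
  have key : ∀ i, (∀ x, _root_.ballIn N G D u (i + 1) x → _root_.ballIn N G D u i x) ∨
      i + 1 ≤ (B i).card := by
    intro i
    induction i with
    | zero =>
      right
      exact Finset.card_pos.2 ⟨u, (hB 0 u).2 rfl⟩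
    | succ i ih =>
      rcases ih with ih | ih
      · left
        rintro x (h | ⟨r, h1, h2⟩)
        · exact h
        · exact Or.inr ⟨r, ih r h1, h2⟩
      · by_cases hc : ∀ x, _root_.ballIn N G D u (i + 1) x → _root_.ballIn N G D u i x
        · left
          rintro x (h | ⟨r, h1, h2⟩)
          · exact h
          · exact Or.inr ⟨r, hc r h1, h2⟩
        · right
          push Not at hc
          obtain ⟨x, h1, h2⟩ := hc
          have : B i ⊂ B (i + 1) := by
            rw [Finset.ssubset_iff_of_subset]
            · exact ⟨x, (hB _ _).2 h1, fun h => h2 ((hB _ _).1 h)⟩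
            · intro y hy
              exact (hB _ _).2 (Or.inl ((hB _ _).1 hy))
          have := Finset.card_lt_card this
          omega
  have hlast : ∀ x, _root_.ballIn N G D u (N + 1) x → _root_.ballIn N G D u N x := by
    rcases key N with h | h
    · exact h
    · have := Finset.card_le_card (Finset.filter_subset (fun x => _root_.ballIn N G D u N x)
        (Finset.range N))
      rw [Finset.card_range] at this
      change N + 1 ≤ ((Finset.range N).filter fun x => _root_.ballIn N G D u N x).card at h
      omega
  have hmono : ∀ i, _root_.ballIn N G D u i u := by
    intro i
    induction i with
    | zero => rfl
    | succ i ih => exact Or.inl ih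
  induction h with
  | refl => exact hmono N
  | tail _ h ih => exact hlast _ (Or.inr ⟨_, ih, h.1, h.2.1, h.2.2⟩)

end Matching

/-! ### A language of bounded loops

Commands whose loops run over a range that is known when the loop is entered. Every command is a
total function on memories, and compiles to a program whose running time is bounded by a polynomial
in the loop bounds. -/

namespace RAM

namespace Memory

theorem store_same (s : Memory) (a i v j : ℕ) :
    s.store a i v a j = if j = i then v else s a j := by
  simp [store]

theorem store_ne (s : Memory) {a b : ℕ} (i v : ℕ) (h : b ≠ a) : s.store a i v b = s b := by
  funext j
  simp [store, h]

end Memory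

namespace Expr

/-- The value of a scalar, i.e. of cell 0 of an array. -/
abbrev var (a : ℕ) : Expr := .get a (.const 0)

/-- Equality test. -/
def eq (x y : Expr) : Expr := .sub (.const 1) (.add (.sub x y) (.sub y x))

/-- Conjunction of two conditions. -/
def and (x y : Expr) : Expr := .sub (.const 1) (.add (.sub (.const 1) x) (.sub (.const 1) y))

/-- Negation of a condition. -/
def not (x : Expr) : Expr := .sub (.const 1) x

theorem eval_const (s : Memory) (c : ℕ) : (const c).eval s = c := rfl

theorem eval_get (s : Memory) (a : ℕ) (x : Expr) : (get a x).eval s = s a (x.eval s) := rfl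

theorem eval_add (s : Memory) (x y : Expr) : (add x y).eval s = x.eval s + y.eval s := rfl

theorem eval_sub (s : Memory) (x y : Expr) : (sub x y).eval s = x.eval s - y.eval s := rfl

theorem eval_eq (s : Memory) (x y : Expr) :
    (eq x y).eval s = if x.eval s = y.eval s then 1 else 0 := by
  simp only [eq, eval]
  split_ifs <;> omega

theorem eval_and (s : Memory) (x y : Expr) :
    (and x y).eval s = if x.eval s ≠ 0 ∧ y.eval s ≠ 0 then 1 else 0 := by
  simp only [and, eval]
  split_ifs <;> omega

theorem eval_not (s : Memory) (x : Expr) :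
    (not x).eval s = if x.eval s = 0 then 1 else 0 := by
  simp only [not, eval]
  split_ifs <;> omega

theorem eval_eq_ne_zero {s : Memory} {x y : Expr} :
    (eq x y).eval s ≠ 0 ↔ x.eval s = y.eval s := by
  rw [eval_eq]; split_ifs <;> simp [*]

theorem eval_and_ne_zero {s : Memory} {x y : Expr} :
    (and x y).eval s ≠ 0 ↔ x.eval s ≠ 0 ∧ y.eval s ≠ 0 := by
  rw [eval_and]; split_ifs <;> simp_all

theorem eval_not_ne_zero {s : Memory} {x : Expr} : (not x).eval s ≠ 0 ↔ x.eval s = 0 := by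
  rw [eval_not]; split_ifs <;> simp [*]

end Expr

/-- Commands. `rep x a c` runs `c` for the values `0, 1, …, a[0] - 1` of `x[0]`. -/
inductive Cmd where
  | skip
  | put (a : ℕ) (idx val : Expr)
  | seq (c d : Cmd)
  | ite (cond : Expr) (c d : Cmd)
  | rep (x a : ℕ) (c : Cmd)

/-- Iteration of a function that may depend on the number of the step. -/
def iter {α : Type*} (F : ℕ → α → α) : ℕ → α → α
  | 0, s => s
  | i + 1, s => F i (iter F i s)

namespace Cmd

/-- Assignment to a scalar. -/
abbrev set (a : ℕ) (val : Expr) : Cmd := .put a (.const 0) val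

/-- One-sided conditional. -/
abbrev when (cond : Expr) (c : Cmd) : Cmd := .ite cond c .skip

/-- The memory after the execution of a command. -/
def den : Cmd → Memory → Memory
  | skip, s => s
  | put a idx val, s => s.store a (idx.eval s) (val.eval s)
  | seq c d, s => d.den (c.den s)
  | ite cond c d, s => if cond.eval s ≠ 0 then c.den s else d.den s
  | rep x a c, s => iter (fun i s' => (c.den s').store x 0 (i + 1)) (s a 0) (s.store x 0 0)

theorem den_seq (c d : Cmd) (s : Memory) : (seq c d).den s = d.den (c.den s) := rfl

/-- The arrays that a command may change. -/
def writes : Cmd → List ℕ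
  | skip => []
  | put a _ _ => [a]
  | seq c d => c.writes ++ d.writes
  | ite _ c d => c.writes ++ d.writes
  | rep x _ c => x :: c.writes

/-- The loop bounds of the command lie in `B`, the command does not change them, and loop bodies do
not change their loop variable. -/
def ok (B : List ℕ) : Cmd → Bool
  | skip => true
  | put a _ _ => decide (a ∉ B)
  | seq c d => c.ok B && d.ok B
  | ite _ c d => c.ok B && d.ok B
  | rep x a c => decide (a ∈ B) && decide (x ∉ B) && decide (x ∉ c.writes) && c.ok B

/-- The program of a command. -/
def compile : Cmd → Prog
  | skip => .nop
  | put a idx val => .put a idx val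
  | seq c d => .seq c.compile d.compile
  | ite cond c d => .ite cond c.compile d.compile
  | rep x a c => .seq (.put x (.const 0) (.const 0)) (.loop (.sub (.var a) (.var x))
      (.seq c.compile (.put x (.const 0) (.add (.var x) (.const 1)))))

/-- A bound for the running time in terms of the loop bounds. -/
noncomputable def timeBound : Cmd → Polynomial ℕ
  | skip => 1
  | put _ idx val => Polynomial.C (idx.cost + val.cost + 1)
  | seq c d => c.timeBound + d.timeBound
  | ite cond c d => Polynomial.C (cond.cost + 1) + c.timeBound + d.timeBound
  | rep _ _ c => Polynomial.X * (c.timeBound + Polynomial.C 12) + Polynomial.C 9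

/-- Since `writes` is computable, the side conditions of this frame rule are settled by `decide` for
the concrete commands below. -/
theorem den_frame {b : ℕ} (c : Cmd) (h : b ∉ c.writes) (s : Memory) : c.den s b = s b := by
  induction c generalizing s with
  | skip => rfl
  | put a idx val => exact Memory.store_ne _ _ _ (by simpa [writes] using h)
  | seq c d ihc ihd =>
    simp only [writes, List.mem_append, not_or] at h
    rw [den, ihd h.2, ihc h.1]
  | ite cond c d ihc ihd =>
    simp only [writes, List.mem_append, not_or] at h
    rw [den]
    split_ifs
    · exact ihc h.1 s
    · exact ihd h.2 s
  | rep x a c ih =>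
    simp only [writes, List.mem_cons, not_or] at h
    rw [den]
    generalize s a 0 = n
    induction n with
    | zero => exact Memory.store_ne _ _ _ h.1
    | succ n ihn =>
      rw [iter, Memory.store_ne _ _ _ h.1, ih h.2, ihn]

theorem notMem_writes_of_ok {B : List ℕ} {c : Cmd} (hc : c.ok B = true) {b : ℕ} (hb : b ∈ B) :
    b ∉ c.writes := by
  induction c with
  | skip => simp [writes]
  | put a _ _ =>
    simp only [ok, decide_eq_true_eq] at hc
    simp only [writes, List.mem_singleton]
    exact fun h => hc (h ▸ hb)
  | seq c d ihc ihd =>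
    simp only [ok, Bool.and_eq_true] at hc
    simp [writes, ihc hc.1, ihd hc.2]
  | ite _ c d ihc ihd =>
    simp only [ok, Bool.and_eq_true] at hc
    simp [writes, ihc hc.1, ihd hc.2]
  | rep x a c ih =>
    simp only [ok, Bool.and_eq_true, decide_eq_true_eq] at hc
    simp only [writes, List.mem_cons, not_or]
    exact ⟨fun h => hc.1.1.2 (h ▸ hb), ih hc.2⟩

/-- A compiled command halts with the memory given by its semantics, in polynomial time. -/
theorem exists_runs (B : List ℕ) (K : ℕ) (c : Cmd) (hc : c.ok B = true) (s : Memory)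
    (hK : ∀ a ∈ B, s a 0 ≤ K) :
    ∃ t, t ≤ c.timeBound.eval K ∧ Runs c.compile s t (c.den s) := by
  induction c generalizing s with
  | skip => exact ⟨1, by simp [timeBound], Runs.nop s⟩
  | put a idx val => exact ⟨_, by simp [timeBound], Runs.put s a idx val⟩
  | seq c d ihc ihd =>
    simp only [ok, Bool.and_eq_true] at hc
    obtain ⟨t, ht, hr⟩ := ihc hc.1 s hK
    obtain ⟨t', ht', hr'⟩ := ihd hc.2 (c.den s) (by
      intro a ha
      rw [c.den_frame (notMem_writes_of_ok hc.1 ha) s]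
      exact hK a ha)
    exact ⟨t + t', by simp only [timeBound, Polynomial.eval_add]; omega, Runs.seq hr hr'⟩
  | ite cond c d ihc ihd =>
    simp only [ok, Bool.and_eq_true] at hc
    by_cases h : cond.eval s = 0
    · obtain ⟨t, ht, hr⟩ := ihd hc.2 s hK
      refine ⟨cond.cost + 1 + t, ?_, ?_⟩
      · simp only [timeBound, Polynomial.eval_add, Polynomial.eval_C]; omega
      · simp only [den, h, ne_eq, not_true, if_false]
        exact Runs.ite_false h hr
    · obtain ⟨t, ht, hr⟩ := ihc hc.1 s hK
      refine ⟨cond.cost + 1 + t, ?_, ?_⟩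
      · simp only [timeBound, Polynomial.eval_add, Polynomial.eval_C]; omega
      · simp only [den, h, ne_eq, not_false_iff, if_true]
        exact Runs.ite_true h hr
  | rep x a c ih =>
    simp only [ok, Bool.and_eq_true, decide_eq_true_eq] at hc
    obtain ⟨⟨⟨haB, hxB⟩, hxc⟩, hc⟩ := hc
    have hxa : a ≠ x := fun h => hxB (h ▸ haB)
    have hBc : ∀ b ∈ B, b ∉ c.writes := fun b hb => notMem_writes_of_ok hc hb
    set T := c.timeBound.eval K with hT
    set F : ℕ → Memory → Memory := fun i s' => (c.den s').store x 0 (i + 1) with hF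
    set st : ℕ → Memory := fun i => iter F i (s.store x 0 0) with hst
    -- The bounds are never written, so the test compares the counter with the bound read at entry
    -- in every round.
    have hstB : ∀ i, ∀ b ∈ B, st i b = s b := by
      intro i b hb
      induction i with
      | zero => exact Memory.store_ne _ _ _ (fun h : b = x => hxB (h ▸ hb))
      | succ i ihi =>
        change (c.den (st i)).store x 0 (i + 1) b = s b
        rw [Memory.store_ne _ _ _ (fun h : b = x => hxB (h ▸ hb)), den_frame c (hBc b hb), ihi]
    have hstx : ∀ i, st i x 0 = i := by
      intro i
      cases i with
      | zero => simp [hst, iter, Memory.store]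
      | succ i => simp [hst, iter, hF, Memory.store]
    -- A round takes 6 steps for the test, at most `T` for the body and 6 for the increment; the
    -- last test takes 6. The initial assignment adds 3, whence the 12 and the 9 in `timeBound`.
    have hloop : ∀ d i, i + d = s a 0 → ∃ t, t ≤ d * (T + 12) + 6 ∧
        Runs (.loop (.sub (.var a) (.var x))
          (.seq c.compile (.put x (.const 0) (.add (.var x) (.const 1))))) (st i) t
            (st (s a 0)) := by
      intro d
      induction d with
      | zero =>
        intro i hi
        rw [Nat.add_zero] at hi
        subst hi
        refine ⟨_, ?_, Runs.loop_done ?_⟩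
        · simp [Expr.cost]
        · simp only [Expr.eval]
          rw [hstB _ a haB, hstx]
          omega
      | succ d ihd =>
        intro i hi
        obtain ⟨t, ht, hr⟩ := ihd (i + 1) (by omega)
        obtain ⟨t1, ht1, hr1⟩ := ih hc (st i) (fun b hb => by rw [hstB i b hb]; exact hK b hb)
        have hput : Runs (.put x (.const 0) (.add (.var x) (.const 1))) (c.den (st i)) 6
            (st (i + 1)) := by
          have := Runs.put (c.den (st i)) x (.const 0) (.add (.var x) (.const 1))
          have e : (c.den (st i)).store x ((Expr.const 0).eval (c.den (st i)))
              ((Expr.add (.var x) (.const 1)).eval (c.den (st i))) = st (i + 1) := by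
            simp only [Expr.eval]
            rw [den_frame c hxc, hstx]
            rfl
          rw [e] at this
          exact this
        refine ⟨_, ?_, Runs.loop_step ?_ (Runs.seq hr1 hput) hr⟩
        · simp only [Expr.cost]
          rw [Nat.succ_mul]
          omega
        · simp only [Expr.eval]
          rw [hstB _ a haB, hstx]
          omega
    obtain ⟨t, ht, hr⟩ := hloop (s a 0) 0 (by omega)
    refine ⟨_, ?_, Runs.seq (Runs.put s x (.const 0) (.const 0)) hr⟩
    simp only [Expr.cost, timeBound, Polynomial.eval_add, Polynomial.eval_mul, Polynomial.eval_X,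
      Polynomial.eval_C, ← hT]
    have : s a 0 * (T + 12) ≤ K * (T + 12) := Nat.mul_le_mul_right _ (hK a haB)
    omega

/-- Invariant rule for loops. -/
theorem den_rep {x a : ℕ} {c : Cmd} {s : Memory} (Inv : ℕ → Memory → Prop)
    (h0 : Inv 0 (s.store x 0 0))
    (hstep : ∀ i < s a 0, ∀ s' : Memory, (∀ b, b ∉ x :: c.writes → s' b = s b) → s' x 0 = i →
      Inv i s' → Inv (i + 1) ((c.den s').store x 0 (i + 1))) :
    Inv (s a 0) ((rep x a c).den s) := by
  rw [den]
  have key : ∀ n ≤ s a 0, ∀ st,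
      st = iter (fun i s' => (c.den s').store x 0 (i + 1)) n (s.store x 0 0) →
      (∀ b, b ∉ x :: c.writes → st b = s b) ∧ st x 0 = n ∧ Inv n st := by
    intro n
    induction n with
    | zero =>
      rintro - st rfl
      refine ⟨fun b hb => ?_, by simp [iter, Memory.store], h0⟩
      simp only [List.mem_cons, not_or] at hb
      exact Memory.store_ne _ _ _ hb.1
    | succ n ih =>
      rintro hn st rfl
      obtain ⟨h1, h2, h3⟩ := ih (by omega) _ rfl
      refine ⟨fun b hb => ?_, by simp [iter, Memory.store], hstep n hn _ h1 h2 h3⟩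
      have hb' := hb
      simp only [List.mem_cons, not_or] at hb
      rw [iter, Memory.store_ne _ _ _ hb.1, den_frame c hb.2]
      exact h1 b hb'
  exact (key _ le_rfl _ rfl).2.2

end Cmd

end RAM

/-! ### The matching algorithm

The program keeps a set `D` of vertices and, for every vertex of `D`, a matching that misses this
vertex; none of these matchings misses more than `c` vertices. -/

namespace RAM

open RAM.Expr RAM.Cmd

infixr:60 ";;" => Cmd.seq

-- Roles of the main arrays: `arrMul` holds the row offsets of `N × N` tables; `arrTab` holds the
-- stored matching of each vertex in `arrD`, and `arrC` is `c`; `arrM` is the current matching and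
-- `arrH` the same without the edges at `arrA`; `arrR` marks the vertices reached by a search and
-- `arrRTab` holds their matchings; `arrW` and `arrL` are the two sides of an exchange from `arrT`;
-- `arrBest`, flagged by `arrFound`, makes progress; `arrAug` flags that `arrH` has been improved.
-- Arrays from 40 to 46, 50, 51, 60 and 61 are loop counters.
notation "arrN" => (10 : ℕ)
notation "arrB" => (11 : ℕ)
notation "arrMul" => (12 : ℕ)
notation "arrAdj" => (13 : ℕ)
notation "arrD" => (14 : ℕ)
notation "arrTab" => (15 : ℕ)
notation "arrC" => (16 : ℕ)
notation "arrA" => (17 : ℕ)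
notation "arrNb" => (18 : ℕ)
notation "arrH" => (19 : ℕ)
notation "arrR" => (20 : ℕ)
notation "arrRTab" => (21 : ℕ)
notation "arrW" => (22 : ℕ)
notation "arrL" => (23 : ℕ)
notation "arrMark" => (24 : ℕ)
notation "arrPos" => (25 : ℕ)
notation "arrTmp" => (26 : ℕ)
notation "arrFound" => (27 : ℕ)
notation "arrBest" => (28 : ℕ)
notation "arrAug" => (29 : ℕ)
notation "arrCnt" => (30 : ℕ)
notation "arrNew" => (31 : ℕ)
notation "arrM" => (32 : ℕ)
notation "arrT" => (33 : ℕ)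

/-- Loop that fills a segment of an array. -/
theorem den_fill {x a b : ℕ} {idx val : Expr} {s : Memory} (base : ℕ) (φ : ℕ → ℕ) (hxb : b ≠ x)
    (hidx : ∀ i < s a 0, ∀ s' : Memory, (∀ b', b' ≠ x → b' ≠ b → s' b' = s b') → s' x 0 = i →
      (∀ j, base + i ≤ j → s' b j = s b j) → idx.eval s' = base + i ∧ val.eval s' = φ i) :
    (∀ i < s a 0, (rep x a (put b idx val)).den s b (base + i) = φ i) ∧
      ∀ j, (j < base ∨ base + s a 0 ≤ j) → (rep x a (put b idx val)).den s b j = s b j := by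
  refine den_rep (fun n s' => (∀ i < n, s' b (base + i) = φ i) ∧
    ∀ j, (j < base ∨ base + n ≤ j) → s' b j = s b j) ?_ ?_
  · refine ⟨by omega, fun j _ => ?_⟩
    rw [Memory.store_ne _ _ _ hxb]
  · rintro i hi s' hfr hx ⟨h1, h2⟩
    obtain ⟨e1, e2⟩ := hidx i hi s'
      (fun b' h h' => hfr b' (by simp [writes, h, h'])) hx (fun j hj => h2 j (Or.inr hj))
    simp only [den, e1, e2]
    rw [Memory.store_ne _ _ _ hxb]
    constructor
    · intro j hj
      rw [Memory.store_same]
      split_ifs with h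
      · rw [show j = i by omega]
      · exact h1 j (by omega)
    · intro j hj
      rw [Memory.store_same, if_neg (by omega)]
      exact h2 j (by omega)

/-- The graph stored in the memory. -/
structure Env (N : ℕ) (G : ℕ → ℕ → Prop) (s : Memory) : Prop where
  size : s arrN 0 = N
  mul : ∀ u < N, s arrMul u = u * N
  adj : ∀ u < N, ∀ v < N, s arrAdj (u * N + v) ≠ 0 ↔ G u v

theorem Env.congr {N : ℕ} {G : ℕ → ℕ → Prop} {s s' : Memory} (h : Env N G s)
    (h1 : s' arrN = s arrN) (h2 : s' arrMul = s arrMul) (h3 : s' arrAdj = s arrAdj) :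
    Env N G s' :=
  ⟨by rw [h1]; exact h.size, by rw [h2]; exact h.mul, by rw [h3]; exact h.adj⟩

/-- The table of matchings. -/
def TabInv (N : ℕ) (G : ℕ → ℕ → Prop) (s : Memory) : Prop :=
  ∀ v < N, s arrD v ≠ 0 → Mate N G (fun x => s arrTab (v * N + x)) ∧ s arrTab (v * N + v) = v ∧
    miss N (fun x => s arrTab (v * N + x)) ≤ s arrC 0

theorem TabInv.congr {N : ℕ} {G : ℕ → ℕ → Prop} {s s' : Memory} (h : TabInv N G s)
    (h1 : s' arrD = s arrD) (h2 : s' arrTab = s arrTab) (h3 : s' arrC = s arrC) :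
    TabInv N G s' := by
  unfold TabInv
  rw [h1, h2, h3]
  exact h

/-- The matching in `arrBest` makes progress: it is better than the table, or it misses a vertex
outside `D`. -/
def Progress (N : ℕ) (G : ℕ → ℕ → Prop) (s : Memory) : Prop :=
  Mate N G (s arrBest) ∧ miss N (s arrBest) ≤ s arrC 0 ∧
    (miss N (s arrBest) < s arrC 0 ∨ ∃ x < N, s arrBest x = x ∧ s arrD x = 0)

theorem Progress.congr {N : ℕ} {G : ℕ → ℕ → Prop} {s s' : Memory} (h : Progress N G s)
    (h1 : s' arrD = s arrD) (h2 : s' arrBest = s arrBest) (h3 : s' arrC = s arrC) :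
    Progress N G s' := by
  unfold Progress
  rw [h1, h2, h3]
  exact h

/-! ### Detecting progress -/

/-- Count the vertices missed by the matching in `arrL`, and look for one outside `D`. -/
def countMissed : Cmd :=
  set arrCnt (.const 0) ;; set arrNew (.const 0) ;;
  rep 40 arrN (when (eq (get arrL (var 40)) (var 40))
    (set arrCnt (add (var arrCnt) (.const 1)) ;;
      when (not (get arrD (var 40))) (set arrNew (.const 1))))

theorem countMissed_spec {N : ℕ} {s : Memory} (hN : s arrN 0 = N) :
    countMissed.den s arrCnt 0 = miss N (s arrL) ∧
      (countMissed.den s arrNew 0 ≠ 0 ↔ ∃ x < N, s arrL x = x ∧ s arrD x = 0) := by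
  subst hN
  rw [countMissed, den_seq, den_seq]
  generalize hs : den (set arrNew _) (den _ s) = s1
  have e : ∀ b, b ≠ arrCnt → b ≠ arrNew → s1 b = s b := by
    intro b h1 h2
    rw [← hs]
    simp [den, Memory.store_ne, h1, h2]
  have e1 : s1 arrCnt 0 = 0 := by rw [← hs]; simp [den, Memory.store, eval]
  have e2 : s1 arrNew 0 = 0 := by rw [← hs]; simp [den, Memory.store, eval]
  rw [← e arrN (by decide) (by decide), ← e arrL (by decide) (by decide),
    ← e arrD (by decide) (by decide)]
  clear hs e
  refine den_rep (fun n s' => s' arrCnt 0 = miss n (s1 arrL) ∧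
      (s' arrNew 0 ≠ 0 ↔ ∃ x < n, s1 arrL x = x ∧ s1 arrD x = 0)) ?_ ?_
  · simp [Memory.store, miss, e1, e2]
  · rintro i - s' hfr hx ⟨h1, h2⟩
    have hL : s' arrL = s1 arrL := hfr _ (by decide)
    have hD : s' arrD = s1 arrD := hfr _ (by decide)
    have hm : miss (i + 1) (s1 arrL) = miss i (s1 arrL) + if s1 arrL i = i then 1 else 0 := by
      unfold miss
      rw [Finset.range_add_one, Finset.filter_insert]
      split_ifs <;> simp
    rw [hm]
    simp only [den, eval_eq, eval_get, eval_const, hx, hL, Memory.store_ne, ne_eq,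
      Nat.reduceEqDiff, not_false_iff]
    by_cases hc : s1 arrL i = i
    · by_cases hd : s1 arrD i = 0
      · simp [hc, hd, eval, eval_not, Memory.store, h1, hx, hD]
        exact ⟨i, by omega, hc, hd⟩
      · have e3 : ((Expr.get arrD (var 40)).not).eval
            (s'.store arrCnt 0 ((add (var arrCnt) (.const 1)).eval s')) = 0 := by
          simp [eval_not, eval, Memory.store, hx, hD, hd]
        simp only [hc, if_true, one_ne_zero, not_false_iff, e3, not_true, if_false]
        simp only [eval, Memory.store_same, Memory.store_ne, ne_eq, Nat.reduceEqDiff,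
          not_false_iff, if_true, h1, true_and]
        rw [← ne_eq, h2]
        constructor
        · rintro ⟨x, h3, h4⟩
          exact ⟨x, by omega, h4⟩
        · rintro ⟨x, h3, h4⟩
          refine ⟨x, ?_, h4⟩
          rcases Nat.lt_succ_iff_lt_or_eq.1 h3 with h | rfl
          · exact h
          · exact absurd h4.2 hd
    · simp only [hc, if_false, not_true, h1, Nat.add_zero, true_and, h2]
      constructor
      · rintro ⟨x, h3, h4⟩
        exact ⟨x, by omega, h4⟩
      · rintro ⟨x, h3, h4⟩
        refine ⟨x, ?_, h4⟩
        rcases Nat.lt_succ_iff_lt_or_eq.1 h3 with h | rfl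
        · exact h
        · exact absurd h4.1 hc

/-- Save the matching in `arrL` if it makes progress. -/
def report : Cmd :=
  countMissed ;;
  -- Addition acts as a disjunction, and truncated subtraction as a strict comparison.
  when (add (sub (var arrC) (var arrCnt)) (var arrNew))
    (rep 40 arrN (put arrBest (var 40) (get arrL (var 40))) ;; set arrFound (.const 1))

/-- A negative report is used as well: that `arrL` misses no fewer than `c` vertices, and only
vertices of `D`, is what the optimality certificate needs. -/
theorem report_spec {N : ℕ} {G : ℕ → ℕ → Prop} {s : Memory} (hE : Env N G s)
    (hf : s arrFound 0 = 0) (hL : Mate N G (s arrL)) (hm : miss N (s arrL) ≤ s arrC 0) :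
    (report.den s arrFound 0 ≠ 0 ∧ Progress N G (report.den s)) ∨
      (report.den s arrFound 0 = 0 ∧ s arrC 0 ≤ miss N (s arrL) ∧
        ∀ x < N, s arrL x = x → s arrD x ≠ 0) := by
  have hD : report.den s arrD = s arrD := den_frame _ (by decide) _
  have hC : report.den s arrC = s arrC := den_frame _ (by decide) _
  unfold Progress
  rw [hD, hC]
  clear hD hC
  obtain ⟨h1, h2⟩ := countMissed_spec hE.size
  rw [report, den, den]
  have hfr : ∀ b, b ∉ countMissed.writes → countMissed.den s b = s b :=
    fun b hb => den_frame _ hb _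
  generalize countMissed.den s = s1 at *
  simp only [eval, h1, hfr arrC (by decide)]
  split_ifs with h
  · left
    rw [den]
    obtain ⟨h3, -⟩ := den_fill (x := 40) (a := arrN) (b := arrBest) (idx := var 40)
      (val := get arrL (var 40)) (s := s1) 0 (s arrL) (by decide) (by
        intro i _ s' h4 h5 _
        simp [eval, h5, h4 arrL, hfr arrL (by decide)])
    rw [hfr arrN (by decide), hE.size] at h3
    simp only [Nat.zero_add] at h3
    generalize (rep _ _ _).den s1 = s2 at *
    have hb : (den (set arrFound (.const 1)) s2) arrBest = s2 arrBest := den_frame _ (by decide) _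
    rw [hb, miss_congr h3]
    refine ⟨by simp [den, eval, Memory.store], hL.congr h3, hm, ?_⟩
    by_cases hc : miss N (s arrL) < s arrC 0
    · exact Or.inl hc
    · obtain ⟨x, h4, h5, h6⟩ := h2.1 (by omega)
      exact Or.inr ⟨x, h4, by rw [h3 x h4, h5], h6⟩
  · right
    rw [den, hfr arrFound (by decide)]
    refine ⟨hf, by omega, fun x hx h4 h5 => ?_⟩
    have := h2.2 ⟨x, hx, h4, h5⟩
    omega

/-! ### Exchange with a stored matching -/

/-- Mark the vertices of the alternating path from `arrT` in the matchings `arrW` and `arrL`. -/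
def markPath : Cmd :=
  rep 40 arrN (put arrMark (var 40) (.const 0)) ;; set arrPos (var arrT) ;;
  rep 40 arrN (put arrMark (var arrPos) (.const 1) ;; set arrPos (get arrW (var arrPos)) ;;
    put arrMark (var arrPos) (.const 1) ;; set arrPos (get arrL (var arrPos)))

/-- The right-hand side is the set `S` of `exchange`, where `N` rounds are enough because the walk
has period at most `N`. -/
theorem markPath_spec {N : ℕ} {s : Memory} (hN : s arrN 0 = N) (x : ℕ) (hx : x < N) :
    markPath.den s arrMark x ≠ 0 ↔ ∃ i < N, x = alternatingWalk (s arrW) (s arrL) (s arrT 0) i ∨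
      x = s arrW (alternatingWalk (s arrW) (s arrL) (s arrT 0) i) := by
  subst hN
  have hfill := (den_fill (x := 40) (a := arrN) (b := arrMark) (idx := var 40)
      (val := .const 0) (s := s) 0 (fun _ => 0) (by decide) (by
        intro i _ s' h4 h5 _
        simp [eval, h5])).1
  simp only [Nat.zero_add] at hfill
  rw [markPath, den, den]
  have hfr : ∀ b, b ∉ (rep 40 arrN (put arrMark (var 40) (.const 0))).writes →
      (rep 40 arrN (put arrMark (var 40) (.const 0))).den s b = s b :=
    fun b hb => den_frame _ hb _
  generalize (rep 40 arrN (put arrMark (var 40) (.const 0))).den s = s1 at *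
  generalize hs2 : den (set arrPos (var arrT)) s1 = s2
  have hfr2 : ∀ b, b ≠ arrPos → b ≠ 40 → b ≠ arrMark → s2 b = s b := by
    intro b h1 h2 h3
    rw [← hs2, den, Memory.store_ne _ _ _ h1]
    exact hfr b (by simp [writes, h2, h3])
  have hpos : s2 arrPos 0 = s arrT 0 := by
    rw [← hs2]
    simp [den, eval, Memory.store, hfr arrT (by decide)]
  have hmark : ∀ i < s arrN 0, s2 arrMark i = 0 := by
    intro i hi
    rw [← hs2, den, Memory.store_ne _ _ _ (by decide)]
    exact hfill i hi
  set w := alternatingWalk (s arrW) (s arrL) (s arrT 0) with hw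
  have hmain := den_rep (x := 40) (a := arrN) (s := s2)
    (c := put arrMark (var arrPos) (.const 1) ;; set arrPos (get arrW (var arrPos)) ;;
      put arrMark (var arrPos) (.const 1) ;; set arrPos (get arrL (var arrPos)))
    (fun n s' => s' arrPos 0 = w n ∧ ∀ x < s arrN 0, s' arrMark x ≠ 0 ↔ ∃ i < n, x = w i ∨
      x = s arrW (w i)) ?_ ?_
  · rw [hfr2 arrN (by decide) (by decide) (by decide)] at hmain
    exact hmain.2 x hx
  · refine ⟨by simp [Memory.store, hpos, hw, alternatingWalk], fun x hx => ?_⟩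
    simp [Memory.store_ne, hmark x hx]
  · rintro i - s' h1 - ⟨h2, h3⟩
    have hW : s' arrW = s arrW := by
      rw [h1 _ (by decide), hfr2 _ (by decide) (by decide) (by decide)]
    have hL : s' arrL = s arrL := by
      rw [h1 _ (by decide), hfr2 _ (by decide) (by decide) (by decide)]
    simp only [den, eval, Memory.store_ne, Memory.store_same, ne_eq, Nat.reduceEqDiff,
      not_false_iff, if_true, h2, hW, hL]
    refine ⟨rfl, fun x hx => ?_⟩
    have h4 := h3 x hx
    by_cases e1 : x = s arrW (w i)
    · simp only [e1, if_true, one_ne_zero, not_false_iff, true_iff]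
      exact ⟨i, by omega, Or.inr rfl⟩
    · by_cases e2 : x = w i
      · simp only [e2, if_true, one_ne_zero, not_false_iff, true_iff, ite_self]
        exact ⟨i, by omega, Or.inl rfl⟩
      · simp only [e1, e2, if_false]
        rw [← ne_eq, h4]
        constructor
        · rintro ⟨j, h5, h6⟩
          exact ⟨j, by omega, h6⟩
        · rintro ⟨j, h5, h6⟩
          refine ⟨j, ?_, h6⟩
          rcases Nat.lt_succ_iff_lt_or_eq.1 h5 with h | rfl
          · exact h
          · tauto

/-- Exchange the matchings `arrW` and `arrL` on the marked vertices. -/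
def swapMarked : Cmd :=
  rep 40 arrN (when (get arrMark (var 40))
    (set arrTmp (get arrW (var 40)) ;; put arrW (var 40) (get arrL (var 40)) ;;
      put arrL (var 40) (var arrTmp)))

theorem swapMarked_spec {N : ℕ} {s : Memory} (hN : s arrN 0 = N) (x : ℕ) (hx : x < N) :
    swapMarked.den s arrW x = (if s arrMark x ≠ 0 then s arrL x else s arrW x) ∧
      swapMarked.den s arrL x = (if s arrMark x ≠ 0 then s arrW x else s arrL x) := by
  subst hN
  have hmain := den_rep (x := 40) (a := arrN) (s := s)
    (c := when (get arrMark (var 40))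
    (set arrTmp (get arrW (var 40)) ;; put arrW (var 40) (get arrL (var 40)) ;;
      put arrL (var 40) (var arrTmp)))
    (fun n s' => ∀ x,
      s' arrW x = (if x < n ∧ s arrMark x ≠ 0 then s arrL x else s arrW x) ∧
      s' arrL x = (if x < n ∧ s arrMark x ≠ 0 then s arrW x else s arrL x)) ?_ ?_
  · have := hmain x
    simp only [hx, true_and] at this
    exact this
  · simp [Memory.store_ne]
  · rintro i - s' hfr hi h x
    have hM : s' arrMark = s arrMark := hfr _ (by decide)
    by_cases hm : s arrMark i = 0
    · simp only [den, eval, hi, hM, hm, ne_eq, not_true, if_false, Memory.store_ne,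
        Nat.reduceEqDiff, not_false_iff, (h x).1, (h x).2]
      have : (x < i + 1 ∧ ¬ s arrMark x = 0) ↔ (x < i ∧ ¬ s arrMark x = 0) := by
        constructor
        · rintro ⟨h1, h2⟩
          rcases Nat.lt_succ_iff_lt_or_eq.1 h1 with h | rfl
          · exact ⟨h, h2⟩
          · exact absurd hm h2
        · rintro ⟨h1, h2⟩
          exact ⟨by omega, h2⟩
      simp only [this, and_self]
    · simp only [den, eval, hi, hM, hm, ne_eq, not_false_iff, if_true, Memory.store_ne,
        Nat.reduceEqDiff, Memory.store_same, (h x).1, (h x).2, (h i).1, (h i).2, lt_irrefl,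
        false_and, if_false]
      by_cases hxi : x = i
      · subst hxi
        simp [hm]
      · have : x < i + 1 ↔ x < i := by omega
        simp only [hxi, if_false, this, and_self]

/-- Make the matching `arrW` miss the vertex `arrT` of `D`, by an exchange with the matching of
the table that misses this vertex. -/
def switch : Cmd :=
  rep 40 arrN (put arrL (var 40) (get arrTab (add (get arrMul (var arrT)) (var 40)))) ;;
  markPath ;; swapMarked ;; report

/-- The report examines the stored matching after the exchange. There is progress if it has improved
or misses a vertex outside `D`. Otherwise it misses the vertex `z` given up by `arrW`, so `z` lies
in `D`, and `arrW` has traded `z` for `t`. -/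
theorem switch_spec {N : ℕ} {G : ℕ → ℕ → Prop} {s : Memory} (hE : Env N G s) (hT : TabInv N G s)
    (hf : s arrFound 0 = 0) (hW : Mate N G (s arrW)) (ht : s arrT 0 < N)
    (htD : s arrD (s arrT 0) ≠ 0) :
    (switch.den s arrFound 0 ≠ 0 ∧ Progress N G (switch.den s)) ∨
      (switch.den s arrFound 0 = 0 ∧ Mate N G (switch.den s arrW) ∧
        ∃ z < N, s arrD z ≠ 0 ∧ s arrW z = z ∧ (s arrW (s arrT 0) = s arrT 0 → z = s arrT 0) ∧
          ∀ y < N, switch.den s arrW y = y ↔ y = s arrT 0 ∨ (s arrW y = y ∧ y ≠ z)) := by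
  classical
  obtain ⟨hm1, hm2, hm3⟩ := hT _ ht htD
  set t := s arrT 0 with htdef
  have hfill := (den_fill (x := 40) (a := arrN) (b := arrL) (idx := var 40)
      (val := get arrTab (add (get arrMul (var arrT)) (var 40))) (s := s) 0
      (fun x => s arrTab (t * N + x)) (by decide) (by
        intro i _ s' h4 h5 _
        simp [eval, h5, h4 arrTab, h4 arrMul, h4 arrT, ← htdef, hE.mul t ht])).1
  simp only [Nat.zero_add, hE.size] at hfill
  rw [switch, den, den, den]
  have hfr : ∀ b, b ∉ [40, arrL] → (rep 40 arrN
      (put arrL (var 40) (get arrTab (add (get arrMul (var arrT)) (var 40))))).den s b = s b :=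
    fun b hb => den_frame _ (by simpa [writes] using hb) _
  generalize (rep 40 arrN
      (put arrL (var 40) (get arrTab (add (get arrMul (var arrT)) (var 40))))).den s = s1 at *
  have hN1 : s1 arrN 0 = N := by rw [hfr _ (by decide)]; exact hE.size
  have hmark := markPath_spec hN1
  rw [hfr arrT (by decide), hfr arrW (by decide), ← htdef] at hmark
  have hfr2 : ∀ b, b ∉ markPath.writes → b ∉ [40, arrL] → markPath.den s1 b = s b := by
    intro b h1 h2
    rw [den_frame _ h1, hfr b h2]
  have hL2 : markPath.den s1 arrL = s1 arrL := den_frame _ (by decide) _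
  generalize markPath.den s1 = s2 at *
  have hN2 : s2 arrN 0 = N := by rw [hfr2 _ (by decide) (by decide)]; exact hE.size
  have hswap := swapMarked_spec hN2
  rw [hL2, hfr2 arrW (by decide) (by decide)] at hswap
  have hfr3 : ∀ b, b ∉ [40, arrL, arrTmp, arrW, arrMark, arrPos] → swapMarked.den s2 b = s b := by
    intro b h1
    simp only [List.mem_cons, not_or, List.not_mem_nil, not_false_iff, and_true] at h1
    rw [den_frame, hfr2]
    · simp [markPath, writes, h1]
    · simp [h1]
    · simp [swapMarked, writes, h1]
  generalize swapMarked.den s2 = s3 at *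
  have hL1 : Mate N G (s1 arrL) := hm1.congr hfill
  obtain ⟨hx1, hx2, hx3⟩ := exchange hW hL1 ht ((hfill t ht).trans hm2)
    (fun x => ∃ i < N, x = alternatingWalk (s arrW) (s1 arrL) t i ∨
      x = s arrW (alternatingWalk (s arrW) (s1 arrL) t i)) (fun x => Iff.rfl)
  have hW3 : ∀ x < N, s3 arrW x = if (∃ i < N, x = alternatingWalk (s arrW) (s1 arrL) t i ∨
      x = s arrW (alternatingWalk (s arrW) (s1 arrL) t i)) then s1 arrL x else s arrW x := by
    intro x hx
    rw [(hswap x hx).1]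
    exact if_congr (hmark x hx) rfl rfl
  have hL3 : ∀ x < N, s3 arrL x = if (∃ i < N, x = alternatingWalk (s arrW) (s1 arrL) t i ∨
      x = s arrW (alternatingWalk (s arrW) (s1 arrL) t i)) then s arrW x else s1 arrL x := by
    intro x hx
    rw [(hswap x hx).2]
    exact if_congr (hmark x hx) rfl rfl
  have hle : miss N (s1 arrL) ≤ s3 arrC 0 := by
    rw [miss_congr hfill, hfr3 arrC (by decide)]
    exact hm3
  rcases report_spec (s := s3)
    (hE.congr (hfr3 _ (by decide)) (hfr3 _ (by decide)) (hfr3 _ (by decide)))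
    (by rw [hfr3 _ (by decide)]; exact hf) (hx2.congr hL3) (by
      rw [miss_congr hL3]
      rcases hx3 with h | ⟨z, -, -, -, -, -, h⟩ <;> omega) with h | ⟨h1, h2, h3⟩
  · exact Or.inl h
  · right
    have hWr : report.den s3 arrW = s3 arrW := den_frame _ (by decide) _
    rw [hWr]
    refine ⟨h1, hx1.congr hW3, ?_⟩
    rw [miss_congr hL3] at h2
    rcases hx3 with h | ⟨z, hz, h4, h5, h7, h6, -⟩
    · omega
    · refine ⟨z, hz, ?_, h4, h7, fun y hy => ?_⟩
      · rw [← hfr3 arrD (by decide)]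
        exact h3 z hz (by rw [hL3 z hz]; exact h5)
      · rw [hW3 y hy]
        exact h6 y hy

/-! ### The barrier and its removal -/

/-- Compute the set `A` of neighbours of `D` outside `D`, with a neighbour in `D` for each. -/
def findBarrier : Cmd :=
  rep 41 arrN (put arrA (var 41) (.const 0) ;; when (not (get arrD (var 41)))
    (rep 42 arrN (when (and (get arrD (var 42)) (get arrAdj (add (get arrMul (var 41)) (var 42))))
      (put arrA (var 41) (.const 1) ;; put arrNb (var 41) (var 42)))))

/-- The specification of `findBarrier` for the vertex `a`. -/
def IsBarrierAt (N : ℕ) (G : ℕ → ℕ → Prop) (D A nb : ℕ → ℕ) (a : ℕ) : Prop :=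
  (A a ≠ 0 ↔ D a = 0 ∧ ∃ d < N, D d ≠ 0 ∧ G a d) ∧
    (A a ≠ 0 → nb a < N ∧ D (nb a) ≠ 0 ∧ G a (nb a))

theorem findBarrier_inner_spec {N : ℕ} {G : ℕ → ℕ → Prop} {s : Memory} (hE : Env N G s) {a : ℕ}
    (ha : a < N) (h41 : s 41 0 = a) (hA : s arrA a = 0) (s' : Memory)
    (hs' : s' = (rep 42 arrN
      (when (and (get arrD (var 42)) (get arrAdj (add (get arrMul (var 41)) (var 42))))
        (put arrA (var 41) (.const 1) ;; put arrNb (var 41) (var 42)))).den s) :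
    (∀ x, x ≠ a → s' arrA x = s arrA x ∧ s' arrNb x = s arrNb x) ∧
      (s' arrA a ≠ 0 ↔ ∃ d < N, s arrD d ≠ 0 ∧ G a d) ∧
      (s' arrA a ≠ 0 → s' arrNb a < N ∧ s arrD (s' arrNb a) ≠ 0 ∧ G a (s' arrNb a)) := by
  have hmain := den_rep (x := 42) (a := arrN) (s := s)
    (c := when (and (get arrD (var 42)) (get arrAdj (add (get arrMul (var 41)) (var 42))))
        (put arrA (var 41) (.const 1) ;; put arrNb (var 41) (var 42)))
    (fun n s' => (∀ x, x ≠ a → s' arrA x = s arrA x ∧ s' arrNb x = s arrNb x) ∧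
      (s' arrA a ≠ 0 ↔ ∃ d < n, s arrD d ≠ 0 ∧ G a d) ∧
      (s' arrA a ≠ 0 → s' arrNb a < N ∧ s arrD (s' arrNb a) ≠ 0 ∧ G a (s' arrNb a))) ?_ ?_
  · rw [hs']
    rwa [hE.size] at hmain
  · simp [Memory.store_ne, hA]
  · rintro d hd s1 hfr h42 ⟨h1, h2, h3⟩
    rw [hE.size] at hd
    have e41 : s1 41 0 = a := by rw [hfr _ (by decide), h41]
    have eD : s1 arrD = s arrD := hfr _ (by decide)
    have eM : s1 arrMul = s arrMul := hfr _ (by decide)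
    have eG : s1 arrAdj = s arrAdj := hfr _ (by decide)
    have hadj := hE.adj a ha d hd
    simp only [den, eval_and, eval, e41, h42, eD, eM, eG, hE.mul a ha, ne_eq]
    by_cases hc : s arrD d ≠ 0 ∧ G a d
    · have hc' : ¬ s arrD d = 0 ∧ ¬ s arrAdj (a * N + d) = 0 := ⟨hc.1, hadj.2 hc.2⟩
      simp only [hc', not_false_iff, and_self, if_true, one_ne_zero, Memory.store_ne,
        Memory.store_same, ne_eq, Nat.reduceEqDiff, e41, h42, true_iff, forall_const]
      refine ⟨fun x hx => ?_, ⟨d, by omega, hc⟩, hd, trivial, hc.2⟩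
      simp only [hx, if_false]
      exact h1 x hx
    · have hc' : ¬ (¬ s arrD d = 0 ∧ ¬ s arrAdj (a * N + d) = 0) :=
        fun h => hc ⟨h.1, hadj.1 h.2⟩
      simp only [hc', if_false, not_true, Memory.store_ne, ne_eq, Nat.reduceEqDiff,
        not_false_iff]
      refine ⟨h1, ?_, h3⟩
      rw [← ne_eq, h2]
      constructor
      · rintro ⟨x, h4, h5⟩
        exact ⟨x, by omega, h5⟩
      · rintro ⟨x, h4, h5⟩
        refine ⟨x, ?_, h5⟩
        rcases Nat.lt_succ_iff_lt_or_eq.1 h4 with h | rfl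
        · exact h
        · exact absurd h5 hc

theorem findBarrier_spec {N : ℕ} {G : ℕ → ℕ → Prop} {s : Memory} (hE : Env N G s) :
    ∀ a < N, IsBarrierAt N G (s arrD) (findBarrier.den s arrA) (findBarrier.den s arrNb) a := by
  have hmain := den_rep (x := 41) (a := arrN) (s := s)
    (c := put arrA (var 41) (.const 0) ;; when (not (get arrD (var 41)))
      (rep 42 arrN (when (and (get arrD (var 42)) (get arrAdj (add (get arrMul (var 41)) (var 42))))
        (put arrA (var 41) (.const 1) ;; put arrNb (var 41) (var 42)))))
    (fun n s' => ∀ a < n, IsBarrierAt N G (s arrD) (s' arrA) (s' arrNb) a) ?_ ?_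
  · rwa [hE.size] at hmain
  · intro a ha; omega
  · intro i hi s1 hfr h41 h
    rw [hE.size] at hi
    rw [den_seq]
    have hs2 : ∀ b, b ≠ arrA → den (put arrA (var 41) (.const 0)) s1 b = s1 b :=
      fun b hb => Memory.store_ne _ _ _ hb
    have hs2A : ∀ x, den (put arrA (var 41) (.const 0)) s1 arrA x =
        if x = i then 0 else s1 arrA x := by
      intro x
      simp only [den, eval, h41, Memory.store_same]
    generalize den (put arrA (var 41) (.const 0)) s1 = s2 at *
    have hfr2 : ∀ b, b ≠ arrA → b ∉ [41, 42, arrNb] → s2 b = s b := by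
      intro b h1 h2
      rw [hs2 b h1]
      refine hfr b ?_
      simp only [List.mem_cons, not_or, List.not_mem_nil, not_false_iff, and_true] at h2
      simp [writes, h1, h2]
    have hE2 : Env N G s2 := hE.congr (hfr2 _ (by decide) (by decide))
      (hfr2 _ (by decide) (by decide)) (hfr2 _ (by decide) (by decide))
    have h41' : s2 41 0 = i := by rw [hs2 _ (by decide), h41]
    have hD : s2 arrD = s arrD := hfr2 _ (by decide) (by decide)
    rw [Memory.store_ne _ _ _ (by decide), Memory.store_ne _ _ _ (by decide)]
    intro a ha
    rw [den]
    by_cases hDi : s arrD i = 0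
    · rw [if_pos (by simp [eval_not, eval, h41', hD, hDi])]
      obtain ⟨h1, h2, h3⟩ := findBarrier_inner_spec hE2 hi h41' (by rw [hs2A]; simp) _ rfl
      generalize den (rep 42 _ _) s2 = s3 at *
      rw [hD] at h2 h3
      by_cases hai : a = i
      · subst hai
        exact ⟨by rw [h2]; simp [hDi], h3⟩
      · have := h a (by omega)
        unfold IsBarrierAt at *
        rw [(h1 a hai).1, (h1 a hai).2, hs2A, if_neg hai, hs2 arrNb (by decide)]
        exact this
    · rw [if_neg (by simp [eval_not, eval, h41', hD, hDi]), den]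
      by_cases hai : a = i
      · subst hai
        unfold IsBarrierAt
        rw [hs2A]
        simp [hDi]
      · have := h a (by omega)
        unfold IsBarrierAt at *
        rw [hs2A, if_neg hai, hs2 arrNb (by decide)]
        exact this

/-- Remove the edges at `A` from the matching `arrM`. -/
def removeBarrier : Cmd :=
  rep 41 arrN (ite (add (get arrA (var 41)) (get arrA (get arrM (var 41))))
    (put arrH (var 41) (var 41)) (put arrH (var 41) (get arrM (var 41))))

theorem removeBarrier_spec {N : ℕ} {s : Memory} (hN : s arrN 0 = N) :
    ∀ x < N, removeBarrier.den s arrH x = isolate (fun y => s arrA y ≠ 0) (s arrM) x := by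
  have hmain := den_rep (x := 41) (a := arrN) (s := s)
    (c := ite (add (get arrA (var 41)) (get arrA (get arrM (var 41))))
      (put arrH (var 41) (var 41)) (put arrH (var 41) (get arrM (var 41))))
    (fun n s' => ∀ x < n, s' arrH x = isolate (fun y => s arrA y ≠ 0) (s arrM) x) ?_ ?_
  · rwa [hN] at hmain
  · intro a ha; omega
  · intro i hi s1 hfr h41 h x hx
    have eA : s1 arrA = s arrA := hfr _ (by decide)
    have eM : s1 arrM = s arrM := hfr _ (by decide)
    rw [Memory.store_ne _ _ _ (by decide), den]
    have hiff : (add (get arrA (var 41)) (get arrA (get arrM (var 41)))).eval s1 ≠ 0 ↔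
        s arrA i ≠ 0 ∨ s arrA (s arrM i) ≠ 0 := by
      simp only [eval, h41, eA, eM]
      omega
    have hput : ∀ v : Expr, (put arrH (var 41) v).den s1 arrH x =
        if x = i then v.eval s1 else s1 arrH x := by
      intro v
      simp only [den, eval, h41, Memory.store_same]
    by_cases hxi : x = i
    · subst hxi
      unfold isolate
      by_cases h1 : s arrA x ≠ 0 ∨ s arrA (s arrM x) ≠ 0
      · rw [if_pos (hiff.2 h1), if_pos h1, hput, if_pos rfl]
        exact h41
      · rw [if_neg (hiff.not.2 h1), if_neg h1, hput, if_pos rfl]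
        simp only [eval, h41, eM]
    · have := h x (by omega)
      split_ifs
      · rw [hput, if_neg hxi, this]
      · rw [hput, if_neg hxi, this]

/-! ### Search inside the components of `D` -/

/-- One step of the search from `42`: move the missed vertex from `44` to `45`. -/
def floodStep : Cmd :=
  when (and (and (not (var arrFound)) (not (var arrAug)))
      (and (and (get arrR (var 44)) (get arrD (var 45)))
        (and (not (get arrR (var 45))) (get arrAdj (add (get arrMul (var 44)) (var 45))))))
    (rep 41 arrN (put arrW (var 41) (get arrRTab (add (get arrMul (var 44)) (var 41)))) ;;
      set arrT (var 45) ;; switch ;;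
      when (not (var arrFound))
        (ite (eq (get arrW (var 44)) (var 44))
          (put arrW (var 44) (var 45) ;; put arrW (var 45) (var 44) ;;
            rep 41 arrN (put arrH (var 41) (get arrW (var 41))) ;; set arrAug (.const 1))
          (put arrR (var 45) (.const 1) ;;
            rep 41 arrN (put arrRTab (add (get arrMul (var 45)) (var 41)) (get arrW (var 41))))))

/-- The search has made progress, or has improved the matching `H0` in `arrH`, or has not changed
it and `Q` holds. -/
def Searching (N : ℕ) (G : ℕ → ℕ → Prop) (H0 : ℕ → ℕ) (Q : Prop) (s : Memory) : Prop :=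
  (s arrFound 0 ≠ 0 ∧ Progress N G s) ∨
    (s arrFound 0 = 0 ∧ s arrAug 0 ≠ 0 ∧ Mate N G (s arrH) ∧
      (∀ a < N, s arrA a ≠ 0 → s arrH a = a) ∧ miss N (s arrH) < miss N H0) ∨
    (s arrFound 0 = 0 ∧ s arrAug 0 = 0 ∧ s arrH = H0 ∧ Q)

theorem Searching.congr {N : ℕ} {G : ℕ → ℕ → Prop} {H0 : ℕ → ℕ} {Q Q' : Prop} {s s' : Memory}
    (h : Searching N G H0 Q s)
    (hfr : ∀ b ∈ [arrFound, arrBest, arrAug, arrH, arrA, arrD, arrC], s' b = s b) (hQ : Q → Q') :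
    Searching N G H0 Q' s' := by
  have e1 := hfr arrFound (by decide)
  have e2 := hfr arrAug (by decide)
  have e3 := hfr arrH (by decide)
  have e4 := hfr arrA (by decide)
  unfold Searching
  rw [e1, e2, e3, e4]
  rcases h with ⟨h1, h2⟩ | h | ⟨h1, h2, h3, h4⟩
  · exact Or.inl ⟨h1, h2.congr (hfr _ (by decide)) (hfr _ (by decide)) (hfr _ (by decide))⟩
  · exact Or.inr (Or.inl h)
  · exact Or.inr (Or.inr ⟨h1, h2, h3, hQ h4⟩)

/-- For every vertex `r` in `arrR`, the table `arrRTab` has a matching that misses the same vertices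
as `H0`, except that it misses `r` instead of `u`. -/
def FloodInv (N : ℕ) (G : ℕ → ℕ → Prop) (H0 : ℕ → ℕ) (u : ℕ) (s : Memory) : Prop :=
  ∀ r < N, s arrR r ≠ 0 → s arrD r ≠ 0 ∧ (r = u ∨ H0 r ≠ r) ∧
    Mate N G (fun x => s arrRTab (r * N + x)) ∧
    ∀ x < N, s arrRTab (r * N + x) = x ↔ x = r ∨ (H0 x = x ∧ x ≠ u)

theorem FloodInv.congr {N : ℕ} {G : ℕ → ℕ → Prop} {H0 : ℕ → ℕ} {u : ℕ} {s s' : Memory}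
    (h : FloodInv N G H0 u s) (h1 : s' arrR = s arrR) (h2 : s' arrRTab = s arrRTab)
    (h3 : s' arrD = s arrD) : FloodInv N G H0 u s' := by
  unfold FloodInv
  rw [h1, h2, h3]
  exact h

/-- What does not change during the search. -/
structure SearchEnv (N : ℕ) (G : ℕ → ℕ → Prop) (H0 : ℕ → ℕ) (s : Memory) : Prop where
  env : Env N G s
  tab : TabInv N G s
  symm : ∀ x < N, ∀ y < N, G x y → G y x
  disj : ∀ a < N, s arrA a ≠ 0 → s arrD a = 0
  mate : Mate N G H0
  missA : ∀ a < N, s arrA a ≠ 0 → H0 a = a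

theorem SearchEnv.congr {N : ℕ} {G : ℕ → ℕ → Prop} {H0 : ℕ → ℕ} {s s' : Memory}
    (h : SearchEnv N G H0 s)
    (hfr : ∀ b ∈ [arrN, arrMul, arrAdj, arrD, arrTab, arrC, arrA], s' b = s b) :
    SearchEnv N G H0 s' where
  env := h.env.congr (hfr _ (by decide)) (hfr _ (by decide)) (hfr _ (by decide))
  tab := h.tab.congr (hfr _ (by decide)) (hfr _ (by decide)) (hfr _ (by decide))
  symm := h.symm
  disj := by rw [hfr arrA (by decide), hfr arrD (by decide)]; exact h.disj
  mate := h.mate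
  missA := by rw [hfr arrA (by decide)]; exact h.missA

/-- The matching kept for `r` is switched so that it misses `t`, at the price of a vertex `z`. If `z
≠ r`, both ends of the edge `r t` are missed and the edge can be added. If `z = r`, the missed
vertex has moved from `r` to `t`. The parameter `P` carries facts of the calling loops through the
three outcomes. -/
theorem floodStep_spec {N : ℕ} {G : ℕ → ℕ → Prop} {H0 : ℕ → ℕ} {s : Memory}
    (hS : SearchEnv N G H0 s) {u r t : ℕ} (hu : u < N) (hHu : H0 u = u) (hDu : s arrD u ≠ 0)
    (hr : r < N) (ht : t < N) (h44 : s 44 0 = r) (h45 : s 45 0 = t)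
    {P : Prop} (h : Searching N G H0 (s arrR u ≠ 0 ∧ FloodInv N G H0 u s ∧ P) s) :
    Searching N G H0 (P ∧ FloodInv N G H0 u (floodStep.den s) ∧
      (∀ x, s arrR x ≠ 0 → floodStep.den s arrR x ≠ 0) ∧
      (s arrR r ≠ 0 → s arrD t ≠ 0 → G r t → floodStep.den s arrR t ≠ 0)) (floodStep.den s) := by
  have hE := hS.env
  rw [floodStep, den]
  have hcond : (and (and (not (var arrFound)) (not (var arrAug)))
      (and (and (get arrR (var 44)) (get arrD (var 45)))
        (and (not (get arrR (var 45))) (get arrAdj (add (get arrMul (var 44)) (var 45)))))).eval s ≠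
        0 ↔ ((s arrFound 0 = 0 ∧ s arrAug 0 = 0) ∧ (s arrR r ≠ 0 ∧ s arrD t ≠ 0) ∧
          s arrR t = 0 ∧ G r t) := by
    simp only [eval_and_ne_zero, eval_not_ne_zero, eval_get, eval_add, eval_const, h44, h45,
      hE.mul r hr]
    rw [← hE.adj r hr t ht]
  split_ifs with hc
  swap
  · rw [den]
    rw [hcond] at hc
    rcases h with h | h | ⟨h1, h2, h3, h4, h5, hP⟩
    · exact Or.inl h
    · exact Or.inr (Or.inl h)
    · refine Or.inr (Or.inr ⟨h1, h2, h3, hP, h5, fun _ h => h, fun h6 h7 h8 h9 => ?_⟩)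
      exact hc ⟨⟨h1, h2⟩, ⟨h6, h7⟩, h9, h8⟩
  rw [hcond] at hc
  obtain ⟨⟨hf0, ha0⟩, ⟨hRr, hDt⟩, hRt, hGrt⟩ := hc
  obtain ⟨hH, hRu, hFl, hP⟩ : s arrH = H0 ∧ s arrR u ≠ 0 ∧ FloodInv N G H0 u s ∧ P := by
    rcases h with h | h | h
    · exact absurd hf0 h.1
    · exact absurd ha0 h.2.1
    · exact h.2.2
  obtain ⟨hDr, hur, hMr, hmr⟩ := hFl r hr hRr
  have hrt : r ≠ t := fun h => hRr (h ▸ hRt)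
  rw [den_seq, den_seq, den_seq]
  have hfill := (den_fill (x := 41) (a := arrN) (b := arrW) (idx := var 41)
      (val := get arrRTab (add (get arrMul (var 44)) (var 41))) (s := s) 0
      (fun x => s arrRTab (r * N + x)) (by decide) (by
        intro i _ s' h4 h5 _
        simp [eval, h5, h4 arrRTab, h4 arrMul, h4 44, h44, hE.mul r hr])).1
  simp only [Nat.zero_add, hE.size] at hfill
  have hfr1 : ∀ b, b ∉ [41, arrW] → (rep 41 arrN (put arrW (var 41)
      (get arrRTab (add (get arrMul (var 44)) (var 41))))).den s b = s b :=
    fun b hb => den_frame _ (by simpa [writes] using hb) _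
  generalize (rep 41 arrN (put arrW (var 41)
      (get arrRTab (add (get arrMul (var 44)) (var 41))))).den s = s1 at *
  generalize hs2 : den (set arrT (var 45)) s1 = s2
  have hfr2 : ∀ b, b ∉ [41, arrW, arrT] → s2 b = s b := by
    intro b hb
    simp only [List.mem_cons, not_or, List.not_mem_nil, not_false_iff, and_true] at hb
    rw [← hs2, den, Memory.store_ne _ _ _ hb.2.2]
    exact hfr1 b (by simp [hb])
  have hW2 : ∀ x < N, s2 arrW x = s arrRTab (r * N + x) := by
    intro x hx
    rw [← hs2, den, Memory.store_ne _ _ _ (by decide)]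
    exact hfill x hx
  have hT2 : s2 arrT 0 = t := by
    rw [← hs2]
    simp [den, eval, Memory.store_same, hfr1 45 (by decide), h45]
  have hS2 : SearchEnv N G H0 s2 := hS.congr (fun b hb => hfr2 b (by
    revert b; decide))
  have hsw := switch_spec hS2.env hS2.tab (by rw [hfr2 _ (by decide)]; exact hf0)
    (hMr.congr hW2) (by rw [hT2]; exact ht) (by rw [hT2, hfr2 _ (by decide)]; exact hDt)
  have hfr3 : ∀ b, b ∉ switch.writes → b ∉ [41, arrW, arrT] → switch.den s2 b = s b := by
    intro b h1 h2
    rw [den_frame _ h1, hfr2 b h2]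
  generalize switch.den s2 = s3 at *
  rw [den]
  rcases hsw with ⟨hf3, hPr⟩ | ⟨hf3, hW3, z, hz, hDz, hWz, hzt, hmiss3⟩
  · rw [if_neg (by simp [eval_not, eval, hf3]), den]
    exact Or.inl ⟨hf3, hPr⟩
  rw [if_pos (by simp [eval_not, eval, hf3]), den]
  rw [hT2] at hmiss3 hzt
  have e44 : s3 44 0 = r := by rw [hfr3 _ (by decide) (by decide), h44]
  have e45 : s3 45 0 = t := by rw [hfr3 _ (by decide) (by decide), h45]
  have hmissr : ∀ x < N, s2 arrW x = x ↔ x = r ∨ (H0 x = x ∧ x ≠ u) := by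
    intro x hx
    rw [hW2 x hx]
    exact hmr x hx
  have ht3 : s3 arrW t = t := (hmiss3 t ht).2 (Or.inl rfl)
  by_cases hw : s3 arrW r = r
  · rw [if_pos (by simp [eval_eq, eval, e44, hw]), den_seq, den_seq, den_seq]
    generalize hs4 : den (put arrW (var 45) (var 44)) (den (put arrW (var 44) (var 45)) s3) = s4
    have hfr4 : ∀ b, b ≠ arrW → s4 b = s3 b := by
      intro b hb
      rw [← hs4]
      simp only [den]
      rw [Memory.store_ne _ _ _ hb, Memory.store_ne _ _ _ hb]
    have hW4 : ∀ x, s4 arrW x = addEdge (s3 arrW) r t x := by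
      intro x
      rw [← hs4]
      simp only [den, eval, Memory.store_same, Memory.store_ne, ne_eq, Nat.reduceEqDiff,
        not_false_iff, e44, e45, addEdge]
    have hN4 : s4 arrN 0 = N := by
      rw [hfr4 _ (by decide), hfr3 _ (by decide) (by decide), hE.size]
    have hfill4 := (den_fill (x := 41) (a := arrN) (b := arrH) (idx := var 41)
      (val := get arrW (var 41)) (s := s4) 0
      (fun x => addEdge (s3 arrW) r t x) (by decide) (by
        intro i _ s' h4 h5 _
        simp [eval, h5, h4 arrW, hW4])).1
    simp only [Nat.zero_add, hN4] at hfill4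
    have hfr5 : ∀ b, b ∉ [41, arrH] → (rep 41 arrN (put arrH (var 41)
        (get arrW (var 41)))).den s4 b = s4 b :=
      fun b hb => den_frame _ (by simpa [writes] using hb) _
    generalize (rep 41 arrN (put arrH (var 41) (get arrW (var 41)))).den s4 = s5 at *
    right
    left
    have hfr6 : ∀ b, b ≠ arrAug → den (set arrAug (.const 1)) s5 b = s5 b :=
      fun b hb => Memory.store_ne _ _ _ hb
    rw [hfr6 arrFound (by decide), hfr6 arrH (by decide), hfr6 arrA (by decide)]
    rw [hfr5 arrFound (by decide), hfr4 arrFound (by decide)]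
    rw [hfr5 arrA (by decide), hfr4 arrA (by decide), hfr3 arrA (by decide) (by decide)]
    refine ⟨hf3, by simp [den, eval, Memory.store_same], ?_, ?_, ?_⟩
    · exact (hW3.addEdge hr ht hw ht3 hGrt (hS.symm r hr t ht hGrt)).congr hfill4
    -- A vertex of `A` is outside `D`, so it differs from `r`, `t`, `u` and `z` and stays missed.
    · intro a ha hAa
      rw [hfill4 a ha, addEdge_eq_self_iff hrt]
      have hDa := hS.disj a ha hAa
      have har : a ≠ r := fun h => hDr (h ▸ hDa)
      have hat : a ≠ t := fun h => hDt (h ▸ hDa)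
      have hau : a ≠ u := fun h => hDu (h ▸ hDa)
      have haz : a ≠ z := by
        rintro rfl
        rw [hfr2 _ (by decide)] at hDz
        exact hDz hDa
      refine ⟨(hmiss3 a ha).2 (Or.inr ⟨(hmissr a ha).2 (Or.inr ⟨hS.missA a ha hAa, hau⟩), haz⟩),
        har, hat⟩
    -- Two replacements do not increase the number of missed vertices, and the new edge lowers it by
    -- two.
    · rw [miss_congr hfill4]
      have e1 := miss_addEdge hr ht hw ht3 hrt
      have e2 : miss N (s3 arrW) ≤ miss N (s2 arrW) := miss_le_of_exchange hz hWz hmiss3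
      have e3 : miss N (s2 arrW) ≤ miss N H0 := miss_le_of_exchange hu hHu hmissr
      omega
  · rw [if_neg (by simp [eval_eq, eval, e44, hw]), den_seq]
    -- `r` was missed before the switch and is not missed after it, so it is the vertex given up.
    have hzr : z = r := by
      by_contra hzr
      exact hw ((hmiss3 r hr).2 (Or.inr ⟨(hmissr r hr).2 (Or.inl rfl), fun h => hzr h.symm⟩))
    subst hzr
    -- If `t` had been missed already, the exchange would be trivial and `z = t`. So `t` is matched
    -- by the matching of `r`, and then also by `H0`, since `t ≠ u`: the vertex `u` is marked and
    -- `t` is not.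
    have htr : ¬ s2 arrW t = t := fun h1 => hrt (hzt h1)
    have htH : H0 t ≠ t := by
      intro h1
      have htu : t ≠ u := fun h => hRu (h ▸ hRt)
      exact htr ((hmissr t ht).2 (Or.inr ⟨h1, htu⟩))
    generalize hs4 : den (put arrR (var 45) (.const 1)) s3 = s4
    have hfr4 : ∀ b, b ≠ arrR → s4 b = s3 b := by
      intro b hb
      rw [← hs4]
      simp only [den]
      rw [Memory.store_ne _ _ _ hb]
    have hR4 : ∀ x, s4 arrR x = if x = t then 1 else s arrR x := by
      intro x
      rw [← hs4]
      simp only [den, eval, Memory.store_same, e45, hfr3 arrR (by decide) (by decide)]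
    have hN4 : s4 arrN 0 = N := by
      rw [hfr4 _ (by decide), hfr3 _ (by decide) (by decide), hE.size]
    have hM4 : s4 arrMul = s arrMul := by
      rw [hfr4 _ (by decide), hfr3 _ (by decide) (by decide)]
    have h454 : s4 45 0 = t := by rw [hfr4 _ (by decide), e45]
    obtain ⟨hfill4, hout4⟩ := den_fill (x := 41) (a := arrN) (b := arrRTab)
      (idx := add (get arrMul (var 45)) (var 41)) (val := get arrW (var 41)) (s := s4) (t * N)
      (s3 arrW) (by decide) (by
        intro i _ s' h4 h5 _
        simp [eval, h5, h4 arrW, h4 arrMul, h4 45, h454, hM4, hE.mul t ht, hfr4 arrW])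
    rw [hN4] at hfill4 hout4
    rw [hfr4 arrRTab (by decide), hfr3 arrRTab (by decide) (by decide)] at hout4
    have hfr5 : ∀ b, b ∉ [41, arrRTab] → (rep 41 arrN (put arrRTab
        (add (get arrMul (var 45)) (var 41)) (get arrW (var 41)))).den s4 b = s4 b :=
      fun b hb => den_frame _ (by simpa [writes] using hb) _
    generalize (rep 41 arrN (put arrRTab
        (add (get arrMul (var 45)) (var 41)) (get arrW (var 41)))).den s4 = s5 at *
    have hR5 : ∀ x, s5 arrR x = if x = t then 1 else s arrR x := by
      intro x
      rw [hfr5 _ (by decide), hR4]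
    have hfr : ∀ b, b ∉ [41, arrRTab] → b ≠ arrR → b ∉ switch.writes → b ∉ [41, arrW, arrT] →
        s5 b = s b := by
      intro b h1 h2 h3 h4
      rw [hfr5 b h1, hfr4 b h2, hfr3 b h3 h4]
    refine Or.inr (Or.inr ⟨?_, ?_, ?_, hP, ?_, ?_, ?_⟩)
    · rw [hfr5 _ (by decide), hfr4 _ (by decide), hf3]
    · rw [hfr _ (by decide) (by decide) (by decide) (by decide), ha0]
    · rw [hfr _ (by decide) (by decide) (by decide) (by decide), hH]
    · intro y hy hRy
      rw [hfr arrD (by decide) (by decide) (by decide) (by decide)]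
      by_cases hyt : y = t
      · subst hyt
        refine ⟨hDt, Or.inr htH, hW3.congr hfill4, fun x hx => ?_⟩
        rw [hfill4 x hx, hmiss3 x hx, hmissr x hx]
        constructor
        · rintro (h | ⟨h | h, h'⟩)
          · exact Or.inl h
          · exact absurd h h'
          · exact Or.inr h
        · rintro (h | h)
          · exact Or.inl h
          · by_cases hxz : x = z
            · subst hxz
              rcases hur with h' | h'
              · exact absurd h' h.2
              · exact absurd h.1 h'
            · exact Or.inr ⟨Or.inr h, hxz⟩
      · rw [hR5, if_neg hyt] at hRy
        obtain ⟨h1, h2, h3, h4⟩ := hFl y hy hRy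
        have hrow : ∀ x < N, s5 arrRTab (y * N + x) = s arrRTab (y * N + x) := by
          intro x hx
          apply hout4
          rcases lt_or_gt_of_ne hyt with h | h
          · left
            calc y * N + x < y * N + N := by omega
              _ = (y + 1) * N := by ring
              _ ≤ t * N := Nat.mul_le_mul_right _ h
          · right
            calc t * N + N = (t + 1) * N := by ring
              _ ≤ y * N := Nat.mul_le_mul_right _ h
              _ ≤ y * N + x := by omega
        refine ⟨h1, h2, h3.congr hrow, fun x hx => ?_⟩
        rw [hrow x hx]
        exact h4 x hx
    · intro x hx
      rw [hR5]
      split_ifs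
      · exact one_ne_zero
      · exact hx
    · intro _ _ _
      rw [hR5]
      simp

section Flood

variable {N : ℕ} {G : ℕ → ℕ → Prop} {H0 : ℕ → ℕ} {s : Memory} {u : ℕ} {P : Prop}

/-- Search along all edges at `44`. -/
def floodVertex : Cmd := rep 45 arrN floodStep

theorem floodVertex_spec (hS : SearchEnv N G H0 s) (hu : u < N) (hHu : H0 u = u)
    (hDu : s arrD u ≠ 0) {r : ℕ} (hr : r < N) (h44 : s 44 0 = r)
    (h : Searching N G H0 (s arrR u ≠ 0 ∧ FloodInv N G H0 u s ∧ P) s) :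
    Searching N G H0 (P ∧ FloodInv N G H0 u (floodVertex.den s) ∧
      (∀ x, s arrR x ≠ 0 → floodVertex.den s arrR x ≠ 0) ∧
      (s arrR r ≠ 0 → ∀ t < N, s arrD t ≠ 0 → G r t → floodVertex.den s arrR t ≠ 0))
      (floodVertex.den s) := by
  have hmain := den_rep (x := 45) (a := arrN) (s := s) (c := floodStep)
    (fun n s' => Searching N G H0 ((P ∧ s arrR u ≠ 0) ∧ FloodInv N G H0 u s' ∧
      (∀ x, s arrR x ≠ 0 → s' arrR x ≠ 0) ∧
      (s arrR r ≠ 0 → ∀ t < n, s arrD t ≠ 0 → G r t → s' arrR t ≠ 0)) s') ?_ ?_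
  · rw [hS.env.size] at hmain
    exact hmain.congr (fun _ _ => rfl) (fun h => ⟨h.1.1, h.2⟩)
  · refine h.congr (fun b hb => Memory.store_ne _ _ _ (by revert b; decide)) fun h => ?_
    refine ⟨⟨h.2.2, h.1⟩, h.2.1.congr (Memory.store_ne _ _ _ (by decide))
      (Memory.store_ne _ _ _ (by decide)) (Memory.store_ne _ _ _ (by decide)), fun x hx => ?_,
      by omega⟩
    rw [Memory.store_ne _ _ _ (by decide)]
    exact hx
  · intro i hi s1 hfr h45 h1
    rw [hS.env.size] at hi
    have hS1 : SearchEnv N G H0 s1 := hS.congr (fun b hb => hfr b (by revert b; decide))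
    have hD : s1 arrD = s arrD := hfr _ (by decide)
    have h2 := floodStep_spec hS1 hu hHu (by rw [hD]; exact hDu) hr hi
      (by rw [hfr _ (by decide), h44]) h45
      (h1.congr (Q' := _ ∧ _ ∧ ((P ∧ s arrR u ≠ 0) ∧ (∀ x, s arrR x ≠ 0 → s1 arrR x ≠ 0) ∧
      (s arrR r ≠ 0 → ∀ t < i, s arrD t ≠ 0 → G r t → s1 arrR t ≠ 0))) (fun _ _ => rfl)
      (fun h => ⟨h.2.2.1 u h.1.2, h.2.1, h.1, h.2.2⟩))
    refine h2.congr (fun b hb => Memory.store_ne _ _ _ (by revert b; decide)) ?_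
    rintro ⟨⟨h3, h4, h5⟩, h6, h7, h8⟩
    rw [Memory.store_ne _ _ _ (by decide)]
    refine ⟨h3, h6.congr (Memory.store_ne _ _ _ (by decide))
      (Memory.store_ne _ _ _ (by decide)) (Memory.store_ne _ _ _ (by decide)),
      fun x hx => h7 x (h4 x hx), fun h9 t ht h10 h11 => ?_⟩
    rcases Nat.lt_succ_iff_lt_or_eq.1 ht with ht | rfl
    · exact h7 t (h5 h9 t ht h10 h11)
    · exact h8 (h4 r h9) (by rw [hD]; exact h10) h11

/-- Search along all edges. -/
def floodRound : Cmd := rep 44 arrN floodVertex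

/-- Marks are never removed, so each vertex marked at the start of the round is expanded along all
its edges; the marked set covers one more layer of the ball around `u`. -/
theorem floodRound_spec (hS : SearchEnv N G H0 s) (hu : u < N) (hHu : H0 u = u)
    (hDu : s arrD u ≠ 0)
    (h : Searching N G H0 (s arrR u ≠ 0 ∧ FloodInv N G H0 u s ∧ P) s) :
    Searching N G H0 (P ∧ FloodInv N G H0 u (floodRound.den s) ∧
      (∀ x, s arrR x ≠ 0 → floodRound.den s arrR x ≠ 0) ∧
      (∀ r < N, s arrR r ≠ 0 → ∀ t < N, s arrD t ≠ 0 → G r t → floodRound.den s arrR t ≠ 0))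
      (floodRound.den s) := by
  have hmain := den_rep (x := 44) (a := arrN) (s := s) (c := floodVertex)
    (fun n s' => Searching N G H0 ((P ∧ s arrR u ≠ 0) ∧ FloodInv N G H0 u s' ∧
      (∀ x, s arrR x ≠ 0 → s' arrR x ≠ 0) ∧
      (∀ r < n, s arrR r ≠ 0 → ∀ t < N, s arrD t ≠ 0 → G r t → s' arrR t ≠ 0)) s') ?_ ?_
  · rw [hS.env.size] at hmain
    exact hmain.congr (fun _ _ => rfl) (fun h => ⟨h.1.1, h.2⟩)
  · refine h.congr (fun b hb => Memory.store_ne _ _ _ (by revert b; decide)) fun h => ?_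
    refine ⟨⟨h.2.2, h.1⟩, h.2.1.congr (Memory.store_ne _ _ _ (by decide))
      (Memory.store_ne _ _ _ (by decide)) (Memory.store_ne _ _ _ (by decide)), fun x hx => ?_,
      by omega⟩
    rw [Memory.store_ne _ _ _ (by decide)]
    exact hx
  · intro i hi s1 hfr h44 h1
    rw [hS.env.size] at hi
    have hS1 : SearchEnv N G H0 s1 := hS.congr (fun b hb => hfr b (by revert b; decide))
    have hD : s1 arrD = s arrD := hfr _ (by decide)
    have h2 := floodVertex_spec hS1 hu hHu (by rw [hD]; exact hDu) hi h44
      (h1.congr (Q' := _ ∧ _ ∧ ((P ∧ s arrR u ≠ 0) ∧ (∀ x, s arrR x ≠ 0 → s1 arrR x ≠ 0) ∧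
      (∀ r < i, s arrR r ≠ 0 → ∀ t < N, s arrD t ≠ 0 → G r t → s1 arrR t ≠ 0))) (fun _ _ => rfl)
      (fun h => ⟨h.2.2.1 u h.1.2, h.2.1, h.1, h.2.2⟩))
    refine h2.congr (fun b hb => Memory.store_ne _ _ _ (by revert b; decide)) ?_
    rintro ⟨⟨h3, h4, h5⟩, h6, h7, h8⟩
    rw [Memory.store_ne _ _ _ (by decide)]
    refine ⟨h3, h6.congr (Memory.store_ne _ _ _ (by decide))
      (Memory.store_ne _ _ _ (by decide)) (Memory.store_ne _ _ _ (by decide)),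
      fun x hx => h7 x (h4 x hx), fun r hr h9 t ht h10 h11 => ?_⟩
    rcases Nat.lt_succ_iff_lt_or_eq.1 hr with hr | rfl
    · exact h7 t (h5 r hr h9 t ht h10 h11)
    · exact h8 (h4 r h9) t ht (by rw [hD]; exact h10) h11

/-- Search from the vertex `42`. -/
def floodFrom : Cmd :=
  rep 41 arrN (put arrR (var 41) (.const 0)) ;; put arrR (var 42) (.const 1) ;;
  rep 41 arrN (put arrRTab (add (get arrMul (var 42)) (var 41)) (get arrH (var 41))) ;;
  rep 43 arrN floodRound

/-- `H0` misses no other vertex of the component of `u`. -/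
def Alone (N : ℕ) (G : ℕ → ℕ → Prop) (H0 D : ℕ → ℕ) (u : ℕ) : Prop :=
  ∀ x, ReachIn N G (fun x => D x ≠ 0) u x → H0 x = x → x = u

/-- A search that ends without success has marked the whole component of `u` after `N` rounds, and
`FloodInv` says that `H0` matches every marked vertex other than `u`. -/
theorem floodFrom_spec (hS : SearchEnv N G H0 s) (hu : u < N) (hHu : H0 u = u)
    (hDu : s arrD u ≠ 0) (h42 : s 42 0 = u) (hf : s arrFound 0 = 0) (ha : s arrAug 0 = 0)
    (hH : s arrH = H0) (hP : P) :
    Searching N G H0 (P ∧ Alone N G H0 (s arrD) u) (floodFrom.den s) := by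
  rw [floodFrom, den_seq, den_seq, den_seq]
  have hfill := (den_fill (x := 41) (a := arrN) (b := arrR) (idx := var 41)
      (val := .const 0) (s := s) 0 (fun _ => 0) (by decide) (by
        intro i _ s' h4 h5 _
        simp [eval, h5])).1
  simp only [Nat.zero_add, hS.env.size] at hfill
  have hfr1 : ∀ b, b ∉ [41, arrR] → (rep 41 arrN (put arrR (var 41) (.const 0))).den s b = s b :=
    fun b hb => den_frame _ (by simpa [writes] using hb) _
  generalize (rep 41 arrN (put arrR (var 41) (.const 0))).den s = s1 at *
  generalize hs2 : den (put arrR (var 42) (.const 1)) s1 = s2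
  have hfr2 : ∀ b, b ∉ [41, arrR] → s2 b = s b := by
    intro b hb
    have hb' := hb
    simp only [List.mem_cons, not_or, List.not_mem_nil, not_false_iff, and_true] at hb
    rw [← hs2, den, Memory.store_ne _ _ _ hb.2]
    exact hfr1 b hb'
  have hR2 : ∀ x < N, s2 arrR x = if x = u then 1 else 0 := by
    intro x hx
    rw [← hs2]
    simp only [den, eval, Memory.store_same, hfr1 42 (by decide), h42, hfill x hx]
  have hfill3 := (den_fill (x := 41) (a := arrN) (b := arrRTab)
      (idx := add (get arrMul (var 42)) (var 41)) (val := get arrH (var 41)) (s := s2) (u * N)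
      (s arrH) (by decide) (by
        intro i _ s' h4 h5 _
        simp [eval, h5, h4 arrH, h4 arrMul, h4 42, h42, hfr2, hS.env.mul u hu])).1
  rw [hfr2 arrN (by decide), hS.env.size] at hfill3
  have hfr3 : ∀ b, b ∉ [41, arrRTab] → (rep 41 arrN (put arrRTab
      (add (get arrMul (var 42)) (var 41)) (get arrH (var 41)))).den s2 b = s2 b :=
    fun b hb => den_frame _ (by simpa [writes] using hb) _
  generalize (rep 41 arrN (put arrRTab
      (add (get arrMul (var 42)) (var 41)) (get arrH (var 41)))).den s2 = s3 at *
  have hfr : ∀ b, b ∉ [41, arrRTab] → b ∉ [41, arrR] → s3 b = s b := by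
    intro b h1 h2
    rw [hfr3 b h1, hfr2 b h2]
  have hR3 : ∀ x < N, s3 arrR x = if x = u then 1 else 0 := by
    intro x hx
    rw [hfr3 _ (by decide), hR2 x hx]
  have hS3 : SearchEnv N G H0 s3 :=
    hS.congr (fun b hb => hfr b (by revert b; decide) (by revert b; decide))
  have hD3 : s3 arrD = s arrD := hfr _ (by decide) (by decide)
  have hFl3 : FloodInv N G H0 u s3 := by
    intro r hr hRr
    have hru : r = u := by
      by_contra hne
      rw [hR3 r hr, if_neg hne] at hRr
      exact hRr rfl
    subst hru
    rw [hD3]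
    refine ⟨hDu, Or.inl rfl, ?_, fun x hx => ?_⟩
    · refine hS.mate.congr fun x hx => ?_
      rw [hfill3 x hx, hH]
    · rw [hfill3 x hx, hH]
      constructor
      · intro h
        by_cases hx : x = r
        · exact Or.inl hx
        · exact Or.inr ⟨h, hx⟩
      · rintro (rfl | h)
        · exact hHu
        · exact h.1
  have hmain := den_rep (x := 43) (a := arrN) (s := s3) (c := floodRound)
    (fun n s' => Searching N G H0 (P ∧ FloodInv N G H0 u s' ∧
      ∀ x, ballIn N G (fun x => s arrD x ≠ 0) u n x → s' arrR x ≠ 0) s') ?_ ?_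
  · rw [hS3.env.size] at hmain
    have hDend : (rep 43 arrN floodRound).den s3 arrD = s3 arrD := den_frame _ (by decide) _
    refine hmain.congr (fun _ _ => rfl) ?_
    rintro ⟨h1, h2, h3⟩
    refine ⟨h1, fun x hx hHx => ?_⟩
    have hxN := (hx.mem (D := fun x => s arrD x ≠ 0) hu hDu).1
    obtain ⟨-, h4, -⟩ := h2 x hxN (h3 x (hx.ballIn hu))
    rcases h4 with h4 | h4
    · exact h4
    · exact absurd hHx h4
  · right; right
    rw [Memory.store_ne _ _ _ (by decide), Memory.store_ne _ _ _ (by decide),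
      Memory.store_ne _ _ _ (by decide), Memory.store_ne _ _ _ (by decide)]
    refine ⟨?_, ?_, ?_, hP, hFl3.congr (Memory.store_ne _ _ _ (by decide))
      (Memory.store_ne _ _ _ (by decide)) (Memory.store_ne _ _ _ (by decide)), ?_⟩
    · rw [hfr _ (by decide) (by decide), hf]
    · rw [hfr _ (by decide) (by decide), ha]
    · rw [hfr _ (by decide) (by decide), hH]
    · intro x hx
      rw [show x = u from hx, hR3 u hu]
      simp
  · intro i hi s4 hfr4 _ h4
    have hS4 : SearchEnv N G H0 s4 := hS3.congr (fun b hb => hfr4 b (by revert b; decide))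
    have hD4 : s4 arrD = s arrD := by rw [hfr4 _ (by decide), hD3]
    have hball : ∀ i, ballIn N G (fun x => s arrD x ≠ 0) u i u := by
      intro i
      induction i with
      | zero => rfl
      | succ i ih => exact Or.inl ih
    have h5 := floodRound_spec hS4 hu hHu (by rw [hD4]; exact hDu)
      (h4.congr (Q' := _ ∧ _ ∧ (P ∧ ∀ x, ballIn N G (fun x => s arrD x ≠ 0) u i x →
        s4 arrR x ≠ 0)) (fun _ _ => rfl) (fun h => ⟨h.2.2 u (hball i), h.2.1, h.1, h.2.2⟩))
    refine h5.congr (fun b hb => Memory.store_ne _ _ _ (by revert b; decide)) ?_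
    rintro ⟨⟨h6, h7⟩, h8, h9, h10⟩
    rw [Memory.store_ne _ _ _ (by decide)]
    refine ⟨h6, h8.congr (Memory.store_ne _ _ _ (by decide))
      (Memory.store_ne _ _ _ (by decide)) (Memory.store_ne _ _ _ (by decide)), ?_⟩
    rintro x (hx | ⟨r, hr, hG, hDx, hxN⟩)
    · exact h9 x (h7 x hx)
    · exact h10 r (ballIn_lt hu hr) (h7 r hr) x hxN (by rw [hD4]; exact hDx) hG

/-- Search from all missed vertices of `D`. -/
def floodAll : Cmd :=
  rep 42 arrN (when (and (and (not (var arrFound)) (not (var arrAug)))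
    (and (eq (get arrH (var 42)) (var 42)) (get arrD (var 42)))) floodFrom)

/-- The searches stop at the first success; without one they all start from the same `H0`, so their
conclusions hold together. -/
theorem floodAll_spec (hS : SearchEnv N G H0 s) (hf : s arrFound 0 = 0) (ha : s arrAug 0 = 0)
    (hH : s arrH = H0) :
    Searching N G H0 (∀ u < N, s arrD u ≠ 0 → H0 u = u → Alone N G H0 (s arrD) u)
      (floodAll.den s) := by
  have hmain := den_rep (x := 42) (a := arrN) (s := s)
    (c := when (and (and (not (var arrFound)) (not (var arrAug)))
      (and (eq (get arrH (var 42)) (var 42)) (get arrD (var 42)))) floodFrom)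
    (fun n s' => Searching N G H0
      (∀ u < n, s arrD u ≠ 0 → H0 u = u → Alone N G H0 (s arrD) u) s') ?_ ?_
  · rw [hS.env.size] at hmain
    exact hmain
  · right; right
    rw [Memory.store_ne _ _ _ (by decide), Memory.store_ne _ _ _ (by decide),
      Memory.store_ne _ _ _ (by decide)]
    exact ⟨hf, ha, hH, by omega⟩
  · intro i hi s1 hfr h42 h
    rw [hS.env.size] at hi
    refine Searching.congr (s := den _ s1) ?_
      (fun b hb => Memory.store_ne _ _ _ (by revert b; decide)) id
    have hS1 : SearchEnv N G H0 s1 := hS.congr (fun b hb => hfr b (by revert b; decide))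
    have hD : s1 arrD = s arrD := hfr _ (by decide)
    rw [den]
    split_ifs with hc
    · simp only [eval_and_ne_zero, eval_not_ne_zero, eval_eq_ne_zero, eval_get, eval_const, h42]
        at hc
      obtain ⟨⟨hf1, ha1⟩, hHi, hDi⟩ := hc
      rcases h with h | h | h
      · exact absurd hf1 h.1
      · exact absurd ha1 h.2.1
      · rw [h.2.2.1] at hHi
        have h2 := floodFrom_spec hS1 hi hHi hDi h42 hf1 ha1 h.2.2.1 h.2.2.2
        refine h2.congr (fun _ _ => rfl) ?_
        rintro ⟨h3, h4⟩ u hu h5 h6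
        rcases Nat.lt_succ_iff_lt_or_eq.1 hu with hu | rfl
        · exact h3 u hu h5 h6
        · rw [hD] at h4
          exact h4
    · rw [den]
      simp only [eval_and_ne_zero, eval_not_ne_zero, eval_eq_ne_zero, eval_get, eval_const, h42]
        at hc
      rcases h with h | h | ⟨h1, h2, h3, h4⟩
      · exact Or.inl h
      · exact Or.inr (Or.inl h)
      · refine Or.inr (Or.inr ⟨h1, h2, h3, fun u hu h5 h6 => ?_⟩)
        rcases Nat.lt_succ_iff_lt_or_eq.1 hu with hu | rfl
        · exact h4 u hu h5 h6
        · rw [h3, hD] at hc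
          exact absurd ⟨⟨h1, h2⟩, h6, h5⟩ hc

end Flood

/-! ### Rematching the barrier -/

/-- Match the vertices of `A` to vertices of `D`. -/
def restoreBarrier : Cmd :=
  rep 41 arrN (put arrW (var 41) (get arrH (var 41))) ;;
  rep 46 arrN (when (and (not (var arrFound)) (get arrA (var 46)))
    (set arrT (get arrNb (var 46)) ;; switch ;;
      when (not (var arrFound))
        (put arrW (var 46) (var arrT) ;; put arrW (var arrT) (var 46))))

/-- A switch frees the chosen neighbour in `D` of a vertex of `A`. The vertex it gives up lies in
`D`, so it is no vertex of `A` still waiting for its edge, and each of the `|A|` new edges lowers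
the number of missed vertices by two. Missed vertices outside `A` and `D` are never touched, so the
final report can rule them out. -/
theorem restoreBarrier_spec {N : ℕ} {G : ℕ → ℕ → Prop} {s : Memory} (hE : Env N G s)
    (hT : TabInv N G s) (hG : ∀ x < N, ∀ y < N, G x y → G y x)
    (hA : ∀ a < N, IsBarrierAt N G (s arrD) (s arrA) (s arrNb) a)
    (hf : s arrFound 0 = 0) (hH : Mate N G (s arrH)) (hHA : ∀ a < N, s arrA a ≠ 0 → s arrH a = a)
    (s' : Memory) (hs' : s' = restoreBarrier.den s) :
    (s' arrFound 0 ≠ 0 ∧ Progress N G s') ∨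
      (s' arrFound 0 = 0 ∧ Mate N G (s' arrW) ∧
        miss N (s' arrW) + 2 * ((Finset.range N).filter fun a => s arrA a ≠ 0).card ≤
          miss N (s arrH) ∧
        ∀ x < N, s arrA x = 0 → s arrD x = 0 → s arrH x = x → s' arrW x = x) := by
  rw [restoreBarrier, den_seq] at hs'
  have hfill := (den_fill (x := 41) (a := arrN) (b := arrW) (idx := var 41)
      (val := get arrH (var 41)) (s := s) 0 (s arrH) (by decide) (by
        intro i _ s' h4 h5 _
        simp [eval, h5, h4 arrH])).1
  simp only [Nat.zero_add, hE.size] at hfill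
  have hfr1 : ∀ b, b ∉ [41, arrW] →
      (rep 41 arrN (put arrW (var 41) (get arrH (var 41)))).den s b = s b :=
    fun b hb => den_frame _ (by simpa [writes] using hb) _
  generalize (rep 41 arrN (put arrW (var 41) (get arrH (var 41)))).den s = s1 at *
  have hmain := den_rep (x := 46) (a := arrN) (s := s1)
    (c := when (and (not (var arrFound)) (get arrA (var 46)))
      (set arrT (get arrNb (var 46)) ;; switch ;;
      when (not (var arrFound))
        (put arrW (var 46) (var arrT) ;; put arrW (var arrT) (var 46))))
    (fun n s' => (s' arrFound 0 ≠ 0 ∧ Progress N G s') ∨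
      (s' arrFound 0 = 0 ∧ Mate N G (s' arrW) ∧
        miss N (s' arrW) + 2 * ((Finset.range n).filter fun a => s arrA a ≠ 0).card ≤
          miss N (s arrH) ∧ (∀ a < N, n ≤ a → s arrA a ≠ 0 → s' arrW a = a) ∧
        ∀ x < N, s arrA x = 0 → s arrD x = 0 → s arrH x = x → s' arrW x = x)) ?_ ?_
  · rw [hfr1 arrN (by decide), hE.size, ← hs'] at hmain
    rcases hmain with h | ⟨h1, h2, h3, -, h4⟩
    · exact Or.inl h
    · exact Or.inr ⟨h1, h2, h3, h4⟩
  · right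
    rw [Memory.store_ne _ _ _ (by decide), Memory.store_ne _ _ _ (by decide), miss_congr hfill]
    refine ⟨by rw [hfr1 _ (by decide), hf], hH.congr hfill, by simp, fun a ha _ h => ?_,
      fun x hx _ _ h => ?_⟩
    · rw [hfill a ha, hHA a ha h]
    · rw [hfill x hx, h]
  · intro i hi s2 hfr h46 h
    rw [hfr1 arrN (by decide), hE.size] at hi
    have hfr2 : ∀ b, b ∉ [46, arrT, arrFound, arrW] → b ∉ switch.writes → b ∉ [41, arrW] →
        s2 b = s b := by
      intro b h1 h2 h3
      rw [hfr, hfr1 b h3]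
      simp only [List.mem_cons, not_or, List.not_mem_nil, not_false_iff, and_true] at h1
      simp [writes, h1, h2]
    rw [den]
    have hcard : ((Finset.range (i + 1)).filter fun a => s arrA a ≠ 0).card =
        ((Finset.range i).filter fun a => s arrA a ≠ 0).card + if s arrA i ≠ 0 then 1 else 0 := by
      rw [Finset.range_add_one, Finset.filter_insert]
      split_ifs <;> simp
    have eA : s2 arrA = s arrA := hfr2 _ (by decide) (by decide) (by decide)
    have eD : s2 arrD = s arrD := hfr2 _ (by decide) (by decide) (by decide)
    have eNb : s2 arrNb = s arrNb := hfr2 _ (by decide) (by decide) (by decide)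
    rw [hcard]
    split_ifs with hc hAi hAi
    · simp only [eval_and_ne_zero, eval_not_ne_zero, eval_get, eval_const, h46, eA] at hc
      rcases h with h | ⟨-, hW, hm, hAm, hDm⟩
      · exact absurd hc.1 h.1
      obtain ⟨hb1, hb2, hb3⟩ := (hA i hi).2 hAi
      have hDi : s arrD i = 0 := ((hA i hi).1.1 hAi).1
      rw [den_seq, den_seq]
      generalize hs3 : den (set arrT (get arrNb (var 46))) s2 = s3
      have hfr3 : ∀ b, b ≠ arrT → s3 b = s2 b := by
        intro b hb
        rw [← hs3]
        exact Memory.store_ne _ _ _ hb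
      have hT3 : s3 arrT 0 = s arrNb i := by
        rw [← hs3]
        simp [den, eval, Memory.store_same, h46, eNb]
      have hfr3' : ∀ b ∈ [arrN, arrMul, arrAdj, arrD, arrTab, arrC], s3 b = s b := by
        intro b hb
        rw [hfr3 b (by revert b; decide), hfr2 b (by revert b; decide) (by revert b; decide)
          (by revert b; decide)]
      have hsw := switch_spec (s := s3) (hE.congr (hfr3' _ (by decide)) (hfr3' _ (by decide))
        (hfr3' _ (by decide))) (hT.congr (hfr3' _ (by decide)) (hfr3' _ (by decide))
        (hfr3' _ (by decide))) (by rw [hfr3 _ (by decide)]; exact hc.1)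
        (by rw [hfr3 _ (by decide)]; exact hW) (by rw [hT3]; exact hb1)
        (by rw [hT3, hfr3' _ (by decide)]; exact hb2)
      rw [hT3, hfr3 arrW (by decide), hfr3' arrD (by decide)] at hsw
      have hT4 : switch.den s3 arrT = s3 arrT := den_frame _ (by decide) _
      have h464 : switch.den s3 46 = s3 46 := den_frame _ (by decide) _
      generalize switch.den s3 = s4 at *
      rw [den]
      rcases hsw with ⟨hf4, hP⟩ | ⟨hf4, hW4, z, hz, hDz, hWz, -, hmiss4⟩
      · left
        rw [if_neg (by rw [eval_not_ne_zero]; exact hf4), den]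
        rw [Memory.store_ne _ _ _ (by decide)]
        exact ⟨hf4, hP.congr (Memory.store_ne _ _ _ (by decide))
          (Memory.store_ne _ _ _ (by decide)) (Memory.store_ne _ _ _ (by decide))⟩
      · right
        rw [if_pos (by rw [eval_not_ne_zero]; exact hf4)]
        rw [Memory.store_ne _ _ _ (by decide), Memory.store_ne _ _ _ (by decide)]
        generalize hd : s arrNb i = d at *
        have hid : i ≠ d := by
          rintro rfl
          exact hb2 hDi
        have hW5 : ∀ x, (den (put arrW (var 46) (var arrT) ;; put arrW (var arrT) (var 46)) s4)
            arrW x = addEdge (s4 arrW) i d x := by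
          intro x
          simp only [den, eval, Memory.store_same, Memory.store_ne, ne_eq, Nat.reduceEqDiff,
            not_false_iff, hT4, h464, hT3, hfr3 46 (by decide), h46, addEdge]
        have hf5 : (den (put arrW (var 46) (var arrT) ;; put arrW (var arrT) (var 46)) s4)
            arrFound = s4 arrFound := den_frame _ (by decide) _
        rw [hf5, miss_congr (fun x _ => hW5 x)]
        have hkeep : ∀ x < N, s arrD x = 0 → s2 arrW x = x → s4 arrW x = x := by
          intro x hx h1 h2
          refine (hmiss4 x hx).2 (Or.inr ⟨h2, ?_⟩)
          rintro rfl
          exact hDz h1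
        have hi4 : s4 arrW i = i := hkeep i hi hDi (hAm i hi le_rfl hAi)
        have hd4 : s4 arrW d = d := (hmiss4 d hb1).2 (Or.inl rfl)
        refine ⟨hf4, (hW4.addEdge hi hb1 hi4 hd4 hb3 (hG i hi d hb1 hb3)).congr
          (fun x _ => hW5 x), ?_, ?_, ?_⟩
        · have e1 := miss_addEdge hi hb1 hi4 hd4 hid
          have e2 : miss N (s4 arrW) ≤ miss N (s2 arrW) := miss_le_of_exchange hz hWz hmiss4
          omega
        · intro a ha hia hAa
          rw [hW5, addEdge_eq_self_iff hid]
          have hDa : s arrD a = 0 := ((hA a ha).1.1 hAa).1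
          refine ⟨hkeep a ha hDa (hAm a ha (by omega) hAa), by omega, ?_⟩
          rintro rfl
          exact hb2 hDa
        · intro x hx h1 h2 h3
          rw [hW5, addEdge_eq_self_iff hid]
          refine ⟨hkeep x hx h2 (hDm x hx h1 h2 h3), ?_, ?_⟩
          · rintro rfl
            exact hAi h1
          · rintro rfl
            exact hb2 h2
    · simp only [eval_and_ne_zero, eval_not_ne_zero, eval_get, eval_const, h46, eA] at hc
      exact absurd hc.2 hAi
    · simp only [eval_and_ne_zero, eval_not_ne_zero, eval_get, eval_const, h46, eA] at hc
      rw [den]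
      rcases h with ⟨h1, h2⟩ | h
      · left
        rw [Memory.store_ne _ _ _ (by decide)]
        exact ⟨h1, h2.congr (Memory.store_ne _ _ _ (by decide))
          (Memory.store_ne _ _ _ (by decide)) (Memory.store_ne _ _ _ (by decide))⟩
      · exact absurd ⟨h.1, hAi⟩ hc
    · rw [den]
      rcases h with ⟨h1, h2⟩ | ⟨h1, h2, h3, h4, h5⟩
      · left
        rw [Memory.store_ne _ _ _ (by decide)]
        exact ⟨h1, h2.congr (Memory.store_ne _ _ _ (by decide))
          (Memory.store_ne _ _ _ (by decide)) (Memory.store_ne _ _ _ (by decide))⟩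
      · right
        rw [Memory.store_ne _ _ _ (by decide), Memory.store_ne _ _ _ (by decide)]
        exact ⟨h1, h2, h3, fun a ha hia => h4 a ha (by omega), h5⟩

/-! ### One attempt: progress or certificate -/

/-- Try to make progress. -/
def attempt : Cmd :=
  findBarrier ;; removeBarrier ;; set arrAug (.const 0) ;; floodAll ;;
  when (not (var arrFound)) (restoreBarrier ;;
    when (not (var arrFound))
      (rep 41 arrN (put arrL (var 41) (get arrW (var 41))) ;; report))

/-- If the search has improved `arrH`, rematching `A` ends below `c` missed vertices, which the
report notices. Without progress, the restored matching misses at least `c` vertices, so `arrH`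
misses at least `c + 2 * |A|`; all of them are in `A` or `D` since the restored matching misses only
vertices of `D`. With the result of the searches, these are the hypotheses of `optimal_of_barrier`.
-/
theorem attempt_spec {N : ℕ} {G : ℕ → ℕ → Prop} {s : Memory} (hE : Env N G s)
    (hT : TabInv N G s) (hG : ∀ x < N, ∀ y < N, G x y → G y x) (hf : s arrFound 0 = 0)
    (hM : Mate N G (s arrM)) (hm : miss N (s arrM) ≤ s arrC 0) :
    (attempt.den s arrFound 0 ≠ 0 ∧ Progress N G (attempt.den s)) ∨
      (attempt.den s arrFound 0 = 0 ∧ ∀ f, Mate N G f → s arrC 0 ≤ miss N f) := by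
  rw [attempt, den_seq, den_seq, den_seq, den_seq]
  have hb := findBarrier_spec hE
  have hfr1 : ∀ b, b ∉ findBarrier.writes → findBarrier.den s b = s b :=
    fun b hb => den_frame _ hb _
  generalize findBarrier.den s = s1 at *
  have hrm := removeBarrier_spec (N := N) (s := s1) (by rw [hfr1 _ (by decide)]; exact hE.size)
  rw [hfr1 arrM (by decide)] at hrm
  have hfr2 : ∀ b, b ∉ [41, arrH] → removeBarrier.den s1 b = s1 b :=
    fun b hb => den_frame _ (by
      simp only [List.mem_cons, not_or, List.not_mem_nil, not_false_iff, and_true] at hb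
      simp [removeBarrier, writes, hb]) _
  generalize removeBarrier.den s1 = s2 at *
  generalize hs3 : den (set arrAug (.const 0)) s2 = s3
  have hfr3 : ∀ b, b ≠ arrAug → s3 b = s2 b := by
    intro b hb
    rw [← hs3]
    exact Memory.store_ne _ _ _ hb
  have haug : s3 arrAug 0 = 0 := by
    rw [← hs3]
    simp [den, eval, Memory.store_same]
  have hfr : ∀ b, b ∉ [41, arrH, arrAug] → b ∉ findBarrier.writes → s3 b = s b := by
    intro b h1 h2
    simp only [List.mem_cons, not_or, List.not_mem_nil, not_false_iff, and_true] at h1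
    rw [hfr3 b h1.2.2, hfr2 b (by simp [h1]), hfr1 b h2]
  have hA3 : s3 arrA = s1 arrA := by rw [hfr3 _ (by decide), hfr2 _ (by decide)]
  have hNb3 : s3 arrNb = s1 arrNb := by rw [hfr3 _ (by decide), hfr2 _ (by decide)]
  have hD3 : s3 arrD = s arrD := hfr _ (by decide) (by decide)
  have hC3 : s3 arrC = s arrC := hfr _ (by decide) (by decide)
  rw [← hfr3 arrH (by decide), ← hA3] at hrm
  rw [← hA3, ← hNb3, ← hD3] at hb
  have hE3 : Env N G s3 := hE.congr (hfr _ (by decide) (by decide)) (hfr _ (by decide) (by decide))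
    (hfr _ (by decide) (by decide))
  have hT3 : TabInv N G s3 := hT.congr hD3 (hfr _ (by decide) (by decide)) hC3
  have hH3 : Mate N G (s3 arrH) := (hM.isolate _).congr hrm
  have hHA3 : ∀ a < N, s3 arrA a ≠ 0 → s3 arrH a = a := by
    intro a ha h
    rw [hrm a ha, isolate, if_pos (Or.inl h)]
  have hmiss3 : miss N (s3 arrH) ≤ s3 arrC 0 + 2 *
      ((Finset.range N).filter fun a => s3 arrA a ≠ 0).card := by
    rw [miss_congr hrm, hC3]
    have := miss_isolate_le (fun y => s3 arrA y ≠ 0) hM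
    omega
  have hS3 : SearchEnv N G (s3 arrH) s3 :=
    ⟨hE3, hT3, hG, fun a ha h => ((hb a ha).1.1 h).1, hH3, hHA3⟩
  have hf3 : s3 arrFound 0 = 0 := by rw [hfr _ (by decide) (by decide), hf]
  rw [← hC3]
  clear hs3 hfr hfr1 hfr2 hfr3 hE hT hM hm hf hD3 hrm hA3 hNb3 hC3
  have hfl := floodAll_spec hS3 hf3 haug rfl
  have hfr4 : ∀ b ∈ [arrN, arrMul, arrAdj, arrD, arrTab, arrC, arrA, arrNb],
      floodAll.den s3 b = s3 b := fun b hb => den_frame _ (by revert b; decide) _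
  generalize floodAll.den s3 = s4 at *
  have hS4 : SearchEnv N G (s3 arrH) s4 :=
    hS3.congr (fun b hb => hfr4 b (by revert b; decide))
  have hC4 : s4 arrC = s3 arrC := hfr4 _ (by decide)
  have hD4 : s4 arrD = s3 arrD := hfr4 _ (by decide)
  have hA4 : s4 arrA = s3 arrA := hfr4 _ (by decide)
  rw [← hfr4 arrNb (by decide), ← hA4, ← hD4] at hb
  rw [den]
  by_cases hf4 : s4 arrFound 0 = 0
  swap
  · rw [if_neg (by rw [eval_not_ne_zero]; exact hf4), den]
    rcases hfl with h | h | h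
    · exact Or.inl h
    · exact absurd h.1 hf4
    · exact absurd h.1 hf4
  rw [if_pos (by rw [eval_not_ne_zero]; exact hf4), den_seq]
  have hH4 : Mate N G (s4 arrH) ∧ (∀ a < N, s4 arrA a ≠ 0 → s4 arrH a = a) := by
    rcases hfl with h | h | h
    · exact absurd hf4 h.1
    · exact ⟨h.2.2.1, h.2.2.2.1⟩
    · rw [h.2.2.1, hA4]
      exact ⟨hH3, hHA3⟩
  have hle4 : miss N (s4 arrH) ≤ miss N (s3 arrH) := by
    rcases hfl with h | h | h
    · exact absurd hf4 h.1
    · exact h.2.2.2.2.le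
    · rw [h.2.2.1]
  have hre := restoreBarrier_spec hS4.env hS4.tab hG hb hf4 hH4.1 hH4.2 _ rfl
  have hfr5 : ∀ b ∈ [arrN, arrMul, arrAdj, arrD, arrTab, arrC, arrA],
      restoreBarrier.den s4 b = s4 b := fun b hb => den_frame _ (by revert b; decide) _
  generalize restoreBarrier.den s4 = s5 at *
  rw [den]
  rcases hre with ⟨hf5, hP5⟩ | ⟨hf5, hW5, hm5, hk5⟩
  · rw [if_neg (by rw [eval_not_ne_zero]; exact hf5), den]
    exact Or.inl ⟨hf5, hP5⟩
  rw [if_pos (by rw [eval_not_ne_zero]; exact hf5), den_seq]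
  have hN5 : s5 arrN 0 = N := by rw [hfr5 _ (by decide)]; exact hS4.env.size
  have hfill := (den_fill (x := 41) (a := arrN) (b := arrL) (idx := var 41)
      (val := get arrW (var 41)) (s := s5) 0 (s5 arrW) (by decide) (by
        intro i _ s' h4 h5 _
        simp [eval, h5, h4 arrW])).1
  simp only [Nat.zero_add, hN5] at hfill
  have hfr6 : ∀ b, b ∉ [41, arrL] →
      (rep 41 arrN (put arrL (var 41) (get arrW (var 41)))).den s5 b = s5 b :=
    fun b hb => den_frame _ (by simpa [writes] using hb) _
  generalize (rep 41 arrN (put arrL (var 41) (get arrW (var 41)))).den s5 = s6 at *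
  have hfr7 : ∀ b ∈ [arrN, arrMul, arrAdj, arrD, arrTab, arrC, arrA], s6 b = s4 b := by
    intro b hb
    rw [hfr6 b (by revert b; decide), hfr5 b hb]
  have hC6 : s6 arrC = s3 arrC := by rw [hfr7 _ (by decide), hC4]
  have hD6 : s6 arrD = s3 arrD := by rw [hfr7 _ (by decide), hD4]
  have hcard : ((Finset.range N).filter fun a => s4 arrA a ≠ 0).card =
      ((Finset.range N).filter fun a => s3 arrA a ≠ 0).card := by rw [hA4]
  have hrep := report_spec (s := s6) (hS4.env.congr (hfr7 _ (by decide)) (hfr7 _ (by decide))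
    (hfr7 _ (by decide))) (by rw [hfr6 _ (by decide), hf5]) (hW5.congr hfill) (by
      rw [miss_congr hfill, hC6]
      omega)
  rw [miss_congr hfill, hC6, hD6] at hrep
  rcases hrep with h | ⟨h1, h2, h3⟩
  · exact Or.inl h
  · right
    refine ⟨h1, fun f hf => ?_⟩
    rcases hfl with h | h | ⟨h4, h5, h6, h7⟩
    · exact absurd hf4 h.1
    · have := h.2.2.2.2
      omega
    · rw [hA4, hD4] at hb
      rw [hA4, hD4] at hk5
      rw [h6] at hm5 hk5
      refine optimal_of_barrier (D := fun x => s3 arrD x ≠ 0) (A := fun x => s3 arrA x ≠ 0) hG hH3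
        ?_ hHA3 (by omega) ?_ h7 hf
      · intro a ha
        have := (hb a ha).1
        simp only [not_not]
        exact this
      · intro x hx hHx
        by_contra hno
        simp only [not_or, not_not] at hno
        have := hk5 x hx hno.1 hno.2 hHx
        exact h3 x hx (by rw [hfill x hx, this]) hno.2

/-! ### Updating the table and the main loop -/

/-- Enter the matching `arrBest` into the table for all vertices it misses. -/
def enterBest : Cmd :=
  rep 41 arrN (when (eq (get arrBest (var 41)) (var 41)) (put arrD (var 41) (.const 1) ;;
    rep 42 arrN (put arrTab (add (get arrMul (var 41)) (var 42)) (get arrBest (var 42)))))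

theorem enterBest_spec {N : ℕ} {G : ℕ → ℕ → Prop} {s : Memory} (hE : Env N G s) :
    ∀ v < N, enterBest.den s arrD v = (if s arrBest v = v then 1 else s arrD v) ∧
      ∀ x < N, enterBest.den s arrTab (v * N + x) =
        if s arrBest v = v then s arrBest x else s arrTab (v * N + x) := by
  have hmain := den_rep (x := 41) (a := arrN) (s := s)
    (c := when (eq (get arrBest (var 41)) (var 41)) (put arrD (var 41) (.const 1) ;;
      rep 42 arrN (put arrTab (add (get arrMul (var 41)) (var 42)) (get arrBest (var 42)))))
    (fun n s' => ∀ v < N,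
      s' arrD v = (if v < n ∧ s arrBest v = v then 1 else s arrD v) ∧
      ∀ x < N, s' arrTab (v * N + x) =
        if v < n ∧ s arrBest v = v then s arrBest x else s arrTab (v * N + x)) ?_ ?_
  · rw [hE.size] at hmain
    intro v hv
    have := hmain v hv
    simp only [hv, true_and] at this
    exact this
  · intro v _
    rw [Memory.store_ne _ _ _ (by decide), Memory.store_ne _ _ _ (by decide)]
    simp
  · intro i hi s1 hfr h41 h
    rw [hE.size] at hi
    have eB : s1 arrBest = s arrBest := hfr _ (by decide)
    rw [Memory.store_ne _ _ _ (by decide), Memory.store_ne _ _ _ (by decide), den]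
    split_ifs with hc
    · simp only [eval_eq_ne_zero, eval_get, eval_const, h41, eB] at hc
      rw [den_seq]
      generalize hs2 : den (put arrD (var 41) (.const 1)) s1 = s2
      have hfr2 : ∀ b, b ≠ arrD → s2 b = s1 b := by
        intro b hb
        rw [← hs2]
        exact Memory.store_ne _ _ _ hb
      have hD2 : ∀ x, s2 arrD x = if x = i then 1 else s1 arrD x := by
        intro x
        rw [← hs2]
        simp [den, eval, Memory.store_same, h41]
      have eN2 : s2 arrN = s arrN := by rw [hfr2 _ (by decide), hfr _ (by decide)]
      obtain ⟨hfill, hout⟩ := den_fill (x := 42) (a := arrN) (b := arrTab)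
        (idx := add (get arrMul (var 41)) (var 42)) (val := get arrBest (var 42)) (s := s2) (i * N)
        (s arrBest) (by decide) (by
          intro i _ s' h4 h5 _
          simp [eval, h5, h4 arrBest, h4 arrMul, h4 41, h41, hfr2, ← hE.mul _ hi, hfr arrMul (by decide), eB])
      rw [eN2, hE.size] at hfill hout
      have hD3 : (rep 42 arrN (put arrTab (add (get arrMul (var 41)) (var 42))
        (get arrBest (var 42)))).den s2 arrD = s2 arrD := den_frame _ (by decide) _
      generalize (rep 42 arrN (put arrTab (add (get arrMul (var 41)) (var 42))
        (get arrBest (var 42)))).den s2 = s3 at *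
      intro v hv
      rw [hD3, hD2]
      by_cases hvi : v = i
      · subst hvi
        simp only [Nat.lt_succ_self, hc, and_self, if_true, true_and]
        intro x hx
        rw [hfill x hx]
      · have : v < i + 1 ↔ v < i := by omega
        simp only [this, hvi, if_false]
        refine ⟨(h v hv).1, fun x hx => ?_⟩
        rw [← (h v hv).2 x hx, hout, hfr2 _ (by decide)]
        rcases lt_or_gt_of_ne hvi with h | h
        · left
          calc v * N + x < v * N + N := by omega
            _ = (v + 1) * N := by ring
            _ ≤ i * N := Nat.mul_le_mul_right _ h
        · right
          calc i * N + N = (i + 1) * N := by ring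
            _ ≤ v * N := Nat.mul_le_mul_right _ h
            _ ≤ v * N + x := by omega
    · simp only [eval_eq_ne_zero, eval_get, eval_const, h41, eB] at hc
      rw [den]
      intro v hv
      have : (v < i + 1 ∧ s arrBest v = v) ↔ (v < i ∧ s arrBest v = v) := by
        constructor
        · rintro ⟨h1, h2⟩
          rcases Nat.lt_succ_iff_lt_or_eq.1 h1 with h | rfl
          · exact ⟨h, h2⟩
          · exact absurd h2 hc
        · rintro ⟨h1, h2⟩
          exact ⟨by omega, h2⟩
      simp only [this]
      exact h v hv

/-- Use the progress that has been made. -/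
def update : Cmd :=
  when (var arrFound) (
    rep 41 arrN (put arrL (var 41) (get arrBest (var 41))) ;; countMissed ;;
    when (sub (var arrC) (var arrCnt)) (rep 41 arrN (put arrD (var 41) (.const 0))) ;;
    set arrC (var arrCnt) ;;
    rep 41 arrN (put arrM (var 41) (get arrBest (var 41))) ;;
    enterBest ;; set arrFound (.const 0))

/-- The invariant of the main loop. -/
structure MainInv (N : ℕ) (G : ℕ → ℕ → Prop) (s : Memory) : Prop where
  env : Env N G s
  tab : TabInv N G s
  found : s arrFound 0 = 0
  mate : Mate N G (s arrM)
  miss : miss N (s arrM) ≤ s arrC 0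

/-- The potential that decreases in every iteration. -/
def potential (N : ℕ) (s : Memory) : ℕ :=
  s arrC 0 * (N + 1) + ((Finset.range N).filter fun x => s arrD x = 0).card

theorem miss_le (N : ℕ) (f : ℕ → ℕ) : miss N f ≤ N := by
  have := Finset.card_le_card (Finset.filter_subset (fun x => f x = x) (Finset.range N))
  rwa [Finset.card_range] at this

/-- A strictly better matching makes the stored bound `c` too weak for the old table, so `D` is
emptied first. Otherwise the table remains valid and `D` gains the new missed vertex. -/
theorem update_spec {N : ℕ} {G : ℕ → ℕ → Prop} {s : Memory} (hE : Env N G s) (hT : TabInv N G s)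
    (hf : s arrFound 0 ≠ 0) (hP : Progress N G s) :
    MainInv N G (update.den s) ∧ update.den s arrC 0 ≤ s arrC 0 ∧ update.den s arrC 0 ≤ N ∧
      potential N (update.den s) < potential N s := by
  obtain ⟨hP1, hP2, hP3⟩ := hP
  rw [update, den, if_pos (show (var arrFound).eval s ≠ 0 from hf), den_seq, den_seq, den_seq, den_seq, den_seq, den_seq]
  have hfill := (den_fill (x := 41) (a := arrN) (b := arrL) (idx := var 41)
      (val := get arrBest (var 41)) (s := s) 0 (s arrBest) (by decide) (by
        intro i _ s' h4 h5 _
        simp [eval, h5, h4 arrBest])).1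
  simp only [Nat.zero_add, hE.size] at hfill
  have hfr1 : ∀ b, b ∉ [41, arrL] →
      (rep 41 arrN (put arrL (var 41) (get arrBest (var 41)))).den s b = s b :=
    fun b hb => den_frame _ (by simpa [writes] using hb) _
  generalize (rep 41 arrN (put arrL (var 41) (get arrBest (var 41)))).den s = s1 at *
  have hcnt := (countMissed_spec (N := N) (s := s1) (by rw [hfr1 _ (by decide)]; exact hE.size)).1
  rw [miss_congr hfill] at hcnt
  have hfr2 : ∀ b, b ∉ [41, arrL] → b ∉ countMissed.writes → countMissed.den s1 b = s b := by
    intro b h1 h2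
    rw [den_frame _ h2, hfr1 b h1]
  generalize countMissed.den s1 = s2 at *
  generalize hs3 : den (when (sub (var arrC) (var arrCnt))
    (rep 41 arrN (put arrD (var 41) (.const 0)))) s2 = s3
  have hfr3 : ∀ b, b ∉ [41, arrD] → s3 b = s2 b := by
    intro b hb
    rw [← hs3]
    refine den_frame _ ?_ _
    simp only [List.mem_cons, not_or, List.not_mem_nil, not_false_iff, and_true] at hb
    simp [writes, hb]
  have hD3 : ∀ x < N, s3 arrD x = if miss N (s arrBest) < s arrC 0 then 0 else s arrD x := by
    intro x hx
    rw [← hs3, den]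
    have e : (sub (var arrC) (var arrCnt)).eval s2 ≠ 0 ↔ miss N (s arrBest) < s arrC 0 := by
      simp only [eval, hcnt, hfr2 arrC (by decide) (by decide)]
      omega
    by_cases hc : miss N (s arrBest) < s arrC 0
    · rw [if_pos (e.2 hc), if_pos hc]
      have := (den_fill (x := 41) (a := arrN) (b := arrD) (idx := var 41)
        (val := .const 0) (s := s2) 0 (fun _ => 0) (by decide) (by
          intro i _ s' h4 h5 _
          simp [eval, h5])).1
      simp only [Nat.zero_add, hfr2 arrN (by decide) (by decide), hE.size] at this
      exact this x hx
    · rw [if_neg (e.not.2 hc), if_neg hc, den, hfr2 arrD (by decide) (by decide)]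
  generalize hs4 : den (set arrC (var arrCnt)) s3 = s4
  have hfr4 : ∀ b, b ≠ arrC → s4 b = s3 b := by
    intro b hb
    rw [← hs4]
    exact Memory.store_ne _ _ _ hb
  have hC4 : s4 arrC 0 = miss N (s arrBest) := by
    rw [← hs4]
    simp only [den, eval, Memory.store_same, if_true, hfr3 arrCnt (by decide), hcnt]
  have hfr4' : ∀ b, b ∉ [41, arrL, arrD, arrC] → b ∉ countMissed.writes → s4 b = s b := by
    intro b h1 h2
    simp only [List.mem_cons, not_or, List.not_mem_nil, not_false_iff, and_true] at h1
    rw [hfr4 b h1.2.2.2, hfr3 b (by simp [h1]), hfr2 b (by simp [h1]) h2]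
  have hfill5 := (den_fill (x := 41) (a := arrN) (b := arrM) (idx := var 41)
      (val := get arrBest (var 41)) (s := s4) 0 (s arrBest) (by decide) (by
        intro i _ s' h4 h5 _
        simp [eval, h5, h4 arrBest, hfr4' arrBest (by decide) (by decide)])).1
  simp only [Nat.zero_add, hfr4' arrN (by decide) (by decide), hE.size] at hfill5
  have hfr5 : ∀ b, b ∉ [41, arrM] →
      (rep 41 arrN (put arrM (var 41) (get arrBest (var 41)))).den s4 b = s4 b :=
    fun b hb => den_frame _ (by simpa [writes] using hb) _
  generalize (rep 41 arrN (put arrM (var 41) (get arrBest (var 41)))).den s4 = s5 at *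
  have hfr5' : ∀ b ∈ [arrN, arrMul, arrAdj, arrBest, arrTab], s5 b = s b := by
    intro b hb
    rw [hfr5 b (by revert b; decide), hfr4' b (by revert b; decide) (by revert b; decide)]
  have hE5 : Env N G s5 := hE.congr (hfr5' _ (by decide)) (hfr5' _ (by decide))
    (hfr5' _ (by decide))
  have hen := enterBest_spec hE5
  rw [hfr5' arrBest (by decide), hfr5' arrTab (by decide)] at hen
  have hfr6 : ∀ b, b ∉ enterBest.writes → enterBest.den s5 b = s5 b :=
    fun b hb => den_frame _ hb _
  generalize enterBest.den s5 = s6 at *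
  generalize hs7 : den (set arrFound (.const 0)) s6 = s7
  have hfr7 : ∀ b, b ≠ arrFound → s7 b = s6 b := by
    intro b hb
    rw [← hs7]
    exact Memory.store_ne _ _ _ hb
  have hf7 : s7 arrFound 0 = 0 := by
    rw [← hs7]
    simp [den, eval, Memory.store_same]
  have hC7 : s7 arrC 0 = miss N (s arrBest) := by
    rw [hfr7 _ (by decide), hfr6 _ (by decide), hfr5 _ (by decide), hC4]
  have hM7 : ∀ x < N, s7 arrM x = s arrBest x := by
    intro x hx
    rw [hfr7 _ (by decide), hfr6 _ (by decide), hfill5 x hx]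
  have hD7 : ∀ x < N, s7 arrD x = if s arrBest x = x then 1 else
      if miss N (s arrBest) < s arrC 0 then 0 else s arrD x := by
    intro x hx
    rw [hfr7 _ (by decide), (hen x hx).1, hfr5 _ (by decide), hfr4 _ (by decide), hD3 x hx]
  have hT7 : ∀ v < N, ∀ x < N, s7 arrTab (v * N + x) =
        if s arrBest v = v then s arrBest x else s arrTab (v * N + x) := by
    intro v hv x hx
    rw [hfr7 _ (by decide), (hen v hv).2 x hx]
  have hfr8 : ∀ b ∈ [arrN, arrMul, arrAdj], s7 b = s b := by
    intro b hb
    rw [hfr7 b (by revert b; decide), hfr6 b (by revert b; decide), hfr5' b (by revert b; decide)]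
  clear hs3 hs4 hs7 hfr1 hfr2 hfr3 hfr4 hfr4' hfr5 hfr5' hfr6 hfr7 hen
  refine ⟨⟨?_, ?_, hf7, hP1.congr hM7, ?_⟩, ?_, ?_, ?_⟩
  · exact hE.congr (hfr8 _ (by decide)) (hfr8 _ (by decide)) (hfr8 _ (by decide))
  · intro v hv hDv
    rw [hC7]
    by_cases hbv : s arrBest v = v
    · have hrow : ∀ x < N, s7 arrTab (v * N + x) = s arrBest x := by
        intro x hx
        rw [hT7 v hv x hx, if_pos hbv]
      exact ⟨hP1.congr hrow, by rw [hrow v hv, hbv], by rw [miss_congr hrow]⟩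
    · have hrow : ∀ x < N, s7 arrTab (v * N + x) = s arrTab (v * N + x) := by
        intro x hx
        rw [hT7 v hv x hx, if_neg hbv]
      rw [hD7 v hv, if_neg hbv] at hDv
      split_ifs at hDv with hlt
      · exact absurd rfl hDv
      · obtain ⟨h1, h2, h3⟩ := hT v hv hDv
        exact ⟨h1.congr hrow, by rw [hrow v hv, h2],
          by rw [miss_congr (f := fun x => s arrTab (v * N + x)) hrow]; omega⟩
  · rw [hC7, miss_congr hM7]
  · rw [hC7]
    exact hP2
  · rw [hC7]
    exact miss_le _ _
  -- The factor `N + 1` makes a decrease of `c` outweigh the at most `N` vertices that leave `D`.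
  · unfold potential
    rw [hC7]
    by_cases hlt : miss N (s arrBest) < s arrC 0
    · have h1 := Finset.card_le_card (Finset.filter_subset (fun x => s7 arrD x = 0)
        (Finset.range N))
      rw [Finset.card_range] at h1
      have h2 : (miss N (s arrBest) + 1) * (N + 1) ≤ s arrC 0 * (N + 1) :=
        Nat.mul_le_mul_right _ hlt
      rw [Nat.succ_mul] at h2
      omega
    · have he : miss N (s arrBest) = s arrC 0 := by omega
      rw [he]
      apply Nat.add_lt_add_left
      apply Finset.card_lt_card
      rw [Finset.ssubset_iff_of_subset]
      · obtain ⟨x, hx, h1, h2⟩ := hP3.resolve_left hlt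
        refine ⟨x, by simp [hx, h2], ?_⟩
        simp only [Finset.mem_filter, hD7 x hx, h1, if_true, one_ne_zero, and_false,
          not_false_iff]
      · intro x
        simp only [Finset.mem_filter, Finset.mem_range]
        rintro ⟨h1, h2⟩
        rw [hD7 x h1, if_neg hlt] at h2
        split_ifs at h2
        exact ⟨h1, h2⟩

/-- One iteration of the main loop. -/
def iteration : Cmd := attempt ;; update

theorem iteration_spec {N : ℕ} {G : ℕ → ℕ → Prop} {s : Memory}
    (hG : ∀ x < N, ∀ y < N, G x y → G y x) (h : MainInv N G s) :
    MainInv N G (iteration.den s) ∧ iteration.den s arrC 0 ≤ s arrC 0 ∧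
      (potential N (iteration.den s) < potential N s ∨
        ∀ f, Mate N G f → iteration.den s arrC 0 ≤ miss N f) := by
  rw [iteration, den_seq]
  have hat := attempt_spec h.env h.tab hG h.found h.mate h.miss
  have hfr : ∀ b ∈ [arrN, arrMul, arrAdj, arrD, arrTab, arrC, arrM],
      attempt.den s b = s b := fun b hb => den_frame _ (by revert b; decide) _
  generalize attempt.den s = s1 at *
  have hE1 : Env N G s1 := h.env.congr (hfr _ (by decide)) (hfr _ (by decide)) (hfr _ (by decide))
  have hT1 : TabInv N G s1 :=
    h.tab.congr (hfr _ (by decide)) (hfr _ (by decide)) (hfr _ (by decide))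
  have hC1 : s1 arrC = s arrC := hfr _ (by decide)
  have hM1 : s1 arrM = s arrM := hfr _ (by decide)
  rcases hat with ⟨h1, h2⟩ | ⟨h1, h2⟩
  · obtain ⟨h3, h4, -, h5⟩ := update_spec hE1 hT1 h1 h2
    rw [hC1] at h4
    refine ⟨h3, h4, Or.inl ?_⟩
    have : potential N s1 = potential N s := by
      unfold potential
      rw [hC1, hfr arrD (by decide)]
    rwa [this] at h5
  · have hu : update.den s1 = s1 := by
      rw [update, den, if_neg (by simp [eval, h1]), den]
    rw [hu, hC1]
    exact ⟨⟨hE1, hT1, h1, by rw [hM1]; exact h.mate, by rw [hM1, hC1]; exact h.miss⟩, le_rfl,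
      Or.inr h2⟩

/-- Compute a maximum matching of the stored graph. -/
def maxMatching : Cmd :=
  set arrC (add (var arrN) (.const 1)) ;; rep 41 arrN (put arrBest (var 41) (var 41)) ;;
  set arrFound (.const 1) ;; update ;; rep 50 arrB (rep 51 arrB iteration)

/-- Starting with `c = N + 1` and an empty table makes the empty matching count as progress, so that
`update` also does the initialisation. -/
theorem maxMatching_spec {N : ℕ} {G : ℕ → ℕ → Prop} {s : Memory} (hE : Env N G s)
    (hG : ∀ x < N, ∀ y < N, G x y → G y x) (hB : s arrB 0 = N + 1) (hD : ∀ x < N, s arrD x = 0) :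
    Mate N G (maxMatching.den s arrM) ∧
      ∀ f, Mate N G f → miss N (maxMatching.den s arrM) ≤ miss N f := by
  rw [maxMatching, den_seq, den_seq, den_seq, den_seq]
  generalize hs1 : den (set arrC (add (var arrN) (.const 1))) s = s1
  have hfr1 : ∀ b, b ≠ arrC → s1 b = s b := by
    intro b hb
    rw [← hs1]
    exact Memory.store_ne _ _ _ hb
  have hC1 : s1 arrC 0 = N + 1 := by
    rw [← hs1]
    simp only [den, eval, Memory.store_same, if_true, hE.size]
  have hfill := (den_fill (x := 41) (a := arrN) (b := arrBest) (idx := var 41)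
      (val := var 41) (s := s1) 0 id (by decide) (by
        intro i _ s' h4 h5 _
        simp [eval, h5])).1
  simp only [Nat.zero_add, hfr1 arrN (by decide), hE.size] at hfill
  have hfr2 : ∀ b, b ∉ [41, arrBest] →
      (rep 41 arrN (put arrBest (var 41) (var 41))).den s1 b = s1 b :=
    fun b hb => den_frame _ (by simpa [writes] using hb) _
  generalize (rep 41 arrN (put arrBest (var 41) (var 41))).den s1 = s2 at *
  generalize hs3 : den (set arrFound (.const 1)) s2 = s3
  have hfr3 : ∀ b, b ≠ arrFound → s3 b = s2 b := by
    intro b hb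
    rw [← hs3]
    exact Memory.store_ne _ _ _ hb
  have hf3 : s3 arrFound 0 ≠ 0 := by
    rw [← hs3]
    simp [den, eval, Memory.store_same]
  have hfr : ∀ b, b ∉ [41, arrBest, arrC, arrFound] → s3 b = s b := by
    intro b hb
    simp only [List.mem_cons, not_or, List.not_mem_nil, not_false_iff, and_true] at hb
    rw [hfr3 b hb.2.2.2, hfr2 b (by simp [hb]), hfr1 b hb.2.2.1]
  have hE3 : Env N G s3 := hE.congr (hfr _ (by decide)) (hfr _ (by decide)) (hfr _ (by decide))
  have hT3 : TabInv N G s3 := by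
    intro v hv h
    rw [hfr _ (by decide)] at h
    exact absurd (hD v hv) h
  have hC3 : s3 arrC 0 = N + 1 := by rw [hfr3 _ (by decide), hfr2 _ (by decide), hC1]
  have hB3 : ∀ x < N, s3 arrBest x = id x := by
    intro x hx
    rw [hfr3 _ (by decide), hfill x hx]
  have hid : Mate N G id := fun x hx => ⟨hx, rfl, fun h => absurd rfl h⟩
  obtain ⟨hI, -, hCN, -⟩ := update_spec hE3 hT3 hf3 ⟨hid.congr hB3, by
      rw [hC3]
      exact (miss_le _ _).trans (Nat.le_succ _), Or.inl (by
      rw [hC3]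
      exact Nat.lt_succ_of_le (miss_le _ _))⟩
  have hB4 : update.den s3 arrB 0 = N + 1 := by
    rw [den_frame _ (by decide), hfr _ (by decide), hB]
  generalize update.den s3 = s4 at *
  have hpot : potential N s4 ≤ N * (N + 1) + N := by
    unfold potential
    have h1 := Finset.card_le_card (Finset.filter_subset (fun x => s4 arrD x = 0)
        (Finset.range N))
    rw [Finset.card_range] at h1
    have h2 := Nat.mul_le_mul_right (N + 1) hCN
    omega
  set Inv : ℕ → Memory → Prop := fun k s' => MainInv N G s' ∧
    (potential N s' + k ≤ N * (N + 1) + N ∨ ∀ f, Mate N G f → s' arrC 0 ≤ miss N f) with hInv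
  have hstore : ∀ k s' x v, x ∉ [arrN, arrMul, arrAdj, arrD, arrTab, arrC, arrM, arrFound] →
      Inv k s' → Inv k (s'.store x 0 v) := by
    intro k s' x v hx h
    have e : ∀ b ∈ [arrN, arrMul, arrAdj, arrD, arrTab, arrC, arrM, arrFound],
        s'.store x 0 v b = s' b := by
      intro b hb
      refine Memory.store_ne _ _ _ ?_
      rintro rfl
      exact hx hb
    obtain ⟨⟨h1, h2, h3, h4, h5⟩, h6⟩ := h
    refine ⟨⟨h1.congr (e _ (by decide)) (e _ (by decide)) (e _ (by decide)),
      h2.congr (e _ (by decide)) (e _ (by decide)) (e _ (by decide)), ?_, ?_, ?_⟩, ?_⟩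
    · rw [e _ (by decide)]; exact h3
    · rw [e _ (by decide)]; exact h4
    · rw [e _ (by decide), e _ (by decide)]; exact h5
    · unfold potential at *
      rw [e _ (by decide), e _ (by decide)]; exact h6
  -- The `(N + 1) * (N + 1)` iterations exceed the initial potential, at most `N * (N + 1) + N`, so
  -- some iteration cannot lower it and certifies optimality.
  have hmain : Inv ((N + 1) * (N + 1)) ((rep 50 arrB (rep 51 arrB iteration)).den s4) := by
    have houter := den_rep (x := 50) (a := arrB) (s := s4) (c := rep 51 arrB iteration)
      (fun n s' => Inv (n * (N + 1)) s') ?_ ?_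
    · rw [hB4] at houter
      exact houter
    · refine hstore _ _ _ _ (by decide) ⟨hI, Or.inl ?_⟩
      omega
    · intro i _ s5 hfr5 _ h5
      refine hstore _ _ _ _ (by decide) ?_
      have hB5 : s5 arrB 0 = N + 1 := by rw [hfr5 _ (by decide), hB4]
      have hinner := den_rep (x := 51) (a := arrB) (s := s5) (c := iteration)
        (fun n s' => Inv (i * (N + 1) + n) s') ?_ ?_
      · rw [hB5] at hinner
        rw [Nat.succ_mul]
        exact hinner
      · exact hstore _ _ _ _ (by decide) h5
      · rintro j _ s6 _ _ ⟨h6, h7⟩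
        refine hstore _ _ _ _ (by decide) ?_
        obtain ⟨h8, h9, h10⟩ := iteration_spec hG h6
        refine ⟨h8, ?_⟩
        rcases h7 with h7 | h7
        · rcases h10 with h10 | h10
          · left; omega
          · exact Or.inr h10
        -- An optimal `c` stays optimal because `c` never increases.
        · exact Or.inr fun f hf => h9.trans (h7 f hf)
  obtain ⟨h1, h2⟩ := hmain
  refine ⟨h1.mate, fun f hf => h1.miss.trans ?_⟩
  rcases h2 with h2 | h2
  · exfalso
    have : (N + 1) * (N + 1) = N * (N + 1) + N + 1 := by ring
    omega
  · exact h2 f hf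

end RAM

/-! ### The graph of an instance

The jobs are the vertices below `n`, and machine `i` has the copies `n + q * m + i`. Job `j` is
adjacent to the copies of the machines on which it has the largest tolerance `K`. If no tolerance is
zero, the copies of a machine are adjacent to each other. -/

/-- The graph of an instance with tolerance `b (j * m + i)` of job `j` on machine `i`. -/
def copyGraph (n m : ℕ) (b : ℕ → ℕ) (K z : ℕ) (u v : ℕ) : Prop :=
  (u < n ∧ n ≤ v ∧ b (u * m + (v - n) % m) = K) ∨ (v < n ∧ n ≤ u ∧ b (v * m + (u - n) % m) = K) ∨
    (n ≤ u ∧ n ≤ v ∧ z = 0 ∧ (u - n) % m = (v - n) % m ∧ u ≠ v)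

theorem copyGraph_symm {n m : ℕ} {b : ℕ → ℕ} {K z u v : ℕ} (h : copyGraph n m b K z u v) :
    copyGraph n m b K z v u := by
  rcases h with h | h | ⟨h1, h2, h3, h4, h5⟩
  · exact Or.inr (Or.inl h)
  · exact Or.inl h
  · exact Or.inr (Or.inr ⟨h2, h1, h3, h4.symm, h5.symm⟩)

namespace RAM

open RAM.Expr RAM.Cmd

notation "arrIdx" => (34 : ℕ)
notation "arrK" => (35 : ℕ)
notation "arrZero" => (36 : ℕ)
notation "arrCap" => (37 : ℕ)
notation "arrAcc" => (38 : ℕ)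
notation "arrRow" => (39 : ℕ)
notation "arrMach" => (52 : ℕ)
notation "arrJob" => (53 : ℕ)
notation "arrUsed" => (54 : ℕ)

/-! ### Reading the tolerances -/

/-- Process one tolerance. -/
def scanCell : Cmd :=
  when (sub (get 2 (var arrIdx)) (var arrK)) (set arrK (get 2 (var arrIdx))) ;;
  when (not (get 2 (var arrIdx))) (set arrZero (.const 1)) ;;
  set arrIdx (add (var arrIdx) (.const 1))

/-- `arrK` is the maximum of the first `k` tolerances, and `arrZero` tells whether one of them is
zero. -/
def Scanned (b : ℕ → ℕ) (k : ℕ) (s : Memory) : Prop :=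
  s arrIdx 0 = k ∧ (∀ p < k, b p ≤ s arrK 0) ∧ (s arrK 0 = 0 ∨ ∃ p < k, b p = s arrK 0) ∧
    (s arrZero 0 ≠ 0 ↔ ∃ p < k, b p = 0)

theorem Scanned.congr {b : ℕ → ℕ} {k : ℕ} {s s' : Memory} (h : Scanned b k s)
    (h1 : s' arrIdx = s arrIdx) (h2 : s' arrK = s arrK) (h3 : s' arrZero = s arrZero) :
    Scanned b k s' := by
  unfold Scanned
  rw [h1, h2, h3]
  exact h

theorem scanCell_spec {b : ℕ → ℕ} {k : ℕ} {s : Memory} (hb : s 2 = b) (h : Scanned b k s) :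
    Scanned b (k + 1) (scanCell.den s) := by
  obtain ⟨h1, h2, h3, h4⟩ := h
  rw [scanCell, den_seq, den_seq]
  generalize hs1 : den (when (sub (get 2 (var arrIdx)) (var arrK))
    (set arrK (get 2 (var arrIdx)))) s = s1
  have hfr1 : ∀ c, c ≠ arrK → s1 c = s c := by
    intro c hc
    rw [← hs1]
    exact den_frame _ (by simp [writes, hc]) _
  have hK1 : s1 arrK 0 = max (s arrK 0) (b k) := by
    rw [← hs1, den]
    split_ifs with hc
    · simp only [eval, hb, h1] at hc
      simp only [den, eval, Memory.store_same, hb, h1, if_true]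
      omega
    · simp only [eval, hb, h1] at hc
      rw [den]
      omega
  generalize hs2 : den (when (not (get 2 (var arrIdx))) (set arrZero (.const 1))) s1 = s2
  have hfr2 : ∀ c, c ≠ arrZero → s2 c = s1 c := by
    intro c hc
    rw [← hs2]
    exact den_frame _ (by simp [writes, hc]) _
  have hz2 : s2 arrZero 0 ≠ 0 ↔ s arrZero 0 ≠ 0 ∨ b k = 0 := by
    rw [← hs2, den]
    split_ifs with hc
    · simp only [eval_not_ne_zero, eval_get, eval_const, hfr1 arrIdx (by decide),
        hfr1 2 (by decide), hb, h1] at hc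
      simp [den, eval, Memory.store_same, hc]
    · simp only [eval_not_ne_zero, eval_get, eval_const, hfr1 arrIdx (by decide),
        hfr1 2 (by decide), hb, h1] at hc
      rw [den, hfr1 arrZero (by decide)]
      simp [hc]
  unfold Scanned
  have hfr3 : ∀ c, c ≠ arrIdx → den (set arrIdx (add (var arrIdx) (.const 1))) s2 c = s2 c :=
    fun c hc => Memory.store_ne _ _ _ hc
  rw [hfr3 arrK (by decide), hfr3 arrZero (by decide), hfr2 arrK (by decide), hK1]
  refine ⟨?_, ?_, ?_, ?_⟩
  · simp [den, eval, Memory.store_same, hfr2, hfr1, h1]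
  · intro p hp
    rcases Nat.lt_succ_iff_lt_or_eq.1 hp with hp | rfl
    · exact (h2 p hp).trans (le_max_left _ _)
    · exact le_max_right _ _
  · rcases le_total (s arrK 0) (b k) with hle | hle
    · rw [max_eq_right hle]
      exact Or.inr ⟨k, by omega, rfl⟩
    · rw [max_eq_left hle]
      rcases h3 with h3 | ⟨p, hp, h3⟩
      · exact Or.inl h3
      · exact Or.inr ⟨p, by omega, h3⟩
  · rw [hz2, h4]
    constructor
    · rintro (⟨p, hp, h5⟩ | h5)
      · exact ⟨p, by omega, h5⟩
      · exact ⟨k, by omega, h5⟩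
    · rintro ⟨p, hp, h5⟩
      rcases Nat.lt_succ_iff_lt_or_eq.1 hp with hp | rfl
      · exact Or.inl ⟨p, hp, h5⟩
      · exact Or.inr h5

/-- Compute the largest tolerance, the number of copies of a machine and the number of vertices. -/
def prepare : Cmd :=
  rep 60 0 (rep 61 1 scanCell) ;;
  -- `K - (K - (n + 1))` is the minimum of `K` and `n + 1`. A machine never has more than `n` jobs,
  -- so `n` copies would do for them; the extra one provides two copies when `n = 1` and `K = 2`.
  set arrCap (sub (var arrK) (sub (var arrK) (add (var 0) (.const 1)))) ;;
  set arrN (var 0) ;; rep 61 1 (set arrN (add (var arrN) (var arrCap))) ;;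
  set arrB (add (var arrN) (.const 1))

theorem prepare_spec {s : Memory} {n m : ℕ} (hn : s 0 0 = n) (hm : s 1 0 = m)
    (h0 : Scanned (s 2) 0 s) (s' : Memory) (hs' : s' = prepare.den s) :
    Scanned (s 2) (n * m) s' ∧ s' arrCap 0 = min (s' arrK 0) (n + 1) ∧
      s' arrN 0 = n + s' arrCap 0 * m ∧ s' arrB 0 = s' arrN 0 + 1 := by
  rw [prepare, den_seq, den_seq, den_seq, den_seq] at hs'
  have hscan : Scanned (s 2) (n * m) ((rep 60 0 (rep 61 1 scanCell)).den s) := by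
    have houter := den_rep (x := 60) (a := 0) (s := s) (c := rep 61 1 scanCell)
      (fun i s' => Scanned (s 2) (i * m) s') ?_ ?_
    · rwa [hn] at houter
    · rw [Nat.zero_mul]
      exact h0.congr (Memory.store_ne _ _ _ (by decide)) (Memory.store_ne _ _ _ (by decide))
        (Memory.store_ne _ _ _ (by decide))
    · intro i _ s1 hfr1 _ h1
      have hm1 : s1 1 0 = m := by rw [hfr1 _ (by decide), hm]
      have hinner := den_rep (x := 61) (a := 1) (s := s1) (c := scanCell)
        (fun j s' => Scanned (s 2) (i * m + j) s') ?_ ?_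
      · rw [hm1, ← Nat.succ_mul] at hinner
        exact hinner.congr (Memory.store_ne _ _ _ (by decide)) (Memory.store_ne _ _ _ (by decide))
          (Memory.store_ne _ _ _ (by decide))
      · exact h1.congr (Memory.store_ne _ _ _ (by decide)) (Memory.store_ne _ _ _ (by decide))
          (Memory.store_ne _ _ _ (by decide))
      · intro j _ s2 hfr2 _ h2
        have := scanCell_spec (by rw [hfr2 _ (by decide), hfr1 _ (by decide)]) h2
        exact this.congr (Memory.store_ne _ _ _ (by decide)) (Memory.store_ne _ _ _ (by decide))
          (Memory.store_ne _ _ _ (by decide))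
  have hfr1 : ∀ b, b ∉ (rep 60 0 (rep 61 1 scanCell)).writes →
      (rep 60 0 (rep 61 1 scanCell)).den s b = s b := fun b hb => den_frame _ hb _
  generalize (rep 60 0 (rep 61 1 scanCell)).den s = s1 at *
  generalize hs2 : den (set arrCap _) s1 = s2 at hs'
  have hfr2 : ∀ b, b ≠ arrCap → s2 b = s1 b := by
    intro b hb
    rw [← hs2]
    exact Memory.store_ne _ _ _ hb
  have hcap : s2 arrCap 0 = min (s1 arrK 0) (n + 1) := by
    rw [← hs2]
    simp only [den, eval, Memory.store_same, if_true, hfr1 0 (by decide), hn]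
    omega
  generalize hs3 : den (set arrN (var 0)) s2 = s3 at hs'
  have hfr3 : ∀ b, b ≠ arrN → s3 b = s2 b := by
    intro b hb
    rw [← hs3]
    exact Memory.store_ne _ _ _ hb
  have hN3 : s3 arrN 0 = n := by
    rw [← hs3]
    simp only [den, eval, Memory.store_same, if_true, hfr2 0 (by decide), hfr1 0 (by decide), hn]
  have hN4 := den_rep (x := 61) (a := 1) (s := s3) (c := set arrN (add (var arrN) (var arrCap)))
    (fun i s' => s' arrN 0 = n + s2 arrCap 0 * i) ?_ ?_
  rotate_left
  · rw [Memory.store_ne _ _ _ (by decide), hN3, Nat.mul_zero, Nat.add_zero]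
  · intro i _ s4 hfr4 _ h4
    rw [Memory.store_ne _ _ _ (by decide)]
    simp only [den, eval, Memory.store_same, if_true, h4, hfr4 arrCap (by decide),
      hfr3 arrCap (by decide), Nat.mul_succ, Nat.add_assoc]
  rw [hfr3 1 (by decide), hfr2 1 (by decide), hfr1 1 (by decide), hm] at hN4
  have hfr4 : ∀ b, b ∉ [61, arrN] →
      (rep 61 1 (set arrN (add (var arrN) (var arrCap)))).den s3 b = s3 b :=
    fun b hb => den_frame _ (by simpa [writes] using hb) _
  generalize (rep 61 1 (set arrN (add (var arrN) (var arrCap)))).den s3 = s4 at *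
  have hfr5 : ∀ b, b ≠ arrB → s' b = s4 b := by
    intro b hb
    rw [hs']
    exact Memory.store_ne _ _ _ hb
  have hfr : ∀ b, b ∉ [61, arrN, arrB, arrCap] → s' b = s1 b := by
    intro b hb
    simp only [List.mem_cons, not_or, List.not_mem_nil, not_false_iff, and_true] at hb
    rw [hfr5 b hb.2.2.1, hfr4 b (by simp [hb]), hfr3 b hb.2.1, hfr2 b hb.2.2.2]
  have hcap' : s' arrCap = s2 arrCap := by
    rw [hfr5 _ (by decide), hfr4 _ (by decide), hfr3 _ (by decide)]
  refine ⟨hscan.congr (hfr _ (by decide)) (hfr _ (by decide)) (hfr _ (by decide)), ?_, ?_, ?_⟩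
  · rw [hcap', hcap, hfr arrK (by decide)]
  · rw [hfr5 arrN (by decide), hN4, hcap']
  · rw [hfr5 arrN (by decide), hs']
    simp only [den, eval, Memory.store_same, if_true]

/-! ### Building the graph -/

/-- Fill an array with the multiples of a number. -/
def multiples (a bound step : ℕ) : Cmd :=
  set arrAcc (.const 0) ;;
  rep 60 bound (put a (var 60) (var arrAcc) ;; set arrAcc (add (var arrAcc) (var step)))

/-- The machine has no multiplication, so offsets of matrix rows are tabulated by repeated addition.
-/
theorem multiples_spec {a bound step : ℕ} {s : Memory} (h1 : a ∉ [60, arrAcc, step])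
    (h2 : bound ≠ arrAcc) (h3 : step ∉ [60, arrAcc]) :
    ∀ i < s bound 0, (multiples a bound step).den s a i = i * s step 0 := by
  simp only [List.mem_cons, not_or, List.not_mem_nil, not_false_iff, and_true] at h1 h3
  rw [multiples, den_seq]
  generalize hs1 : den (set arrAcc (.const 0)) s = s1
  have hfr1 : ∀ b, b ≠ arrAcc → s1 b = s b := by
    intro b hb
    rw [← hs1]
    exact Memory.store_ne _ _ _ hb
  have hacc : s1 arrAcc 0 = 0 := by
    rw [← hs1]
    simp [den, eval, Memory.store_same]
  rw [← hfr1 bound h2]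
  have hmain := den_rep (x := 60) (a := bound) (s := s1)
    (c := put a (var 60) (var arrAcc) ;; set arrAcc (add (var arrAcc) (var step)))
    (fun n s' => s' arrAcc 0 = n * s step 0 ∧ ∀ i < n, s' a i = i * s step 0) ?_ ?_
  · exact hmain.2
  · rw [Memory.store_ne _ _ _ (by decide), hacc]
    exact ⟨by simp, by omega⟩
  · rintro i _ s2 hfr2 h60 ⟨h4, h5⟩
    have hst : s2 step = s step := by
      rw [hfr2, hfr1 step h3.2]
      simp [writes, h3, Ne.symm h1.2.2]
    rw [Memory.store_ne _ _ _ (by decide), Memory.store_ne _ _ _ h1.1]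
    simp only [den, eval]
    rw [Memory.store_ne _ _ _ h1.2.1, Memory.store_ne _ _ _ (Ne.symm h1.2.2)]
    simp only [Memory.store_same, if_true, h60]
    rw [Memory.store_ne _ _ _ (Ne.symm h1.2.1), h4, hst]
    refine ⟨by ring, fun j hj => ?_⟩
    split_ifs with hji
    · rw [hji]
    · exact h5 j (by omega)

/-- Compute the machine of every copy. -/
def machines : Cmd :=
  set arrAcc (var 0) ;;
  rep 60 arrCap (rep 61 1 (put arrMach (var arrAcc) (var 61) ;;
    set arrAcc (add (var arrAcc) (.const 1))))

/-- The remainder modulo `m` comes from the inner loop counter, since there is no division either.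
-/
theorem machines_spec {s : Memory} {n m : ℕ} (hn : s 0 0 = n) (hm : s 1 0 = m) :
    ∀ v, n ≤ v → v < n + s arrCap 0 * m → machines.den s arrMach v = (v - n) % m := by
  rw [machines, den_seq]
  generalize hs1 : den (set arrAcc (var 0)) s = s1
  have hfr1 : ∀ b, b ≠ arrAcc → s1 b = s b := by
    intro b hb
    rw [← hs1]
    exact Memory.store_ne _ _ _ hb
  have hacc : s1 arrAcc 0 = n := by
    rw [← hs1]
    simp [den, eval, Memory.store_same, hn]
  rw [← hfr1 arrCap (by decide)]
  have houter := den_rep (x := 60) (a := arrCap) (s := s1)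
    (c := rep 61 1 (put arrMach (var arrAcc) (var 61) ;;
      set arrAcc (add (var arrAcc) (.const 1))))
    (fun q s' => s' arrAcc 0 = n + q * m ∧
      ∀ v, n ≤ v → v < n + q * m → s' arrMach v = (v - n) % m) ?_ ?_
  · exact houter.2
  · rw [Memory.store_ne _ _ _ (by decide), hacc]
    exact ⟨by simp, by omega⟩
  · rintro q _ s2 hfr2 - ⟨h1, h2⟩
    have hm2 : s2 1 0 = m := by rw [hfr2 _ (by decide), hfr1 _ (by decide), hm]
    have hinner := den_rep (x := 61) (a := 1) (s := s2)
      (c := put arrMach (var arrAcc) (var 61) ;; set arrAcc (add (var arrAcc) (.const 1)))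
      (fun i s' => s' arrAcc 0 = n + q * m + i ∧
        ∀ v, n ≤ v → v < n + q * m + i → s' arrMach v = (v - n) % m) ?_ ?_
    · rw [hm2] at hinner
      rw [Memory.store_ne _ _ _ (by decide), Memory.store_ne _ _ _ (by decide), Nat.succ_mul,
        ← Nat.add_assoc]
      exact hinner
    · rw [Memory.store_ne _ _ _ (by decide), Memory.store_ne _ _ _ (by decide)]
      exact ⟨h1, h2⟩
    · rintro i hi s3 _ h61 ⟨h3, h4⟩
      rw [hm2] at hi
      rw [Memory.store_ne _ _ _ (by decide), Memory.store_ne _ _ _ (by decide)]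
      simp only [den, eval, Memory.store_same, Memory.store_ne, ne_eq, Nat.reduceEqDiff,
        not_false_iff, if_true, h3, h61]
      refine ⟨by omega, fun v hv hv' => ?_⟩
      split_ifs with h
      · rw [h, show n + q * m + i - n = i + m * q by rw [Nat.mul_comm m]; omega,
          Nat.add_mul_mod_self_left, Nat.mod_eq_of_lt hi]
      · exact h4 v hv (by omega)

/-- The adjacency of the vertices `60` and `61`. -/
def adjacency : Expr :=
  add (add
    (and (and (sub (var 0) (var 60)) (not (sub (var 0) (var 61))))
      (eq (get 2 (add (get arrRow (var 60)) (get arrMach (var 61)))) (var arrK)))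
    (and (and (sub (var 0) (var 61)) (not (sub (var 0) (var 60))))
      (eq (get 2 (add (get arrRow (var 61)) (get arrMach (var 60)))) (var arrK))))
    (and (and (and (not (sub (var 0) (var 60))) (not (sub (var 0) (var 61)))) (not (var arrZero)))
      (and (eq (get arrMach (var 60)) (get arrMach (var 61))) (not (eq (var 60) (var 61)))))

theorem adjacency_spec {s : Memory} {n m N u v : ℕ} (hn : s 0 0 = n) (hu : u < N) (hv : v < N)
    (h60 : s 60 0 = u) (h61 : s 61 0 = v) (hrow : ∀ j < n, s arrRow j = j * m)
    (hmach : ∀ v, n ≤ v → v < N → s arrMach v = (v - n) % m) :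
    adjacency.eval s ≠ 0 ↔ copyGraph n m (s 2) (s arrK 0) (s arrZero 0) u v := by
  have hadd : ∀ x y : Expr, (add x y).eval s ≠ 0 ↔ x.eval s ≠ 0 ∨ y.eval s ≠ 0 := by
    intro x y
    rw [eval_add]
    omega
  rw [adjacency, hadd, hadd]
  simp only [eval_and_ne_zero, eval_not_ne_zero, eval_eq_ne_zero, eval_get,
    eval_sub, eval_add, eval_const, h60, h61, hn]
  have heq : (eq (var 60) (var 61)).eval s = 0 ↔ u ≠ v := by
    rw [← not_iff_not, ← ne_eq, eval_eq_ne_zero]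
    simp [eval, h60, h61]
  rw [heq]
  unfold copyGraph
  refine or_assoc.trans (or_congr ?_ (or_congr ?_ ?_))
  · constructor
    · rintro ⟨⟨h1, h2⟩, h3⟩
      rw [hrow u (by omega), hmach v (by omega) hv] at h3
      exact ⟨by omega, by omega, h3⟩
    · rintro ⟨h1, h2, h3⟩
      rw [hrow u h1, hmach v h2 hv]
      exact ⟨⟨by omega, by omega⟩, h3⟩
  · constructor
    · rintro ⟨⟨h1, h2⟩, h3⟩
      rw [hrow v (by omega), hmach u (by omega) hu] at h3
      exact ⟨by omega, by omega, h3⟩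
    · rintro ⟨h1, h2, h3⟩
      rw [hrow v h1, hmach u h2 hu]
      exact ⟨⟨by omega, by omega⟩, h3⟩
  · constructor
    · rintro ⟨⟨⟨h1, h2⟩, h3⟩, h4, h5⟩
      rw [hmach u (by omega) hu, hmach v (by omega) hv] at h4
      exact ⟨by omega, by omega, h3, h4, h5⟩
    · rintro ⟨h1, h2, h3, h4, h5⟩
      rw [hmach u h1 hu, hmach v h2 hv]
      exact ⟨⟨⟨by omega, by omega⟩, h3⟩, h4, h5⟩

/-- Compute the graph. -/
def buildGraph : Cmd :=
  multiples arrMul arrN arrN ;; multiples arrRow 0 1 ;; machines ;;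
  rep 60 arrN (rep 61 arrN (put arrAdj (add (get arrMul (var 60)) (var 61)) adjacency))

theorem buildGraph_spec {s : Memory} {n m N : ℕ} (hn : s 0 0 = n) (hm : s 1 0 = m)
    (hN : s arrN 0 = N) (hNe : N = n + s arrCap 0 * m) (s' : Memory) (hs' : s' = buildGraph.den s) :
    Env N (copyGraph n m (s 2) (s arrK 0) (s arrZero 0)) s' ∧ (∀ j < n, s' arrRow j = j * m) ∧
      (∀ v, n ≤ v → v < N → s' arrMach v = (v - n) % m) := by
  rw [buildGraph, den_seq, den_seq, den_seq] at hs'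
  have h1 := multiples_spec (a := arrMul) (bound := arrN) (step := arrN) (s := s) (by decide)
    (by decide) (by decide)
  rw [hN] at h1
  have hfr1 : ∀ b, b ∉ [arrAcc, 60, arrMul] → (multiples arrMul arrN arrN).den s b = s b :=
    fun b hb => den_frame _ (by
      simp only [List.mem_cons, not_or, List.not_mem_nil, not_false_iff, and_true] at hb
      simp [multiples, writes, hb]) _
  generalize (multiples arrMul arrN arrN).den s = s1 at *
  have h2 := multiples_spec (a := arrRow) (bound := 0) (step := 1) (s := s1) (by decide)
    (by decide) (by decide)
  rw [hfr1 0 (by decide), hfr1 1 (by decide), hn, hm] at h2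
  have hfr2 : ∀ b, b ∉ [arrAcc, 60, arrRow] → (multiples arrRow 0 1).den s1 b = s1 b :=
    fun b hb => den_frame _ (by
      simp only [List.mem_cons, not_or, List.not_mem_nil, not_false_iff, and_true] at hb
      simp [multiples, writes, hb]) _
  generalize (multiples arrRow 0 1).den s1 = s2 at *
  have hfr2' : ∀ b, b ∉ [arrAcc, 60, arrMul, arrRow] → s2 b = s b := by
    intro b hb
    simp only [List.mem_cons, not_or, List.not_mem_nil, not_false_iff, and_true] at hb
    rw [hfr2 b (by simp [hb]), hfr1 b (by simp [hb])]
  have h3 := machines_spec (s := s2) (n := n) (m := m) (by rw [hfr2' _ (by decide), hn])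
    (by rw [hfr2' _ (by decide), hm])
  rw [hfr2' arrCap (by decide), ← hNe] at h3
  have hfr3 : ∀ b, b ∉ [arrAcc, 60, 61, arrMach] → machines.den s2 b = s2 b :=
    fun b hb => den_frame _ (by
      simp only [List.mem_cons, not_or, List.not_mem_nil, not_false_iff, and_true] at hb
      simp [machines, writes, hb]) _
  generalize machines.den s2 = s3 at *
  have hfr3' : ∀ b, b ∉ [arrAcc, 60, 61, arrMul, arrRow, arrMach] → s3 b = s b := by
    intro b hb
    simp only [List.mem_cons, not_or, List.not_mem_nil, not_false_iff, and_true] at hb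
    rw [hfr3 b (by simp [hb]), hfr2' b (by simp [hb])]
  have hmul3 : ∀ u < N, s3 arrMul u = u * N := by
    intro u hu
    rw [hfr3 _ (by decide), hfr2 _ (by decide), h1 u hu]
  have hrow3 : ∀ j < n, s3 arrRow j = j * m := by
    intro j hj
    rw [hfr3 _ (by decide), h2 j hj]
  have hN3 : s3 arrN 0 = N := by rw [hfr3' _ (by decide), hN]
  have hn3 : s3 0 0 = n := by rw [hfr3' _ (by decide), hn]
  have hadj := den_rep (x := 60) (a := arrN) (s := s3)
    (c := rep 61 arrN (put arrAdj (add (get arrMul (var 60)) (var 61)) adjacency))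
    (fun i s' => ∀ u < i, ∀ v < N, s' arrAdj (u * N + v) ≠ 0 ↔
      copyGraph n m (s 2) (s arrK 0) (s arrZero 0) u v) ?_ ?_
  rotate_left
  · intro u hu; omega
  · intro i hi s4 hfr4 h60 h4
    rw [hN3] at hi
    have hN4 : s4 arrN 0 = N := by rw [hfr4 _ (by decide), hN3]
    have hfr4' : ∀ b, b ∉ [60, 61, arrAdj] → s4 b = s3 b := by
      intro b hb
      simp only [List.mem_cons, not_or, List.not_mem_nil, not_false_iff, and_true] at hb
      exact hfr4 b (by simp [writes, hb])
    obtain ⟨hfill, hout⟩ := den_fill (x := 61) (a := arrN) (b := arrAdj)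
      (idx := add (get arrMul (var 60)) (var 61)) (val := adjacency) (s := s4) (i * N)
      -- The entry does not depend on `arrAdj`, so it can be evaluated in the memory at loop entry
      -- with only the counter changed.
      (fun v => adjacency.eval (s4.store 61 0 v)) (by decide) (by
        intro v hv s' h5 h6 _
        refine ⟨by simp [eval, h6, h5 60, h60, h5 arrMul, hfr4' arrMul, hmul3 i hi], ?_⟩
        simp [adjacency, eval_and, eval_not, eval_eq, eval, h6, h5, Memory.store_same,
          Memory.store_ne])
    rw [hN4] at hfill hout
    rw [Memory.store_ne _ _ _ (by decide)]
    intro u hu v hv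
    rcases Nat.lt_succ_iff_lt_or_eq.1 hu with hu | rfl
    · rw [hout, h4 u hu v hv]
      left
      calc u * N + v < u * N + N := by omega
        _ = (u + 1) * N := by ring
        _ ≤ i * N := Nat.mul_le_mul_right _ hu
    · rw [hfill v hv, adjacency_spec (n := n) (m := m) (N := N) (u := u) (v := v)
        ?_ hi hv ?_ ?_ ?_ ?_]
      · rw [Memory.store_ne _ _ _ (by decide), Memory.store_ne _ _ _ (by decide),
          Memory.store_ne _ _ _ (by decide), hfr4' _ (by decide), hfr4' _ (by decide),
          hfr4' _ (by decide), hfr3' _ (by decide), hfr3' _ (by decide), hfr3' _ (by decide)]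
      · rw [Memory.store_ne _ _ _ (by decide), hfr4' _ (by decide), hn3]
      · rw [Memory.store_ne _ _ _ (by decide), h60]
      · simp [Memory.store_same]
      · rw [Memory.store_ne _ _ _ (by decide), hfr4' _ (by decide)]
        exact hrow3
      · rw [Memory.store_ne _ _ _ (by decide), hfr4' _ (by decide)]
        exact h3
  rw [hN3, ← hs'] at hadj
  have hfr5 : ∀ b, b ∉ [60, 61, arrAdj] → s' b = s3 b := by
    intro b hb
    rw [hs']
    refine den_frame _ ?_ _
    simp only [List.mem_cons, not_or, List.not_mem_nil, not_false_iff, and_true] at hb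
    simp [writes, hb]
  refine ⟨⟨?_, ?_, hadj⟩, ?_, ?_⟩
  · rw [hfr5 _ (by decide), hN3]
  · rw [hfr5 _ (by decide)]
    exact hmul3
  · rw [hfr5 _ (by decide)]
    exact hrow3
  · rw [hfr5 _ (by decide)]
    exact h3

end RAM

/-! ### From the matching to an assignment of jobs -/

/-- The matching `M` assigns job `j` to a machine; if no tolerance is zero (`z = 0`), both copies of
this machine have to be matched to jobs. -/
def Chosen (n m z : ℕ) (M : ℕ → ℕ) (j : ℕ) : Prop :=
  n ≤ M j ∧ (z ≠ 0 ∨ (M (n + (M j - n) % m) < n ∧ M (n + m + (M j - n) % m) < n))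

/-- `J` and `U` arise from the assignment `J0` of jobs to machines (shifted by one) with the set
`U0` of used machines by the assignment of new jobs to unused machines. -/
structure Extends (n m : ℕ) (J0 U0 J U : ℕ → ℕ) : Prop where
  used : ∀ i < m, U i ≠ 0 ↔ ∃ j < n, J j = i + 1
  keep : ∀ j, J0 j ≠ 0 → J j = J0 j
  new : ∀ j < n, J0 j = 0 → J j ≠ 0 → ∃ i < m, J j = i + 1 ∧ U0 i = 0
  uniq : ∀ j < n, ∀ j' < n, J0 j = 0 → J0 j' = 0 → J j ≠ 0 → J j = J j' → j = j'

/-- A machine is given away only while no job is on it, so a newly assigned job shares its machine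
with nobody. -/
theorem Extends.assign {n m : ℕ} {J0 U0 J U J' U' : ℕ → ℕ} (h : Extends n m J0 U0 J U)
    (hU0 : ∀ i < m, U0 i ≠ 0 ↔ ∃ j < n, J0 j = i + 1) {j i : ℕ} (hj : j < n) (hi : i < m)
    (hJ : J j = 0) (hU : U i = 0) (hJ' : ∀ x, J' x = if x = j then i + 1 else J x)
    (hU' : ∀ x, U' x = if x = i then 1 else U x) : Extends n m J0 U0 J' U' := by
  have hJ0 : J0 j = 0 := by
    by_contra h1
    have := h.keep j h1
    omega
  have hnone : ∀ x < n, J x ≠ i + 1 := by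
    intro x hx h1
    exact (h.used i hi).2 ⟨x, hx, h1⟩ hU
  refine ⟨fun x hx => ?_, fun x hx => ?_, fun x hx h1 h2 => ?_, fun x hx y hy h1 h2 h3 h4 => ?_⟩
  · rw [hU']
    split_ifs with hxi
    · subst hxi
      simp only [ne_eq, one_ne_zero, not_false_iff, true_iff]
      exact ⟨j, hj, by rw [hJ', if_pos rfl]⟩
    · rw [h.used x hx]
      constructor
      · rintro ⟨y, hy, h1⟩
        refine ⟨y, hy, ?_⟩
        rw [hJ', if_neg (by rintro rfl; omega), h1]
      · rintro ⟨y, hy, h1⟩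
        rw [hJ'] at h1
        split_ifs at h1
        · omega
        · exact ⟨y, hy, h1⟩
  · rw [hJ', if_neg (by rintro rfl; exact hx hJ0)]
    exact h.keep x hx
  · rw [hJ'] at h2 ⊢
    split_ifs at h2 ⊢ with hxj
    · refine ⟨i, hi, rfl, ?_⟩
      by_contra h3
      obtain ⟨y, hy, h4⟩ := (hU0 i hi).1 h3
      exact hnone y hy (by rw [h.keep y (by omega), h4])
    · exact h.new x hx h1 h2
  · rw [hJ', hJ'] at h4
    rw [hJ'] at h3
    split_ifs at h3 h4 with h5 h6 h6
    · rw [h5, h6]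
    · exact absurd h4.symm (hnone y hy)
    · exact absurd h4 (hnone x hx)
    · exact h.uniq x hx y hy h1 h2 h3 h4

namespace RAM

open RAM.Expr RAM.Cmd

/-- Assign the jobs as in the matching `arrM`. -/
def assignMatched : Cmd :=
  rep 60 0 (when (not (sub (var 0) (get arrM (var 60))))
    (when (add (var arrZero)
        (and (sub (var 0) (get arrM (add (var 0) (get arrMach (get arrM (var 60))))))
          (sub (var 0) (get arrM (add (add (var 0) (var 1)) (get arrMach (get arrM (var 60))))))))
      (put arrJob (var 60) (add (get arrMach (get arrM (var 60))) (.const 1)) ;;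
        put arrUsed (get arrMach (get arrM (var 60))) (.const 1))))

open Classical in
theorem assignMatched_spec {s : Memory} {n m N : ℕ} (hn : s 0 0 = n) (hm : s 1 0 = m)
    (hM : ∀ j < n, s arrM j < N) (hmach : ∀ v, n ≤ v → v < N → s arrMach v = (v - n) % m)
    (hJ : ∀ j, s arrJob j = 0) (hU : ∀ i, s arrUsed i = 0) (s' : Memory)
    (hs' : s' = assignMatched.den s) :
    (∀ j < n, s' arrJob j =
        if Chosen n m (s arrZero 0) (s arrM) j then (s arrM j - n) % m + 1 else 0) ∧
      (∀ j, n ≤ j → s' arrJob j = 0) ∧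
      ∀ i, s' arrUsed i ≠ 0 ↔ ∃ j < n, s' arrJob j = i + 1 := by
  have hmain := den_rep (x := 60) (a := 0) (s := s)
    (c := when (not (sub (var 0) (get arrM (var 60))))
    (when (add (var arrZero)
        (and (sub (var 0) (get arrM (add (var 0) (get arrMach (get arrM (var 60))))))
          (sub (var 0) (get arrM (add (add (var 0) (var 1)) (get arrMach (get arrM (var 60))))))))
      (put arrJob (var 60) (add (get arrMach (get arrM (var 60))) (.const 1)) ;;
        put arrUsed (get arrMach (get arrM (var 60))) (.const 1))))
    (fun k s' => (∀ j, s' arrJob j =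
        if j < k ∧ Chosen n m (s arrZero 0) (s arrM) j then (s arrM j - n) % m + 1 else 0) ∧
      ∀ i, s' arrUsed i ≠ 0 ↔ ∃ j < k, s' arrJob j = i + 1) ?_ ?_
  · rw [hn] at hmain
    rw [hs']
    refine ⟨fun j hj => ?_, fun j hj => ?_, hmain.2⟩
    · rw [assignMatched, hmain.1]
      simp only [hj, true_and]
    · rw [assignMatched, hmain.1, if_neg (by omega)]
  · simp [Memory.store_ne, hJ, hU]
  · rintro k hk s1 hfr h60 ⟨h1, h2⟩
    rw [hn] at hk
    have e0 : s1 0 0 = n := by rw [hfr _ (by decide), hn]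
    have e1 : s1 1 0 = m := by rw [hfr _ (by decide), hm]
    have eM : s1 arrM = s arrM := hfr _ (by decide)
    have eZ : s1 arrZero = s arrZero := hfr _ (by decide)
    have eMach : s1 arrMach = s arrMach := hfr _ (by decide)
    rw [Memory.store_ne _ _ _ (by decide), Memory.store_ne _ _ _ (by decide)]
    by_cases hc : Chosen n m (s arrZero 0) (s arrM) k
    · have hmk := hmach (s arrM k) hc.1 (hM k hk)
      have hden : (when (not (sub (var 0) (get arrM (var 60))))
        (when (add (var arrZero)
          (and (sub (var 0) (get arrM (add (var 0) (get arrMach (get arrM (var 60))))))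
            (sub (var 0) (get arrM (add (add (var 0) (var 1)) (get arrMach (get arrM (var 60))))))))
        (put arrJob (var 60) (add (get arrMach (get arrM (var 60))) (.const 1)) ;;
          put arrUsed (get arrMach (get arrM (var 60))) (.const 1)))).den s1 =
          (s1.store arrJob k ((s arrM k - n) % m + 1)).store arrUsed ((s arrM k - n) % m) 1 := by
        obtain ⟨hc1, hc2⟩ := hc
        rw [den, if_pos, den, if_pos]
        · simp only [den, eval, h60, eM, eMach, hmk, Memory.store_ne, ne_eq, Nat.reduceEqDiff,
            not_false_iff]
        · rw [eval_add]
          rcases hc2 with hc2 | hc2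
          · simp only [eval_get, eval_const, eZ]
            omega
          · have : (and (sub (var 0) (get arrM (add (var 0) (get arrMach (get arrM (var 60))))))
              (sub (var 0) (get arrM (add (add (var 0) (var 1))
                (get arrMach (get arrM (var 60))))))).eval s1 ≠ 0 := by
              rw [eval_and_ne_zero]
              simp only [eval, h60, eM, eMach, hmk, e0, e1]
              omega
            omega
        · rw [eval_not_ne_zero]
          simp only [eval, h60, eM, e0]
          omega
      rw [hden]
      simp only [Memory.store_ne, Memory.store_same, ne_eq, Nat.reduceEqDiff, not_false_iff]
      constructor
      · intro j
        by_cases hjk : j = k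
        · subst hjk
          simp [hc]
        · have : j < k + 1 ↔ j < k := by omega
          simp only [hjk, if_false, this, h1 j]
      · intro i
        split_ifs with hi
        · simp only [not_false_iff, true_iff]
          exact ⟨k, by omega, by simp [hi]⟩
        · rw [← ne_eq, h2]
          constructor
          · rintro ⟨j, hj, h3⟩
            exact ⟨j, by omega, by rw [if_neg (by omega), h3]⟩
          · rintro ⟨j, hj, h3⟩
            split_ifs at h3 with hjk
            · omega
            · exact ⟨j, by omega, h3⟩
    · have hden : (when (not (sub (var 0) (get arrM (var 60))))
        (when (add (var arrZero)
          (and (sub (var 0) (get arrM (add (var 0) (get arrMach (get arrM (var 60))))))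
            (sub (var 0) (get arrM (add (add (var 0) (var 1)) (get arrMach (get arrM (var 60))))))))
        (put arrJob (var 60) (add (get arrMach (get arrM (var 60))) (.const 1)) ;;
          put arrUsed (get arrMach (get arrM (var 60))) (.const 1)))).den s1 = s1 := by
        rw [den]
        split_ifs with h3
        · rw [eval_not_ne_zero] at h3
          simp only [eval, h60, eM, e0] at h3
          have hmk := hmach (s arrM k) (by omega) (hM k hk)
          rw [den, if_neg, den]
          intro h4
          apply hc
          refine ⟨by omega, ?_⟩
          by_cases hz : s arrZero 0 = 0
          · right
            rw [eval_add] at h4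
            have h5 : (and (sub (var 0) (get arrM (add (var 0) (get arrMach (get arrM (var 60))))))
              (sub (var 0) (get arrM (add (add (var 0) (var 1))
                (get arrMach (get arrM (var 60))))))).eval s1 ≠ 0 := by
              simp only [eval_get, eval_const, eZ, hz] at h4 ⊢
              omega
            rw [eval_and_ne_zero] at h5
            simp only [eval, h60, eM, eMach, hmk, e0, e1] at h5
            omega
          · exact Or.inl hz
        · rw [den]
      rw [hden]
      have hiff : ∀ j, (j < k + 1 ∧ Chosen n m (s arrZero 0) (s arrM) j) ↔
          (j < k ∧ Chosen n m (s arrZero 0) (s arrM) j) := by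
        intro j
        constructor
        · rintro ⟨h3, h4⟩
          refine ⟨?_, h4⟩
          rcases Nat.lt_succ_iff_lt_or_eq.1 h3 with h | rfl
          · exact h
          · exact absurd h4 hc
        · rintro ⟨h3, h4⟩
          exact ⟨by omega, h4⟩
      refine ⟨fun j => by simp only [hiff, h1 j], fun i => ?_⟩
      rw [h2]
      constructor
      · rintro ⟨j, hj, h3⟩
        exact ⟨j, by omega, h3⟩
      · rintro ⟨j, hj, h3⟩
        refine ⟨j, ?_, h3⟩
        rcases Nat.lt_succ_iff_lt_or_eq.1 hj with h | rfl
        · exact h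
        · rw [h1, if_neg (by omega)] at h3
          omega

/-- Assign free jobs to free machines. -/
def assignFree : Cmd :=
  rep 60 0 (rep 61 1 (when (and (not (get arrJob (var 60))) (not (get arrUsed (var 61))))
    (put arrJob (var 60) (add (var 61) (.const 1)) ;; put arrUsed (var 61) (.const 1))))

theorem assignFree_cell_spec {s : Memory} {n m j i : ℕ} {J0 U0 : ℕ → ℕ}
    (hU0 : ∀ i < m, U0 i ≠ 0 ↔ ∃ j < n, J0 j = i + 1) (hj : j < n) (hi : i < m)
    (h60 : s 60 0 = j) (h61 : s 61 0 = i) (h : Extends n m J0 U0 (s arrJob) (s arrUsed))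
    (s' : Memory)
    (hs' : s' = (when (and (not (get arrJob (var 60))) (not (get arrUsed (var 61))))
      (put arrJob (var 60) (add (var 61) (.const 1)) ;; put arrUsed (var 61) (.const 1))).den s) :
    Extends n m J0 U0 (s' arrJob) (s' arrUsed) ∧ (∀ x, s arrJob x ≠ 0 → s' arrJob x ≠ 0) ∧
      (∀ x, s arrUsed x ≠ 0 → s' arrUsed x ≠ 0) ∧ (s' arrJob j ≠ 0 ∨ s' arrUsed i ≠ 0) := by
  rw [den] at hs'
  split_ifs at hs' with hc
  · simp only [eval_and_ne_zero, eval_not_ne_zero, eval_get, eval_const, h60, h61] at hc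
    have hJ' : ∀ x, s' arrJob x = if x = j then i + 1 else s arrJob x := by
      intro x
      rw [hs']
      simp [den, eval, Memory.store_ne, Memory.store_same, h60, h61]
    have hU' : ∀ x, s' arrUsed x = if x = i then 1 else s arrUsed x := by
      intro x
      rw [hs']
      simp [den, eval, Memory.store_ne, Memory.store_same, h61]
    refine ⟨h.assign hU0 hj hi hc.1 hc.2 hJ' hU', fun x hx => ?_, fun x hx => ?_, Or.inl ?_⟩
    · rw [hJ']
      split_ifs
      · omega
      · exact hx
    · rw [hU']
      split_ifs
      · omega
      · exact hx
    · rw [hJ', if_pos rfl]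
      omega
  · simp only [eval_and_ne_zero, eval_not_ne_zero, eval_get, eval_const, h60, h61] at hc
    rw [den] at hs'
    rw [hs']
    exact ⟨h, fun _ h => h, fun _ h => h, by tauto⟩

/-- A job left free has met only used machines, and used machines stay used; hence a free job and a
free machine do not coexist at the end. -/
theorem assignFree_spec {s : Memory} {n m : ℕ} (hn : s 0 0 = n) (hm : s 1 0 = m)
    (hU0 : ∀ i < m, s arrUsed i ≠ 0 ↔ ∃ j < n, s arrJob j = i + 1) (s' : Memory)
    (hs' : s' = assignFree.den s) :
    Extends n m (s arrJob) (s arrUsed) (s' arrJob) (s' arrUsed) ∧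
      ∀ j < n, s' arrJob j ≠ 0 ∨ ∀ i < m, s' arrUsed i ≠ 0 := by
  have houter := den_rep (x := 60) (a := 0) (s := s)
    (c := rep 61 1 (when (and (not (get arrJob (var 60))) (not (get arrUsed (var 61))))
    (put arrJob (var 60) (add (var 61) (.const 1)) ;; put arrUsed (var 61) (.const 1))))
    (fun k s' => Extends n m (s arrJob) (s arrUsed) (s' arrJob) (s' arrUsed) ∧
      ∀ j < k, s' arrJob j ≠ 0 ∨ ∀ i < m, s' arrUsed i ≠ 0) ?_ ?_
  · rw [hn] at houter
    rw [hs']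
    exact houter
  · rw [Memory.store_ne _ _ _ (by decide), Memory.store_ne _ _ _ (by decide)]
    exact ⟨⟨hU0, fun _ _ => rfl, fun j _ h1 h2 => absurd h1 h2,
      fun j _ j' _ h1 _ h2 => absurd h1 h2⟩, by omega⟩
  · rintro k hk s1 hfr1 h60 ⟨h1, h2⟩
    rw [hn] at hk
    have hm1 : s1 1 0 = m := by rw [hfr1 _ (by decide), hm]
    have hinner := den_rep (x := 61) (a := 1) (s := s1)
      (c := when (and (not (get arrJob (var 60))) (not (get arrUsed (var 61))))
        (put arrJob (var 60) (add (var 61) (.const 1)) ;; put arrUsed (var 61) (.const 1)))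
      (fun l s' => Extends n m (s arrJob) (s arrUsed) (s' arrJob) (s' arrUsed) ∧
        (∀ x, s1 arrJob x ≠ 0 → s' arrJob x ≠ 0) ∧
        (∀ x, s1 arrUsed x ≠ 0 → s' arrUsed x ≠ 0) ∧
        (s' arrJob k ≠ 0 ∨ ∀ i < l, s' arrUsed i ≠ 0)) ?_ ?_
    · rw [hm1] at hinner
      obtain ⟨h3, h4, h5, h6⟩ := hinner
      rw [Memory.store_ne _ _ _ (by decide), Memory.store_ne _ _ _ (by decide)]
      refine ⟨h3, fun j hj => ?_⟩
      rcases Nat.lt_succ_iff_lt_or_eq.1 hj with hj | rfl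
      · rcases h2 j hj with h7 | h7
        · exact Or.inl (h4 j h7)
        · exact Or.inr fun i hi => h5 i (h7 i hi)
      · exact h6
    · rw [Memory.store_ne _ _ _ (by decide), Memory.store_ne _ _ _ (by decide)]
      exact ⟨h1, fun _ h => h, fun _ h => h, Or.inr (by omega)⟩
    · rintro l hl s2 hfr2 h61 ⟨h3, h4, h5, h6⟩
      rw [hm1] at hl
      obtain ⟨h7, h8, h9, h10⟩ := assignFree_cell_spec hU0 hk hl
        (by rw [hfr2 _ (by decide), h60]) h61 h3 _ rfl
      rw [Memory.store_ne _ _ _ (by decide), Memory.store_ne _ _ _ (by decide)]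
      refine ⟨h7, fun x hx => h8 x (h4 x hx), fun x hx => h9 x (h5 x hx), ?_⟩
      rcases h6 with h6 | h6
      · exact Or.inl (h8 k h6)
      · rcases h10 with h10 | h10
        · exact Or.inl h10
        · right
          intro i hi
          rcases Nat.lt_succ_iff_lt_or_eq.1 hi with hi | rfl
          · exact h9 i (h6 i hi)
          · exact h10

/-- Write the indicator matrix of the assignment. -/
def writeOutput : Cmd :=
  rep 60 0 (when (get arrJob (var 60))
    (put 3 (sub (add (get arrRow (var 60)) (get arrJob (var 60))) (.const 1)) (.const 1)))

theorem mul_add_inj {m j j' i i' : ℕ} (hi : i < m) (hi' : i' < m) (h : j * m + i = j' * m + i') :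
    j = j' ∧ i = i' := by
  have h1 : (j * m + i) % m = i := by
    rw [Nat.mul_comm, Nat.mul_add_mod, Nat.mod_eq_of_lt hi]
  have h2 : (j' * m + i') % m = i' := by
    rw [Nat.mul_comm, Nat.mul_add_mod, Nat.mod_eq_of_lt hi']
  have h3 : i = i' := by rw [← h1, ← h2, h]
  subst h3
  exact ⟨Nat.eq_of_mul_eq_mul_right (by omega) (Nat.add_right_cancel h), rfl⟩

/-- The index subtracts the shift by one in `arrJob`; entries at most `m` keep each mark inside the
row of its job. -/
theorem writeOutput_spec {s : Memory} {n m : ℕ} (hn : s 0 0 = n) (h3 : ∀ x, s 3 x = 0)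
    (hrow : ∀ j < n, s arrRow j = j * m) (hJ : ∀ j < n, s arrJob j ≤ m) :
    ∀ j < n, ∀ i < m, writeOutput.den s 3 (j * m + i) = if s arrJob j = i + 1 then 1 else 0 := by
  have hmain := den_rep (x := 60) (a := 0) (s := s)
    (c := when (get arrJob (var 60))
      (put 3 (sub (add (get arrRow (var 60)) (get arrJob (var 60))) (.const 1)) (.const 1)))
    (fun k s' => ∀ j < n, ∀ i < m, s' 3 (j * m + i) =
      if j < k ∧ s arrJob j = i + 1 then 1 else 0) ?_ ?_
  · rw [hn] at hmain
    intro j hj i hi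
    have := hmain j hj i hi
    simp only [hj, true_and] at this
    exact this
  · simp [Memory.store_ne, h3]
  · intro k hk s1 hfr h60 h j hj i hi
    rw [hn] at hk
    have eJ : s1 arrJob = s arrJob := hfr _ (by decide)
    have eR : s1 arrRow = s arrRow := hfr _ (by decide)
    rw [Memory.store_ne _ _ _ (by decide), den]
    have heval : (get arrJob (var 60)).eval s1 = s arrJob k := by simp only [eval, h60, eJ]
    by_cases hc : s arrJob k = 0
    · rw [if_neg (by rw [heval]; exact not_not.2 hc), den, h j hj i hi]
      congr 1
      apply propext
      constructor
      · rintro ⟨h4, h5⟩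
        exact ⟨by omega, h5⟩
      · rintro ⟨h4, h5⟩
        refine ⟨?_, h5⟩
        rcases Nat.lt_succ_iff_lt_or_eq.1 h4 with h4 | rfl
        · exact h4
        · omega
    · rw [if_pos (by rw [heval]; exact hc)]
      have hJk := hJ k hk
      have hidx : j * m + i = k * m + s arrJob k - 1 ↔ j = k ∧ s arrJob j = i + 1 := by
        constructor
        · intro h1
          obtain ⟨h4, h5⟩ := mul_add_inj (i' := s arrJob k - 1) hi (by omega)
            (show j * m + i = k * m + (s arrJob k - 1) by omega)
          subst h4
          exact ⟨rfl, by omega⟩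
        · rintro ⟨rfl, h1⟩
          omega
      simp only [den, eval, h60, eJ, eR, hrow k hk, Memory.store_same]
      rw [h j hj i hi]
      by_cases h1 : j * m + i = k * m + s arrJob k - 1
      · rw [if_pos h1, if_pos]
        have := hidx.1 h1
        exact ⟨by omega, this.2⟩
      · rw [if_neg h1]
        congr 1
        apply propext
        constructor
        · rintro ⟨h4, h5⟩
          exact ⟨by omega, h5⟩
        · rintro ⟨h4, h5⟩
          refine ⟨?_, h5⟩
          rcases Nat.lt_succ_iff_lt_or_eq.1 h4 with h4 | rfl
          · exact h4
          · exact absurd (hidx.2 ⟨rfl, h5⟩) h1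

/-- The main part of the program. -/
def mainPart : Cmd :=
  buildGraph ;; maxMatching ;; assignMatched ;; when (not (var arrZero)) assignFree ;; writeOutput

-- This removes the memory from the argument: optimality is proved below for plain functions with
-- these properties.
open Classical in
theorem mainPart_spec {s : Memory} {n m N : ℕ} (hn : s 0 0 = n) (hm : s 1 0 = m) (hm0 : 0 < m)
    (hN : s arrN 0 = N) (hNe : N = n + s arrCap 0 * m) (hB : s arrB 0 = N + 1)
    (h0 : ∀ a ∈ [3, arrD, arrJob, arrUsed], ∀ x, s a x = 0) :
    ∃ M J0 U0 J U : ℕ → ℕ, Mate N (copyGraph n m (s 2) (s arrK 0) (s arrZero 0)) M ∧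
      (∀ f, Mate N (copyGraph n m (s 2) (s arrK 0) (s arrZero 0)) f → miss N M ≤ miss N f) ∧
      (∀ j < n, J0 j = if Chosen n m (s arrZero 0) M j then (M j - n) % m + 1 else 0) ∧
      (∀ i, U0 i ≠ 0 ↔ ∃ j < n, J0 j = i + 1) ∧ (s arrZero 0 ≠ 0 → J = J0) ∧
      (s arrZero 0 = 0 → Extends n m J0 U0 J U ∧ ∀ j < n, J j ≠ 0 ∨ ∀ i < m, U i ≠ 0) ∧
      ∀ j < n, ∀ i < m, mainPart.den s 3 (j * m + i) = if J j = i + 1 then 1 else 0 := by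
  rw [mainPart, den_seq, den_seq, den_seq, den_seq]
  obtain ⟨hE, hrow, hmach⟩ := buildGraph_spec hn hm hN hNe _ rfl
  have hfr1 : ∀ b, b ∉ buildGraph.writes → buildGraph.den s b = s b := fun b hb => den_frame _ hb _
  generalize buildGraph.den s = s1 at *
  obtain ⟨hM, hopt⟩ := maxMatching_spec hE (fun x _ y _ h => copyGraph_symm h)
    (by rw [hfr1 _ (by decide), hB])
    (fun x _ => by rw [hfr1 _ (by decide)]; exact h0 _ (by decide) x)
  have hfr2 : ∀ b, b ∉ maxMatching.writes → maxMatching.den s1 b = s1 b :=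
    fun b hb => den_frame _ hb _
  generalize maxMatching.den s1 = s2 at *
  have hfr2' : ∀ b ∈ [0, 1, 3, arrZero, arrJob, arrUsed], s2 b = s b := by
    intro b hb
    rw [hfr2 b (by revert b; decide), hfr1 b (by revert b; decide)]
  have hn2 : s2 0 0 = n := by rw [hfr2' _ (by decide), hn]
  have hm2 : s2 1 0 = m := by rw [hfr2' _ (by decide), hm]
  have hnN : n ≤ N := by omega
  obtain ⟨hJ0, hJ0', hU0⟩ := assignMatched_spec (N := N) hn2 hm2
    (fun j hj => (hM j (by omega)).1) (by rw [hfr2 _ (by decide)]; exact hmach)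
    (fun j => by rw [hfr2' _ (by decide)]; exact h0 _ (by decide) j)
    (fun j => by rw [hfr2' _ (by decide)]; exact h0 _ (by decide) j) _ rfl
  have hfr3 : ∀ b, b ∉ [60, arrJob, arrUsed] → assignMatched.den s2 b = s2 b := by
    intro b hb
    simp only [List.mem_cons, not_or, List.not_mem_nil, not_false_iff, and_true] at hb
    exact den_frame _ (by simp [assignMatched, writes, hb]) _
  generalize assignMatched.den s2 = s3 at *
  have hz3 : s3 arrZero = s arrZero := by rw [hfr3 _ (by decide), hfr2' _ (by decide)]
  rw [hfr2' arrZero (by decide)] at hJ0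
  have hn3 : s3 0 0 = n := by rw [hfr3 _ (by decide), hn2]
  have hm3 : s3 1 0 = m := by rw [hfr3 _ (by decide), hm2]
  have hJ0m : ∀ j < n, s3 arrJob j ≤ m := by
    intro j hj
    rw [hJ0 j hj]
    split_ifs
    · have := Nat.mod_lt (s2 arrM j - n) hm0
      omega
    · omega
  generalize hs4 : den (when (not (var arrZero)) assignFree) s3 = s4
  have hfr4 : ∀ b, b ∉ [60, 61, arrJob, arrUsed] → s4 b = s3 b := by
    intro b hb
    rw [← hs4]
    simp only [List.mem_cons, not_or, List.not_mem_nil, not_false_iff, and_true] at hb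
    exact den_frame _ (by simp [assignFree, writes, hb]) _
  have hcase : (s arrZero 0 ≠ 0 → s4 arrJob = s3 arrJob) ∧ (s arrZero 0 = 0 →
      Extends n m (s3 arrJob) (s3 arrUsed) (s4 arrJob) (s4 arrUsed) ∧
        ∀ j < n, s4 arrJob j ≠ 0 ∨ ∀ i < m, s4 arrUsed i ≠ 0) := by
    rw [den] at hs4
    constructor
    · intro hz
      rw [if_neg (by rw [eval_not_ne_zero]; simpa [eval, hz3] using hz), den] at hs4
      rw [hs4]
    · intro hz
      rw [if_pos (by rw [eval_not_ne_zero]; simpa [eval, hz3] using hz)] at hs4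
      exact assignFree_spec hn3 hm3 (fun i _ => hU0 i) _ hs4.symm
  have hJm : ∀ j < n, s4 arrJob j ≤ m := by
    intro j hj
    by_cases hz : s arrZero 0 = 0
    · have hx := (hcase.2 hz).1
      by_cases h : s3 arrJob j = 0
      · by_cases h' : s4 arrJob j = 0
        · omega
        · obtain ⟨i, hi, h1, -⟩ := hx.new j hj h h'
          omega
      · rw [hx.keep j h]
        exact hJ0m j hj
    · rw [hcase.1 hz]
      exact hJ0m j hj
  have hout := writeOutput_spec (s := s4) (n := n) (m := m) (by rw [hfr4 _ (by decide), hn3])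
    (fun x => by
      rw [hfr4 _ (by decide), hfr3 _ (by decide), hfr2' _ (by decide)]
      exact h0 _ (by decide) x)
    (by
      rw [hfr4 _ (by decide), hfr3 _ (by decide), hfr2 _ (by decide)]
      exact hrow) hJm
  exact ⟨s2 arrM, s3 arrJob, s3 arrUsed, s4 arrJob, s4 arrUsed, hM, hopt, hJ0, hU0, hcase.1,
    hcase.2, hout⟩

end RAM

/-! ### From a PD-matching to a matching of the graph -/

section Reduction

/-- The ends are pairwise distinct, so the edges can be added to the empty matching one after
another, each covering two new vertices. The last clause serves the induction. -/
theorem exists_mate_of_edges {N : ℕ} {G : ℕ → ℕ → Prop} {ι : Type*} [DecidableEq ι] (E : Finset ι)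
    (a b : ι → ℕ) (h : ∀ e ∈ E, a e < N ∧ b e < N ∧ G (a e) (b e) ∧ G (b e) (a e))
    (ha : ∀ e ∈ E, ∀ e' ∈ E, a e = a e' → e = e') (hb : ∀ e ∈ E, ∀ e' ∈ E, b e = b e' → e = e')
    (hab : ∀ e ∈ E, ∀ e' ∈ E, a e ≠ b e') :
    ∃ f, Mate N G f ∧ miss N f + 2 * E.card = N ∧
      ∀ x, (∀ e ∈ E, x ≠ a e ∧ x ≠ b e) → f x = x := by
  induction E using Finset.induction_on with
  | empty =>
    refine ⟨id, fun x hx => ⟨hx, rfl, fun h => absurd rfl h⟩, ?_, fun _ _ => rfl⟩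
    simp [miss]
  | insert e E he ih =>
    obtain ⟨f, h1, h2, h3⟩ := ih (fun x hx => h x (Finset.mem_insert_of_mem hx))
      (fun x hx y hy => ha x (Finset.mem_insert_of_mem hx) y (Finset.mem_insert_of_mem hy))
      (fun x hx y hy => hb x (Finset.mem_insert_of_mem hx) y (Finset.mem_insert_of_mem hy))
      (fun x hx y hy => hab x (Finset.mem_insert_of_mem hx) y (Finset.mem_insert_of_mem hy))
    have hee := Finset.mem_insert_self e E
    obtain ⟨h4, h5, h6, h7⟩ := h e hee
    have hne := hab e hee e hee
    have hfa : f (a e) = a e := h3 _ fun x hx => by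
      have hx' := Finset.mem_insert_of_mem (b := e) hx
      exact ⟨fun h => he (ha e hee x hx' h ▸ hx), hab e hee x hx'⟩
    have hfb : f (b e) = b e := h3 _ fun x hx => by
      have hx' := Finset.mem_insert_of_mem (b := e) hx
      exact ⟨fun h => hab x hx' e hee h.symm, fun h => he (hb e hee x hx' h ▸ hx)⟩
    refine ⟨addEdge f (a e) (b e), h1.addEdge h4 h5 hfa hfb h6 h7, ?_, fun x hx => ?_⟩
    · have := miss_addEdge h4 h5 hfa hfb hne
      rw [Finset.card_insert_of_notMem he]
      omega
    · rw [addEdge_eq_self_iff hne]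
      exact ⟨h3 x fun y hy => hx y (Finset.mem_insert_of_mem hy), hx e hee⟩

variable {I : PDInstance} {b : ℕ → ℕ}

/-- The number of jobs before `j` on the machine `i`. -/
def rankOn (I : PDInstance) (M : Finset (Fin I.n × Fin I.m)) (e : Fin I.n × Fin I.m) : ℕ :=
  ((I.jobsOn M e.2).filter fun j => j < e.1).card

theorem rankOn_lt {M : Finset (Fin I.n × Fin I.m)} {e : Fin I.n × Fin I.m} (he : e ∈ M) :
    rankOn I M e < I.deg M e.2 := by
  apply Finset.card_lt_card
  rw [Finset.ssubset_iff_of_subset (Finset.filter_subset _ _)]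
  exact ⟨e.1, by simp [PDInstance.jobsOn, he], by simp⟩

theorem rankOn_inj {M : Finset (Fin I.n × Fin I.m)} {j j' : Fin I.n} {i : Fin I.m}
    (h1 : (j, i) ∈ M) (h2 : (j', i) ∈ M) (h : rankOn I M (j, i) = rankOn I M (j', i)) : j = j' := by
  have key : ∀ j j' : Fin I.n, (j, i) ∈ M → j < j' → rankOn I M (j, i) < rankOn I M (j', i) := by
    intro j j' h1 hlt
    apply Finset.card_lt_card
    rw [Finset.ssubset_iff_of_subset]
    · exact ⟨j, by simp [PDInstance.jobsOn, h1, hlt], by simp⟩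
    · intro x hx
      simp only [Finset.mem_filter] at *
      exact ⟨hx.1, hx.2.trans hlt⟩
  by_contra hne
  rcases lt_or_gt_of_ne hne with hlt | hlt
  · have := key j j' h1 hlt
    omega
  · have := key j' j h2 hlt
    omega

/-- The matching of the graph that corresponds to the edges `F` of a PD-matching, together with the
edges between the first two copies of the machines in `S`. -/
theorem exists_mate_of_isPDMatching (hb : ∀ (j : Fin I.n) (i : Fin I.m), b (j * I.m + i) = I.b j i)
    {K z cap : ℕ} {M F : Finset (Fin I.n × Fin I.m)} (hM : I.IsPDMatching M) (hFM : F ⊆ M)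
    (S : Finset (Fin I.m)) (hF : ∀ e ∈ F, I.b e.1 e.2 = K ∧ I.deg M e.2 ≤ cap)
    (hS : ∀ i ∈ S, ∀ e ∈ F, e.2 ≠ i) (hS2 : S.Nonempty → z = 0 ∧ 2 ≤ cap) :
    ∃ f, Mate (I.n + cap * I.m) (copyGraph I.n I.m b K z) f ∧
      miss (I.n + cap * I.m) f + 2 * (F.card + S.card) = I.n + cap * I.m := by
  classical
  have hcopy : ∀ q < cap, ∀ i : Fin I.m, I.n + (q * I.m + i) < I.n + cap * I.m := by
    intro q hq i
    have h1 : (q + 1) * I.m ≤ cap * I.m := Nat.mul_le_mul_right _ hq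
    have := i.2
    rw [Nat.succ_mul] at h1
    omega
  have hmod : ∀ (q : ℕ) (i : Fin I.m), (I.n + (q * I.m + i) - I.n) % I.m = i := by
    intro q i
    rw [Nat.add_sub_cancel_left, Nat.mul_comm, Nat.mul_add_mod, Nat.mod_eq_of_lt i.2]
  -- A job of rank `q` on its machine is matched to copy `q`, which exists because ranks are below
  -- the degree and the degree is at most `cap`. Machines in `S` contribute the edge between copies
  -- 0 and 1.
  refine (exists_mate_of_edges (N := I.n + cap * I.m)
    (G := copyGraph I.n I.m b K z) (F.disjSum S)
    (Sum.elim (fun e => e.1.val) (fun i => I.n + (0 * I.m + i.val)))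
    (Sum.elim (fun e => I.n + (rankOn I M e * I.m + e.2.val)) (fun i => I.n + (1 * I.m + i.val)))
    ?_ ?_ ?_ ?_).imp fun f h => ⟨h.1, by rw [← Finset.card_disjSum]; exact h.2.1⟩
  · rintro (e | i) he
    · rw [Finset.inl_mem_disjSum] at he
      simp only [Sum.elim_inl]
      obtain ⟨h1, h2⟩ := hF e he
      have hG : copyGraph I.n I.m b K z e.1.val (I.n + (rankOn I M e * I.m + e.2.val)) :=
        Or.inl ⟨e.1.2, by omega, by rw [hmod, hb, h1]⟩
      exact ⟨by have := e.1.2; omega, hcopy _ ((rankOn_lt (hFM he)).trans_le h2) _, hG,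
        copyGraph_symm hG⟩
    · rw [Finset.inr_mem_disjSum] at he
      simp only [Sum.elim_inr]
      obtain ⟨h1, h2⟩ := hS2 ⟨i, he⟩
      have hG : copyGraph I.n I.m b K z (I.n + (0 * I.m + i.val)) (I.n + (1 * I.m + i.val)) :=
        Or.inr (Or.inr ⟨by omega, by omega, h1, by rw [hmod, hmod], by have := i.2; omega⟩)
      exact ⟨hcopy 0 (by omega) i, hcopy 1 (by omega) i, hG, copyGraph_symm hG⟩
  · rintro (e | i) he (e' | i') he' h
    · rw [Finset.inl_mem_disjSum] at he he'
      have h1 : e.1 = e'.1 := Fin.ext h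
      have h2 : e.2 = e'.2 := hM.1 e.1 e.2 e'.2 (hFM he) (h1 ▸ hFM he')
      rw [Prod.ext h1 h2]
    · have := e.1.2
      simp only [Sum.elim_inl, Sum.elim_inr] at h
      omega
    · have := e'.1.2
      simp only [Sum.elim_inl, Sum.elim_inr] at h
      omega
    · simp only [Sum.elim_inr] at h
      rw [Fin.ext (show i.val = i'.val by omega)]
  · rintro (e | i) he (e' | i') he' h
    · rw [Finset.inl_mem_disjSum] at he he'
      simp only [Sum.elim_inl] at h
      obtain ⟨h1, h2⟩ := RAM.mul_add_inj e.2.2 e'.2.2 (Nat.add_left_cancel h)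
      obtain ⟨j, i⟩ := e
      obtain ⟨j', i'⟩ := e'
      have h3 : i = i' := Fin.ext h2
      subst h3
      rw [rankOn_inj (hFM he) (hFM he') h1]
    · rw [Finset.inl_mem_disjSum] at he
      rw [Finset.inr_mem_disjSum] at he'
      simp only [Sum.elim_inl, Sum.elim_inr] at h
      obtain ⟨h1, h2⟩ := RAM.mul_add_inj e.2.2 i'.2 (Nat.add_left_cancel h)
      exact absurd (Fin.ext h2) (hS i' he' e he)
    · rw [Finset.inl_mem_disjSum] at he'
      rw [Finset.inr_mem_disjSum] at he
      simp only [Sum.elim_inl, Sum.elim_inr] at h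
      obtain ⟨h1, h2⟩ := RAM.mul_add_inj i.2 e'.2.2 (Nat.add_left_cancel h)
      exact absurd (Fin.ext h2.symm) (hS i he e' he')
    · simp only [Sum.elim_inr] at h
      rw [Fin.ext (show i.val = i'.val by omega)]
  · rintro (e | i) he (e' | i') he' h
    · have := e.1.2
      simp only [Sum.elim_inl] at h
      omega
    · have := e.1.2
      simp only [Sum.elim_inl, Sum.elim_inr] at h
      omega
    · rw [Finset.inl_mem_disjSum] at he'
      rw [Finset.inr_mem_disjSum] at he
      simp only [Sum.elim_inl, Sum.elim_inr] at h
      obtain ⟨h1, h2⟩ := RAM.mul_add_inj i.2 e'.2.2 (Nat.add_left_cancel h)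
      exact absurd (Fin.ext h2.symm) (hS i he e' he')
    · simp only [Sum.elim_inr] at h
      obtain ⟨h1, h2⟩ := RAM.mul_add_inj i.2 i'.2 (Nat.add_left_cancel h)
      omega

/-- The edge set given by an assignment of jobs to machines (shifted by one). -/
def edgesOf (I : PDInstance) (J : ℕ → ℕ) : Finset (Fin I.n × Fin I.m) :=
  Finset.univ.filter fun e => J e.1 = e.2 + 1

theorem mem_edgesOf {J : ℕ → ℕ} {j : Fin I.n} {i : Fin I.m} :
    (j, i) ∈ edgesOf I J ↔ J j = i + 1 := by
  simp [edgesOf]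

theorem card_eq_sum_deg (M : Finset (Fin I.n × Fin I.m)) : M.card = ∑ i, I.deg M i := by
  rw [Finset.card_eq_sum_card_fiberwise (f := Prod.snd) (t := Finset.univ) (by simp)]
  refine Finset.sum_congr rfl fun i _ => ?_
  refine Finset.card_bij (fun e _ => e.1) ?_ ?_ ?_
  · rintro ⟨j, i'⟩ h
    simp only [Finset.mem_filter] at h
    obtain ⟨h1, rfl⟩ := h
    simpa [PDInstance.jobsOn] using h1
  · rintro ⟨j, i1⟩ h1 ⟨j', i2⟩ h2 h
    simp only [Finset.mem_filter] at h1 h2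
    simp only at h
    rw [h, h1.2, h2.2]
  · intro j hj
    simp only [PDInstance.jobsOn, Finset.mem_filter, Finset.mem_univ, true_and] at hj
    exact ⟨(j, i), by simp [hj], rfl⟩

theorem card_le_of_isPDMatching {M : Finset (Fin I.n × Fin I.m)} (hM : I.IsPDMatching M) :
    M.card ≤ I.n := by
  have := Finset.card_le_card_of_injOn (s := M) (t := Finset.univ) Prod.fst (by simp)
    (fun e he e' he' h => Prod.ext h (hM.1 e.1 e.2 e'.2 he (by rw [h]; exact he')))
  simpa using this

theorem one_le_deg {M : Finset (Fin I.n × Fin I.m)} {j : Fin I.n} {i : Fin I.m} (h : (j, i) ∈ M) :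
    1 ≤ I.deg M i :=
  Finset.card_pos.2 ⟨j, by simp [PDInstance.jobsOn, h]⟩

theorem copyGraph_job {n m K z j v : ℕ} (hj : j < n) (h : copyGraph n m b K z j v) :
    n ≤ v ∧ b (j * m + (v - n) % m) = K := by
  rcases h with h | h | h
  · exact h.2
  · omega
  · omega

end Reduction

/-! ### Optimality of the two constructions -/

section Optimality

variable {I : PDInstance} {b : ℕ → ℕ}

/-- Copies are independent because `z ≠ 0`, so each matching edge assigns one job, to a machine with
at most `K` copies on which it has tolerance `K`. Conversely, an edge of a PD-matching has positive
tolerance, hence tolerance `K`, so every PD-matching is a matching of the graph. -/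
theorem isMaximumPDMatching_of_zero
    (hb : ∀ (j : Fin I.n) (i : Fin I.m), b (j * I.m + i) = I.b j i) (hm0 : 0 < I.m)
    {K z cap N : ℕ} (hz : z ≠ 0) (hcap : cap = min K (I.n + 1)) (hN : N = I.n + cap * I.m)
    (hK : ∀ j i, I.b j i = 0 ∨ I.b j i = K) {M J : ℕ → ℕ}
    (hM : Mate N (copyGraph I.n I.m b K z) M)
    (hopt : ∀ f, Mate N (copyGraph I.n I.m b K z) f → miss N M ≤ miss N f)
    (hJ : ∀ j < I.n, J j = if I.n ≤ M j then (M j - I.n) % I.m + 1 else 0) :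
    I.IsMaximumPDMatching (edgesOf I J) := by
  have hnN : I.n ≤ N := by omega
  have hmem : ∀ (j : Fin I.n) (i : Fin I.m), (j, i) ∈ edgesOf I J →
      I.n ≤ M j ∧ (M j - I.n) % I.m = i := by
    intro j i h
    rw [mem_edgesOf, hJ j j.2] at h
    split_ifs at h with h1
    exact ⟨h1, by omega⟩
  refine ⟨⟨fun j i i' h1 h2 => ?_, fun j i h => ?_⟩, fun M' hM' => ?_⟩
  · rw [mem_edgesOf] at h1 h2
    exact Fin.ext (by omega)
  · obtain ⟨h1, h2⟩ := hmem j i h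
    have hjN : (j : ℕ) < N := by omega
    have hbK := (copyGraph_job j.2 ((hM j hjN).2.2 (by omega))).2
    rw [h2, hb] at hbK
    rw [hbK]
    have hle : I.deg (edgesOf I J) i ≤ (Finset.range cap).card := by
      -- The quotient is the number of the copy; on the fixed machine `i` it determines the copy and
      -- thereby the job.
      refine Finset.card_le_card_of_injOn (fun j => (M j - I.n) / I.m) ?_ ?_
      · intro x hx
        have hx' : (x, i) ∈ edgesOf I J := by simpa [PDInstance.jobsOn] using hx
        have h3 := (hM x (by omega)).1
        have h4 := (hmem x i hx').1
        simp only [Finset.coe_range, Set.mem_Iio]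
        rw [Nat.div_lt_iff_lt_mul hm0]
        omega
      · intro x hx y hy hxy
        have hx' : (x, i) ∈ edgesOf I J := by simpa [PDInstance.jobsOn] using hx
        have hy' : (y, i) ∈ edgesOf I J := by simpa [PDInstance.jobsOn] using hy
        obtain ⟨h3, h4⟩ := hmem x i hx'
        obtain ⟨h5, h6⟩ := hmem y i hy'
        have h7 := Nat.div_add_mod (M x - I.n) I.m
        have h8 := Nat.div_add_mod (M y - I.n) I.m
        simp only at hxy
        rw [hxy, h4] at h7
        rw [h6] at h8
        have h9 : M x = M y := by omega
        apply Fin.ext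
        rw [← (hM x (by omega)).2.1, h9, (hM y (by omega)).2.1]
    rw [Finset.card_range] at hle
    omega
  · obtain ⟨f, hf, hfm⟩ := exists_mate_of_isPDMatching (cap := cap) (z := z) (K := K) hb hM'
      (Finset.Subset.refl M') ∅ (fun e he => by
        have h1 := one_le_deg (j := e.1) (i := e.2) he
        have h2 := hM'.2 e.1 e.2 he
        have h3 : I.deg M' e.2 ≤ I.n := by
          simpa [PDInstance.deg] using Finset.card_le_univ (I.jobsOn M' e.2)
        have h4 : I.b e.1 e.2 = K := (hK e.1 e.2).resolve_left (by omega)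
        exact ⟨h4, by omega⟩) (by simp) (by simp)
    rw [← hN] at hf hfm
    have h1 := hopt f hf
    -- The matched vertices are the assigned jobs and their partners, so there are at most twice as
    -- many as edges in the output.
    set C := (edgesOf I J).image fun e => e.1.val with hC
    have hCmem : ∀ x < I.n, I.n ≤ M x → x ∈ C := by
      intro x hx h
      rw [hC, Finset.mem_image]
      refine ⟨(⟨x, hx⟩, ⟨(M x - I.n) % I.m, Nat.mod_lt _ hm0⟩), ?_, rfl⟩
      rw [mem_edgesOf, hJ x hx, if_pos h]
    have hcov : (Finset.range N).filter (fun x => ¬ M x = x) ⊆ C ∪ C.image M := by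
      intro x hx
      rw [Finset.mem_filter, Finset.mem_range] at hx
      obtain ⟨h2, h3, h4⟩ := hM x hx.1
      rw [Finset.mem_union]
      rcases h4 hx.2 with h | h | h
      · exact Or.inl (hCmem x h.1 h.2.1)
      · exact Or.inr (Finset.mem_image.2 ⟨M x, hCmem _ h.1 (h3.symm ▸ h.2.1), h3⟩)
      · exact absurd h.2.2.1 hz
    have h2 := Finset.card_le_card hcov
    have h3 := Finset.card_union_le C (C.image M)
    have h4 : (C.image M).card ≤ C.card := Finset.card_image_le
    have h5 : C.card ≤ (edgesOf I J).card := Finset.card_image_le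
    have h6 := Finset.card_filter_add_card_filter_not (s := Finset.range N) (fun x => M x = x)
    rw [Finset.card_range] at h6
    change miss N M + _ = N at h6
    simp only [Finset.card_empty] at hfm
    omega

theorem eq_or_eq_add_of_mod_eq {m v i : ℕ} (hv : v < 2 * m) (h : v % m = i) :
    v = i ∨ v = m + i := by
  by_cases h1 : v < m
  · rw [Nat.mod_eq_of_lt h1] at h
    exact Or.inl h
  · rw [Nat.mod_eq_sub_mod (by omega), Nat.mod_eq_of_lt (by omega)] at h
    omega

/-- If only one of the two copies `p` and `q` of a machine is matched to a job, the other one is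
missed. -/
theorem missed_copy {n m N : ℕ} {K : ℕ} (hN : N = n + 2 * m) {M : ℕ → ℕ}
    (hM : Mate N (copyGraph n m b K 0) M) {p q i : ℕ} (hi : i < m)
    (hpq : (p = n + i ∧ q = n + m + i) ∨ (q = n + i ∧ p = n + m + i)) (hp : M p < n)
    (hq : n ≤ M q) : M q = q := by
  by_contra hne
  have hqN : q < N := by omega
  obtain ⟨h1, h2, h3⟩ := hM q hqN
  rcases h3 hne with h | h | ⟨-, -, -, h4, h5⟩
  · omega
  · omega
  · have hqm : (q - n) % m = i := by
      rcases hpq with h | h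
      · rw [show q - n = m + i by omega, Nat.add_mod_left, Nat.mod_eq_of_lt hi]
      · rw [show q - n = i by omega, Nat.mod_eq_of_lt hi]
    rw [hqm] at h4
    have h6 : M q = p := by
      rcases eq_or_eq_add_of_mod_eq (by omega) h4.symm with h | h <;> omega
    rw [h6] at h2
    omega

open Classical in
/-- The jobs not matched to machines with two matched copies are at most as many as the missed
vertices. -/
theorem le_miss_add_double {n m N K : ℕ} (hm0 : 0 < m) (hN : N = n + 2 * m) {M : ℕ → ℕ}
    (hM : Mate N (copyGraph n m b K 0) M) :
    n ≤ miss N M +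
      2 * ((Finset.range m).filter fun i => M (n + i) < n ∧ M (n + m + i) < n).card := by
  set S := (Finset.range m).filter fun i => M (n + i) < n ∧ M (n + m + i) < n with hS
  have hcopy : ∀ j < n, n ≤ M j → ∃ i < m, (M j - n) % m = i ∧ (M j = n + i ∨ M j = n + m + i) := by
    intro j hj h
    refine ⟨_, Nat.mod_lt _ hm0, rfl, ?_⟩
    have := (hM j (by omega)).1
    rcases eq_or_eq_add_of_mod_eq (m := m) (v := M j - n) (by omega) rfl with h | h <;> omega
  have hadj : ∀ j < n, M j ≠ j → n ≤ M j := fun j hj h =>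
    (copyGraph_job hj ((hM j (by omega)).2.2 h)).1
  -- A chosen job is the partner of one of the two copies of a machine in `S`.
  have h1 : ((Finset.range n).filter fun j => Chosen n m 0 M j).card ≤
      (S.image (fun i => M (n + i)) ∪ S.image (fun i => M (n + m + i))).card := by
    apply Finset.card_le_card
    intro j hj
    rw [Finset.mem_filter, Finset.mem_range] at hj
    obtain ⟨hj, hc1, hc2⟩ := hj
    obtain ⟨i, hi, h2, h3⟩ := hcopy j hj hc1
    rw [h2] at hc2
    have hiS : i ∈ S := by
      rw [hS, Finset.mem_filter, Finset.mem_range]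
      exact ⟨hi, hc2.resolve_left (by simp)⟩
    have h4 := (hM j (by omega)).2.1
    rw [Finset.mem_union, Finset.mem_image, Finset.mem_image]
    rcases h3 with h3 | h3 <;> rw [h3] at h4
    · exact Or.inl ⟨i, hiS, h4⟩
    · exact Or.inr ⟨i, hiS, h4⟩
  have h2 : ((Finset.range n).filter fun j => ¬ Chosen n m 0 M j).card ≤ miss N M := by
    -- A job that is matched but not chosen is charged to the other copy of its machine: no job has
    -- that copy, and its only other neighbour is taken, so it is missed.
    have hother : ∀ j < n, ¬ Chosen n m 0 M j → M j ≠ j → ∃ q, n ≤ q ∧ q < N ∧ M q = q ∧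
        ((q = M j + m ∧ M j < n + m) ∨ (M j = q + m ∧ q < n + m)) := by
      intro j hj hc hne
      have hc1 := hadj j hj hne
      obtain ⟨i, hi, h2, h3⟩ := hcopy j hj hc1
      have h4 := (hM j (by omega)).2.1
      have h5 : ¬ (M (n + i) < n ∧ M (n + m + i) < n) := fun h => hc ⟨hc1, Or.inr (h2.symm ▸ h)⟩
      rcases h3 with h3 | h3 <;> rw [h3] at h4
      · refine ⟨n + m + i, by omega, by omega, ?_, Or.inl (by omega)⟩
        exact missed_copy hN hM hi (Or.inl ⟨rfl, rfl⟩) (by omega) (by omega)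
      · refine ⟨n + i, by omega, by omega, ?_, Or.inr (by omega)⟩
        exact missed_copy hN hM hi (Or.inr ⟨rfl, rfl⟩) (by omega) (by omega)
    choose! q hq1 hq2 hq3 hq4 using hother
    -- A missed job pays for itself. The charge is injective, as a missed copy determines the other
    -- copy and hence the job matched to it.
    refine Finset.card_le_card_of_injOn (fun j => if M j = j then j else q j) ?_ ?_
    · intro j hj
      simp only [Finset.coe_filter, Finset.mem_range, Set.mem_ofPred_eq] at hj ⊢
      split_ifs with h
      · exact ⟨by omega, h⟩
      · exact ⟨hq2 j hj.1 hj.2 h, hq3 j hj.1 hj.2 h⟩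
    · intro x hx y hy hxy
      simp only [Finset.coe_filter, Finset.mem_range, Set.mem_ofPred_eq] at hx hy hxy
      split_ifs at hxy with h3 h4 h4
      · exact hxy
      · have := hq1 y hy.1 hy.2 h4
        omega
      · have := hq1 x hx.1 hx.2 h3
        omega
      · have h5 := hq4 x hx.1 hx.2 h3
        have h6 := hq4 y hy.1 hy.2 h4
        have h8 := hadj x hx.1 h3
        have h9 := hadj y hy.1 h4
        have h10 := (hM x (by omega)).1
        have h11 := (hM y (by omega)).1
        have h7 : M x = M y := by omega
        rw [← (hM x (by omega)).2.1, h7, (hM y (by omega)).2.1]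
  have h3 := Finset.card_union_le (S.image (fun i => M (n + i))) (S.image (fun i => M (n + m + i)))
  have h4 : (S.image (fun i => M (n + i))).card ≤ S.card := Finset.card_image_le
  have h5 : (S.image (fun i => M (n + m + i))).card ≤ S.card := Finset.card_image_le
  have h6 := Finset.card_filter_add_card_filter_not (s := Finset.range n)
    (fun j => Chosen n m 0 M j)
  rw [Finset.card_range] at h6
  omega

/-- A PD-matching with tolerances one and two yields a matching of the graph. -/
theorem exists_mate_of_isPDMatching_two
    (hb : ∀ (j : Fin I.n) (i : Fin I.m), b (j * I.m + i) = I.b j i)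
    (h12 : ∀ j i, I.b j i = 1 ∨ I.b j i = 2) {M : Finset (Fin I.n × Fin I.m)}
    (hM : I.IsPDMatching M) :
    ∃ f, Mate (I.n + 2 * I.m) (copyGraph I.n I.m b 2 0) f ∧
      miss (I.n + 2 * I.m) f + 2 * M.card ≤ I.n + 2 * I.m := by
  -- Machines of degree two keep their two job edges. Every other machine, even an empty one,
  -- contributes the edge between its copies, which pays for its at most one job.
  obtain ⟨f, hf, hfm⟩ := exists_mate_of_isPDMatching (cap := 2) (z := 0) (K := 2) hb hM
      (Finset.filter_subset (fun e => I.deg M e.2 = 2) M)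
      (Finset.univ.filter fun i => I.deg M i ≠ 2) (fun e he => by
        rw [Finset.mem_filter] at he
        have h2 := hM.2 e.1 e.2 he.1
        have h3 := h12 e.1 e.2
        omega)
      (fun i hi e he h => by
        rw [Finset.mem_filter] at hi he
        rw [h] at he
        exact hi.2 he.2) (fun _ => ⟨rfl, le_refl _⟩)
  refine ⟨f, hf, ?_⟩
  have h1 : ∀ i, I.deg M i ≤ I.deg (M.filter fun e => I.deg M e.2 = 2) i +
      if I.deg M i ≠ 2 then 1 else 0 := by
    intro i
    split_ifs with h
    · by_cases h0 : I.deg M i = 0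
      · omega
      · obtain ⟨j, hj⟩ := Finset.card_pos.1 (Nat.pos_of_ne_zero h0)
        have hj' : (j, i) ∈ M := by simpa [PDInstance.jobsOn] using hj
        have h2 := hM.2 j i hj'
        have h3 := h12 j i
        omega
    · rw [Nat.add_zero]
      apply Finset.card_le_card
      intro j hj
      rw [ne_eq, not_not] at h
      simpa [PDInstance.jobsOn, h] using hj
  have h2 := Finset.sum_le_sum fun i (_ : i ∈ Finset.univ) => h1 i
  rw [Finset.sum_add_distrib, ← card_eq_sum_deg, ← card_eq_sum_deg, ← Finset.card_filter] at h2
  omega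

-- Jobs kept from the matching share machines in pairs and have tolerance two there; any other
-- assigned job is alone, which every tolerance allows. If a job remains free, all `m` machines are
-- used, and the `d` machines with both copies matched to jobs are used twice, so there are at least
-- `m + d` edges. From `n ≤ miss + 2 * d` and `N = n + 2 * m`, the graph matching has at most `m +
-- d` edges, and no PD-matching has more than that.
open Classical in
theorem isMaximumPDMatching_of_one_two
    (hb : ∀ (j : Fin I.n) (i : Fin I.m), b (j * I.m + i) = I.b j i) (hm0 : 0 < I.m)
    (h12 : ∀ j i, I.b j i = 1 ∨ I.b j i = 2) {N : ℕ} (hN : N = I.n + 2 * I.m)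
    {M J0 U0 J U : ℕ → ℕ} (hM : Mate N (copyGraph I.n I.m b 2 0) M)
    (hopt : ∀ f, Mate N (copyGraph I.n I.m b 2 0) f → miss N M ≤ miss N f)
    (hJ0 : ∀ j < I.n, J0 j = if Chosen I.n I.m 0 M j then (M j - I.n) % I.m + 1 else 0)
    (hU0 : ∀ i, U0 i ≠ 0 ↔ ∃ j < I.n, J0 j = i + 1) (hx : Extends I.n I.m J0 U0 J U)
    (hfull : ∀ j < I.n, J j ≠ 0 ∨ ∀ i < I.m, U i ≠ 0) :
    I.IsMaximumPDMatching (edgesOf I J) := by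
  have hdouble : ∀ j < I.n, ∀ i, J0 j = i + 1 → i < I.m ∧ b (j * I.m + i) = 2 ∧
      (j = M (I.n + i) ∨ j = M (I.n + I.m + i)) := by
    intro j hj i h
    rw [hJ0 j hj] at h
    split_ifs at h with hc
    have hi : (M j - I.n) % I.m = i := by omega
    obtain ⟨h1, h2, h3⟩ := hM j (by omega)
    have h4 := (copyGraph_job hj (h3 (by have := hc.1; omega))).2
    have h5 := hc.1
    refine ⟨hi ▸ Nat.mod_lt _ hm0, hi ▸ h4, ?_⟩
    rcases eq_or_eq_add_of_mod_eq (v := M j - I.n) (by omega) hi with h | h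
    · left
      rw [← h2, show I.n + i = M j by omega, h2]
    · right
      rw [← h2, show I.n + I.m + i = M j by omega, h2]
  have hassigned : ∀ j < I.n, J j ≠ 0 → ∃ i < I.m, J j = i + 1 := by
    intro j hj h
    by_cases h0 : J0 j = 0
    · obtain ⟨i, hi, h1, -⟩ := hx.new j hj h0 h
      exact ⟨i, hi, h1⟩
    · obtain ⟨i, hi⟩ := Nat.exists_eq_succ_of_ne_zero h0
      exact ⟨i, (hdouble j hj i hi).1, by rw [hx.keep j h0, hi]⟩
  refine ⟨⟨fun j i i' h1 h2 => ?_, fun j i h => ?_⟩, fun M' hM' => ?_⟩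
  · rw [mem_edgesOf] at h1 h2
    exact Fin.ext (by omega)
  · rw [mem_edgesOf] at h
    by_cases h0 : J0 j = 0
    · have hU : U0 i = 0 := by
        obtain ⟨i', -, h1, h2⟩ := hx.new j j.2 h0 (by omega)
        rwa [show (i : ℕ) = i' by omega]
      have hle : I.deg (edgesOf I J) i ≤ 1 := by
        rw [← Finset.card_singleton j]
        refine Finset.card_le_card fun x hxi => ?_
        have hx' : J x = i + 1 := by simpa [PDInstance.jobsOn, mem_edgesOf] using hxi
        rw [Finset.mem_singleton]
        have hx0 : J0 x = 0 := by
          by_contra hx0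
          exact (hU0 i).2 ⟨x, x.2, by rw [← hx.keep x hx0, hx']⟩ hU
        exact Fin.ext (hx.uniq x x.2 j j.2 hx0 h0 (by omega) (by omega))
      have := h12 j i
      omega
    · have hj : J0 j = i + 1 := by rw [← hx.keep j h0, h]
      obtain ⟨-, h1, -⟩ := hdouble j j.2 i hj
      rw [hb] at h1
      rw [h1]
      calc I.deg (edgesOf I J) i = ((I.jobsOn (edgesOf I J) i).image Fin.val).card :=
            (Finset.card_image_of_injective _ Fin.val_injective).symm
        _ ≤ ({M (I.n + i), M (I.n + I.m + i)} : Finset ℕ).card := by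
            apply Finset.card_le_card
            intro y hy
            obtain ⟨x, hxi, rfl⟩ := Finset.mem_image.1 hy
            have hx' : J x = i + 1 := by simpa [PDInstance.jobsOn, mem_edgesOf] using hxi
            have hx0 : J0 x = i + 1 := by
              by_cases hx0 : J0 x = 0
              · obtain ⟨i', -, h2, h3⟩ := hx.new x x.2 hx0 (by omega)
                have : (i : ℕ) = i' := by omega
                exact absurd (this ▸ h3) ((hU0 i).2 ⟨j, j.2, hj⟩)
              · rw [← hx.keep x hx0, hx']
            rw [Finset.mem_insert, Finset.mem_singleton]
            exact (hdouble x x.2 i hx0).2.2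
        _ ≤ 2 := Finset.card_le_two
  -- If all jobs are placed, the bound by `n` is trivially attained; the graph matters only when
  -- some job is free.
  · by_cases hall : ∀ j < I.n, J j ≠ 0
    · refine (card_le_of_isPDMatching hM').trans ?_
      have h1 : (edgesOf I J).image Prod.fst = Finset.univ := by
        rw [Finset.eq_univ_iff_forall]
        intro j
        obtain ⟨i, hi, h⟩ := hassigned j j.2 (hall j j.2)
        exact Finset.mem_image.2 ⟨(j, ⟨i, hi⟩), by rw [mem_edgesOf, h], rfl⟩
      have h2 : ((edgesOf I J).image Prod.fst).card ≤ (edgesOf I J).card := Finset.card_image_le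
      rw [h1, Finset.card_univ, Fintype.card_fin] at h2
      exact h2
    · push Not at hall
      obtain ⟨j0, hj0, h0⟩ := hall
      have hU := (hfull j0 hj0).resolve_left (by simpa using h0)
      obtain ⟨f, hf, hfm⟩ := exists_mate_of_isPDMatching_two hb h12 hM'
      rw [← hN] at hf hfm
      have h1 := hopt f hf
      have h2 := le_miss_add_double hm0 hN hM
      have hdeg : ∀ i : Fin I.m, (1 + if M (I.n + i) < I.n ∧ M (I.n + I.m + i) < I.n then 1 else 0)
          ≤ I.deg (edgesOf I J) i := by
        intro i
        split_ifs with hd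
        · have hJM : ∀ p, (p = I.n + i ∨ p = I.n + I.m + i) → M p < I.n → J (M p) = i + 1 := by
            intro p hp hlt
            have hpm := (hM p (by omega)).2.1
            have hpi : (p - I.n) % I.m = i := by
              rcases hp with hp | hp
              · rw [show p - I.n = i by omega, Nat.mod_eq_of_lt i.2]
              · rw [show p - I.n = I.m + i by omega, Nat.add_mod_left, Nat.mod_eq_of_lt i.2]
            have : J0 (M p) = i + 1 := by
              rw [hJ0 _ hlt, hpm, if_pos, hpi]
              rw [Chosen, hpm, hpi]
              exact ⟨by omega, Or.inr hd⟩
            rw [hx.keep _ (by omega), this]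
          have hne : M (I.n + i) ≠ M (I.n + I.m + i) := by
            intro h
            have h3 := (hM (I.n + i) (by omega)).2.1
            rw [h, (hM (I.n + I.m + i) (by omega)).2.1] at h3
            omega
          rw [PDInstance.deg, show 1 + 1 = Nat.succ 1 from rfl, Nat.succ_le_iff,
            Finset.one_lt_card]
          refine ⟨⟨_, hd.1⟩, ?_, ⟨_, hd.2⟩, ?_, fun h => hne (Fin.mk.inj h)⟩
          · simpa [PDInstance.jobsOn, mem_edgesOf] using hJM _ (Or.inl rfl) hd.1
          · simpa [PDInstance.jobsOn, mem_edgesOf] using hJM _ (Or.inr rfl) hd.2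
        · obtain ⟨j, hj, h⟩ := (hx.used i i.2).1 (hU i i.2)
          exact one_le_deg (j := ⟨j, hj⟩) (mem_edgesOf.2 h)
      have h3 := Finset.sum_le_sum fun i (_ : i ∈ Finset.univ) => hdeg i
      rw [← card_eq_sum_deg, Finset.sum_add_distrib, Fin.sum_univ_eq_sum_range
        (fun i => if M (I.n + i) < I.n ∧ M (I.n + I.m + i) < I.n then 1 else 0),
        ← Finset.card_filter] at h3
      simp only [Finset.sum_const, Finset.card_univ, Fintype.card_fin, smul_eq_mul, mul_one] at h3
      omega

end Optimality

/-! ### Input encoding and assembly of the theorem -/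

namespace PDInstance

variable (I : PDInstance)

theorem input_zero : I.input 0 0 = I.n := rfl

theorem input_one : I.input 1 0 = I.m := rfl

theorem input_two (j : Fin I.n) (i : Fin I.m) : I.input 2 (j * I.m + i) = I.b j i := by
  have h : I.input 2 (j * I.m + i) = ∑ j' : Fin I.n, ∑ i' : Fin I.m, (if (j : ℕ) * I.m + i = j' * I.m + i' then
    I.b j' i' else 0) := rfl
  rw [h, Finset.sum_eq_single j, Finset.sum_eq_single i, if_pos rfl]
  · intro i' _ hi
    exact if_neg fun h => hi (Fin.ext (RAM.mul_add_inj i.2 i'.2 h).2.symm)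
  · simp
  · intro j' _ hj
    exact Finset.sum_eq_zero fun i' _ =>
      if_neg fun h => hj (Fin.ext (RAM.mul_add_inj i.2 i'.2 h).1.symm)
  · simp

theorem input_of_three_le {a : ℕ} (ha : 3 ≤ a) (c : ℕ) : I.input a c = 0 := by
  rw [input, if_neg (by omega), if_neg (by omega), if_neg (by omega)]

/-- Every tolerance contributes its separator, even a zero, whose `Nat.size` is `0`. -/
theorem mul_le_bitSize : I.n * I.m ≤ I.bitSize := by
  have h : ∑ _j : Fin I.n, ∑ _i : Fin I.m, 1 ≤ ∑ j, ∑ i, (Nat.size (I.b j i) + 1) :=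
    Finset.sum_le_sum fun j _ => Finset.sum_le_sum fun i _ => by omega
  simp only [Finset.sum_const, Finset.card_univ, Fintype.card_fin, smul_eq_mul, mul_one] at h
  rw [bitSize]
  omega

theorem exists_index {p : ℕ} (hp : p < I.n * I.m) :
    ∃ (j : Fin I.n) (i : Fin I.m), p = j * I.m + i := by
  have hm : 0 < I.m := Nat.pos_of_ne_zero fun h => by simp [h] at hp
  refine ⟨⟨p / I.m, (Nat.div_lt_iff_lt_mul hm).2 hp⟩, ⟨p % I.m, Nat.mod_lt _ hm⟩, ?_⟩
  rw [Nat.mul_comm]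
  exact (Nat.div_add_mod p I.m).symm

theorem index_lt (j : Fin I.n) (i : Fin I.m) : (j : ℕ) * I.m + i < I.n * I.m := by
  have h : ((j : ℕ) + 1) * I.m ≤ I.n * I.m := Nat.mul_le_mul_right _ j.2
  rw [Nat.succ_mul] at h
  omega

end PDInstance

theorem RAM.Scanned.tolerances {I : PDInstance} {s : RAM.Memory}
    (h : RAM.Scanned (I.input 2) (I.n * I.m) s) :
    (∀ j i, I.b j i ≤ s arrK 0) ∧ (s arrK 0 = 0 ∨ ∃ j i, I.b j i = s arrK 0) ∧
      (s arrZero 0 ≠ 0 ↔ ∃ j i, I.b j i = 0) := by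
  obtain ⟨-, h1, h2, h3⟩ := h
  have hex : ∀ t, (∃ p < I.n * I.m, I.input 2 p = t) ↔ ∃ j i, I.b j i = t := by
    intro t
    constructor
    · rintro ⟨p, hp, h⟩
      obtain ⟨j, i, rfl⟩ := I.exists_index hp
      exact ⟨j, i, by rw [← I.input_two, h]⟩
    · rintro ⟨j, i, h⟩
      exact ⟨_, I.index_lt j i, by rw [I.input_two, h]⟩
  refine ⟨fun j i => ?_, by rwa [hex] at h2, by rwa [hex] at h3⟩
  rw [← I.input_two]
  exact h1 _ (I.index_lt j i)

theorem mainTheorem6 :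
    MaxPDMatchingInPolyTime
      {I : PDInstance | (∃ k : ℕ, I.toleranceSet = {0, k}) ∨ I.toleranceSet = {1, 2}} := by
  -- The program has two parts because `prepare` computes loop bounds of `mainPart`, and a command
  -- must not change its own bounds. The substituted polynomial bounds `N + 1`, using `cap ≤ n + 1`
  -- and that `n` and `m` are at most the bit size.
  refine ⟨.seq RAM.prepare.compile RAM.mainPart.compile, RAM.prepare.timeBound +
    RAM.mainPart.timeBound.comp (.X + (.X + 1) * .X + 1), fun I hI => ?_⟩
  -- The tolerance set is nonempty, so neither dimension is zero; then `n` and `m` are each at most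
  -- `n * m`, although their own binary encodings are short.
  have hpos : 0 < I.n ∧ 0 < I.m := by
    have hne : I.toleranceSet.Nonempty := by
      rcases hI with ⟨k, h⟩ | h <;> rw [h]
      exacts [⟨0, by simp⟩, ⟨1, by simp⟩]
    obtain ⟨t, j, i, -⟩ := hne
    exact ⟨j.pos, i.pos⟩
  obtain ⟨hn0, hm0⟩ := hpos
  have hsize := I.mul_le_bitSize
  have hnX : I.n ≤ I.bitSize := (Nat.le_mul_of_pos_right _ hm0).trans hsize
  have hmX : I.m ≤ I.bitSize := (Nat.le_mul_of_pos_left _ hn0).trans hsize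
  obtain ⟨hscan, hcap, hN, hB⟩ := RAM.prepare_spec I.input_zero I.input_one
    (by simp [RAM.Scanned, I.input_of_three_le]) _ rfl
  obtain ⟨t1, ht1, hr1⟩ := RAM.Cmd.exists_runs [0, 1] I.bitSize RAM.prepare (by decide) I.input
    (by simp [I.input_zero, I.input_one, hnX, hmX])
  have hfr : ∀ a, a ∉ RAM.prepare.writes → RAM.prepare.den I.input a = I.input a :=
    fun a ha => RAM.Cmd.den_frame _ ha _
  generalize RAM.prepare.den I.input = s at *
  have h0 : s 0 0 = I.n := by rw [hfr 0 (by decide)]; rfl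
  have h1 : s 1 0 = I.m := by rw [hfr 1 (by decide)]; rfl
  have h2 : s 2 = I.input 2 := hfr 2 (by decide)
  have hzero : ∀ a ∈ [3, arrD, arrJob, arrUsed], ∀ x, s a x = 0 := by
    intro a ha x
    rw [hfr a (by revert a; decide)]
    exact I.input_of_three_le (by revert a; decide) x
  have hNX : s arrN 0 ≤ I.bitSize + (I.bitSize + 1) * I.bitSize := by
    rw [hN]
    exact Nat.add_le_add hnX (Nat.mul_le_mul (by omega) hmX)
  have hXX : I.bitSize ≤ (I.bitSize + 1) * I.bitSize := Nat.le_mul_of_pos_left _ (by omega)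
  obtain ⟨t2, ht2, hr2⟩ := RAM.Cmd.exists_runs [0, 1, arrN, arrB, arrCap]
    (I.bitSize + (I.bitSize + 1) * I.bitSize + 1) RAM.mainPart (by decide) s (by
      simp only [List.mem_cons, List.not_mem_nil, or_false, forall_eq_or_imp, forall_eq]
      omega)
  refine ⟨_, _, hr1.seq hr2, ?_, ?_⟩
  · simp only [Polynomial.eval_add, Polynomial.eval_comp, Polynomial.eval_mul, Polynomial.eval_X,
      Polynomial.eval_one]
    exact Nat.add_le_add ht1 ht2
  obtain ⟨M, J0, U0, J, U, hM, hopt, hJ0, hU0, hJz, hJ, hout⟩ :=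
    RAM.mainPart_spec h0 h1 hm0 rfl hN hB hzero
  refine ⟨edgesOf I J, ?_, fun j i => ?_⟩
  · rw [h2] at hM hopt
    obtain ⟨hle, hatt, hz⟩ := hscan.tolerances
    have hT : ∀ t, (∃ j i, I.b j i = t) ↔ t ∈ I.toleranceSet := fun t => Iff.rfl
    have hmem : ∀ j i, I.b j i ∈ I.toleranceSet := fun j i => ⟨j, i, rfl⟩
    rcases hI with ⟨k, hI⟩ | hI
    · have hz0 : s arrZero 0 ≠ 0 := hz.2 ((hT 0).2 (by simp [hI]))
      refine isMaximumPDMatching_of_zero I.input_two hm0 hz0 hcap hN (fun j i => ?_) hM hopt ?_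
      · rw [hT, hI] at hatt
        have h3 := hmem j i
        have h4 := hle j i
        rw [hI] at h3
        simp only [Set.mem_insert_iff, Set.mem_singleton_iff] at h3 hatt
        omega
      · rw [hJz hz0]
        simpa [Chosen, hz0] using hJ0
    · have hz0 : s arrZero 0 = 0 := by
        by_contra h
        have := hz.1 h
        rw [hT, hI] at this
        simp at this
      have hK : s arrK 0 = 2 := by
        obtain ⟨j, i, h3⟩ := (hT 2).2 (by simp [hI])
        have h4 := hle j i
        rw [hT, hI] at hatt
        simp only [Set.mem_insert_iff, Set.mem_singleton_iff] at hatt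
        omega
      have hcap2 : s arrCap 0 = 2 := by rw [hcap, hK]; exact min_eq_left (Nat.succ_le_succ hn0)
      rw [hz0, hK] at hM hopt
      rw [hz0] at hJ0
      rw [hcap2] at hN
      refine isMaximumPDMatching_of_one_two I.input_two hm0 (fun j i => ?_) hN hM hopt hJ0 hU0
        (hJ hz0).1 (hJ hz0).2
      have h3 := hmem j i
      rw [hI] at h3
      simpa using h3
  · rw [hout j j.2 i i.2]
    simp only [mem_edgesOf]
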